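/- A conic fibration over a field $k$ is a $k$-morphism $f:F\to B$ from a smooth projective (irreducible) surface $F$ over $k$ to a smooth (irreducible) curve $B$ over $k$ whose generic fiber is isomorphic, over the function field $k(B)$, to a plane conic. Two conic fibrations $f:F\to B$ and $f':F'\to B'$ over $k$ are called birational if there are a birational map $\phi:F\dashrightarrow F'$ and an isomorphism $\tau:B\cong B'$, both defined over $k$, such that $f'\circ\phi=\tau\circ f$. **Theorem.** Let $f:F\to\mathbb P^1_{\mathbb R}$ be a conic fibration over $\mathbb R$. Then there are an integer $m\ge 0$, distinct real numbers $a_1,\dots,a_{2m}$, a sign $\varepsilon\in\{1,-1\}$, and a conic fibration $f':F'\to\mathbb P^1_{\mathbb R}$ over $\mathbb R$ such that $f$ and $f'$ are birational as conic fibrations and $f'$ has affine equation $$x^2+y^2=\varepsilon\prod_{i=1}^{2m}(z-a_i)\subset\mathbb A^3,$$ that is, the affine surface in $\mathbb A^3_{\mathbb R}$ with this equation is (isomorphic over $\mathbb R$ to) an open subscheme of $F'$ on which $f'$ is the coordinate $z:\mathbb A^3\to\mathbb A^1\subset\mathbb P^1$. -/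

import Mathlib

open CategoryTheory AlgebraicGeometry MvPolynomial

universe u

noncomputable section

attribute [instance] MvPolynomial.gradedAlgebra

namespace RealConic

/-- The standard grading of `K[x₀, …, xₙ]` by total degree. -/
abbrev grading (n : ℕ) (K : Type u) [CommRing K] :
    ℕ → Submodule K (MvPolynomial (Fin (n + 1)) K) :=
  homogeneousSubmodule (Fin (n + 1)) K

/-- Projective `n`-space over `K`, i.e. `Proj K[x₀, …, xₙ]`. -/
abbrev projSpace (n : ℕ) (K : Type u) [CommRing K] : Scheme.{u} :=
  Proj (grading n K)

/-- The structure morphism `ℙⁿ_K ⟶ Spec K`. -/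
def projSpaceStr (n : ℕ) (K : Type u) [CommRing K] :
    projSpace n K ⟶ Spec (CommRingCat.of K) :=
  Proj.toSpecZero (grading n K) ≫
    Spec.map (CommRingCat.ofHom (algebraMap K (grading n K 0)))

/-- For a form `Q` of degree `2`, the regular function `Q / x_j ^ 2` on the standard affine chart
`D₊(x_j)` of `ℙⁿ_K`. -/
def chartEquation {n : ℕ} {K : Type u} [CommRing K] (Q : MvPolynomial (Fin (n + 1)) K)
    (hQ : Q.IsHomogeneous 2) (j : Fin (n + 1)) :
    Γ(projSpace n K, Proj.basicOpen (grading n K) (X j)) :=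
  Proj.awayToSection (grading n K) (X j)
    (HomogeneousLocalization.Away.mk (grading n K) (d := 1)
      ((mem_homogeneousSubmodule 1 (X j)).mpr (isHomogeneous_X K j)) 2 Q
      ((mem_homogeneousSubmodule _ Q).mpr hQ))

/-- The `K`-scheme `sC : C ⟶ Spec K` is isomorphic over `K` to a plane conic, i.e. to the closed
subscheme of `ℙ²_K` defined by a nonzero quadratic form `Q`: there is a closed immersion
`C ⟶ ℙ²_K` over `K` whose ideal on each standard chart `D₊(x_j)` is generated by `Q / x_j ^ 2`.
No smoothness is required here. -/
def IsPlaneConic (K : Type u) [Field K] {C : Scheme.{u}} (sC : C ⟶ Spec (CommRingCat.of K)) :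
    Prop :=
  ∃ (Q : MvPolynomial (Fin 3) K) (hQ : Q.IsHomogeneous 2) (i : C ⟶ projSpace 2 K),
    Q ≠ 0 ∧ IsClosedImmersion i ∧ i ≫ projSpaceStr 2 K = sC ∧
      ∀ j : Fin 3,
        RingHom.ker (i.app (Proj.basicOpen (grading 2 K) (X j))).hom =
          Ideal.span {chartEquation Q hQ j}

/-- `sF : F ⟶ Spec k` is projective: `F` is a closed subscheme of some `ℙⁿ_k`. -/
def IsProjectiveOver (k : Type u) [Field k] {F : Scheme.{u}}
    (sF : F ⟶ Spec (CommRingCat.of k)) : Prop :=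
  ∃ (n : ℕ) (i : F ⟶ projSpace n k), IsClosedImmersion i ∧ i ≫ projSpaceStr n k = sF

/-- A smooth projective (irreducible) surface over `k`. -/
structure IsSmoothProjectiveSurface (k : Type u) [Field k] {F : Scheme.{u}}
    (sF : F ⟶ Spec (CommRingCat.of k)) : Prop where
  integral : IsIntegral F
  smooth : SmoothOfRelativeDimension 2 sF
  projective : IsProjectiveOver k sF

/-- A smooth (irreducible) curve over `k`. -/
structure IsSmoothCurve (k : Type u) [Field k] {B : Scheme.{u}}
    (sB : B ⟶ Spec (CommRingCat.of k)) : Prop where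
  integral : IsIntegral B
  smooth : SmoothOfRelativeDimension 1 sB
  separated : IsSeparated sB
  quasiCompact : QuasiCompact sB

/-- `f : F ⟶ B` is a conic fibration over `k`: a `k`-morphism from a smooth projective surface to
a smooth curve whose generic fiber is isomorphic to a plane conic over the function field of `B`
(the residue field of the generic point). -/
structure IsConicFibration (k : Type u) [Field k] {F B : Scheme.{u}}
    (sF : F ⟶ Spec (CommRingCat.of k)) (sB : B ⟶ Spec (CommRingCat.of k)) (f : F ⟶ B) :
    Prop where
  surface : IsSmoothProjectiveSurface k sF
  curve : IsSmoothCurve k sB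
  comm : f ≫ sB = sF
  genericFiber : ∃ η : B, IsGenericPoint η Set.univ ∧
    IsPlaneConic (B.residueField η) (f.fiberToSpecResidueField η)

/-- The conic fibrations `f : F ⟶ B` and `f' : F' ⟶ B'` over `k` are birational: there are a
birational map `φ` from `F` to `F'` and an isomorphism `τ : B ≅ B'`, both over `k`, with
`f' ∘ φ = τ ∘ f`. -/
def BirationalConicFibrations (k : Type u) [Field k] {F B F' B' : Scheme.{u}}
    (sF : F ⟶ Spec (CommRingCat.of k)) (sB : B ⟶ Spec (CommRingCat.of k)) (f : F ⟶ B)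
    (sF' : F' ⟶ Spec (CommRingCat.of k)) (sB' : B' ⟶ Spec (CommRingCat.of k)) (f' : F' ⟶ B') :
    Prop :=
  ∃ (φ : F.PartialIso F') (τ : B ≅ B'),
    φ.IsOver sF sF' ∧ τ.hom ≫ sB' = sB ∧ φ.IsOver (f ≫ τ.hom) f'

/-- For a `k`-algebra `R` and `z : R`, the morphism `(z : 1) : Spec R ⟶ ℙ¹_k`, i.e. the composite
of `z : Spec R ⟶ 𝔸¹_k` with the standard open immersion `𝔸¹_k ⟶ ℙ¹_k`. -/
def toP1 (k : Type u) [CommRing k] {R : Type u} [CommRing R] [Algebra k R] (z : R) :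
    Spec (CommRingCat.of R) ⟶ projSpace 1 k :=
  Proj.fromOfGlobalSections (grading 1 k)
    ((Scheme.ΓSpecIso (CommRingCat.of R)).inv.hom.comp (aeval ![z, 1] : _ →ₐ[k] R).toRingHom)
    (by
      rw [Ideal.eq_top_iff_one]
      have hX : (X 1 : MvPolynomial (Fin 2) k) ∈
          (HomogeneousIdeal.irrelevant (grading 1 k)).toIdeal := by
        refine (HomogeneousIdeal.mem_irrelevant_iff (grading 1 k) _).mpr ?_
        exact DirectSum.decompose_of_mem_ne _
          ((mem_homogeneousSubmodule 1 (X 1)).mpr (isHomogeneous_X k 1)) one_ne_zero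
      have h := Ideal.mem_map_of_mem ((Scheme.ΓSpecIso (CommRingCat.of R)).inv.hom.comp
        (aeval ![z, 1] : _ →ₐ[k] R).toRingHom) hX
      simpa using h)

/-- The polynomial `x ^ 2 + y ^ 2 - ε * ∏ i, (z - a i)` in the variables
`x = X 0`, `y = X 1`, `z = X 2`. -/
def standardPoly {ι : Type} [Fintype ι] (ε : ℝ) (a : ι → ℝ) : MvPolynomial (Fin 3) ℝ :=
  X 0 ^ 2 + X 1 ^ 2 - C ε * ∏ i, (X 2 - C (a i))

/-- The coordinate ring of the affine surface `x ^ 2 + y ^ 2 = ε * ∏ i, (z - a i)` in `𝔸³`. -/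
abbrev StandardRing {ι : Type} [Fintype ι] (ε : ℝ) (a : ι → ℝ) : Type :=
  MvPolynomial (Fin 3) ℝ ⧸ Ideal.span {standardPoly ε a}

/-- `f' : F' ⟶ ℙ¹` has affine equation `x ^ 2 + y ^ 2 = ε * ∏ i, (z - a i)`: the affine surface in
`𝔸³` with this equation is an open subscheme of `F'` over `ℝ`, and on it `f'` is the coordinate
`z : 𝔸³ ⟶ 𝔸¹ ⊆ ℙ¹`. -/
def HasStandardAffineEquation {ι : Type} [Fintype ι] {F' : Scheme.{0}}
    (sF' : F' ⟶ Spec (CommRingCat.of ℝ)) (f' : F' ⟶ projSpace 1 ℝ) (ε : ℝ) (a : ι → ℝ) : Prop :=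
  ∃ j : Spec (CommRingCat.of (StandardRing ε a)) ⟶ F',
    IsOpenImmersion j ∧
      j ≫ sF' = Spec.map (CommRingCat.ofHom (algebraMap ℝ (StandardRing ε a))) ∧
      j ≫ f' = toP1 ℝ (Ideal.Quotient.mk (Ideal.span {standardPoly ε a}) (X 2))

end RealConic

end

/-! Let `K` be the residue field of the generic point of the line, a copy of ℝ(t), and let `L` be
the function field of `F`. Up to birational equivalence the fibration is the extension `K ⊆ L`. The
theorem is therefore a normal form for this extension, followed by the construction of a smooth
projective model.

Normal form. The generic fibre is a conic `Q = 0` over `K`, and its inclusion into the smooth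
surface `F` is a preimmersion. This forces `Q` to be nondegenerate: at a singular point there would
be three independent first-order directions, two in the plane of the conic and one along the base
(`det_ne_zero_of_isPreimmersion`). By Tsen's theorem `Q` has a nontrivial zero over ℂ(t)
(`exists_isotropic`). The real and imaginary parts of that zero are orthogonal vectors of equal
value, so `Q` is similar to ⟨1, 1, -g⟩ (`exists_diagonal`), and `L = K(x, y)` with `x² + y² = g`.
Multiplying `x + iy` by elements of `K(i)` changes `g` by sums of two squares. Real irreducible
quadratics are such sums up to sign, so a signed product of distinct linear factors remains
(`exists_squareClass`). If their number is odd, a coordinate `t = 1 / (z - c)` with `c` not a root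
makes the old point at infinity an additional root (`IsStandardPoint.exists_even`).

Model. For degree `2m`, the surface `x² + y² = G(z)` and its counterpart in the coordinates `x /
zᵐ`, `y / zᵐ`, `1 / z` glue to a conic bundle, realised as the closure in ℙ⁷ of a single `L`-point.
Separability of the two polynomials gives smoothness (`exists_conicFibration`).

Schemes are compared through `Spec L`. A chart is a subring of `L` whose spectrum is an open
subscheme containing the given `L`-point. Morphisms from reduced schemes to separated ones are
determined on a dense `Spec L`, so gluing and isomorphism reduce to equalities of subrings
(`ChartCover.exists_hom`, `ChartCover.exists_iso`). For birationality, two finitely generated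
subrings with fraction field `L` become equal after inverting finitely many elements
(`exists_partialIso_of_hasFractions`). -/

noncomputable section

namespace RealConic

/-! ### Morphisms to Proj computed on one chart -/

section fromOfGlobalSections
variable {σ : Type*} {A : Type u}
variable [CommRing A] [SetLike σ A] [AddSubgroupClass σ A]
variable (𝒜 : ℕ → σ) [GradedRing 𝒜] {R : Type u} [CommRing R]

/-- The ring homomorphism `A_(s) → R` induced by `φ : A → R` with `φ s` invertible. -/
def awayLift (φ : A →+* R) (s : A) (hs : IsUnit (φ s)) :
    HomogeneousLocalization.Away 𝒜 s →+* R :=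
  (IsLocalization.Away.lift (S := Localization.Away s) s hs).comp
    (algebraMap (HomogeneousLocalization.Away 𝒜 s) (Localization.Away s))

lemma awayLift_mk (φ : A →+* R) {s : A} {d : ℕ} (hd : s ∈ 𝒜 d) (hs : IsUnit (φ s)) (n : ℕ)
    (a : A) (ha : a ∈ 𝒜 (n • d)) :
    awayLift 𝒜 φ s hs (HomogeneousLocalization.Away.mk 𝒜 hd n a ha) * φ s ^ n = φ a := by
  have h : φ s ^ n = IsLocalization.Away.lift (S := Localization.Away s) s hs
      (algebraMap A (Localization.Away s) (s ^ n)) := by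
    rw [IsLocalization.Away.lift_eq, map_pow]
  have h' : φ a = IsLocalization.Away.lift (S := Localization.Away s) s hs
      (algebraMap A (Localization.Away s) a) := by
    rw [IsLocalization.Away.lift_eq]
  rw [awayLift, RingHom.comp_apply, h, h', ← map_mul]
  congr 1
  rw [HomogeneousLocalization.algebraMap_apply, HomogeneousLocalization.Away.val_mk,
    Localization.mk_eq_mk', IsLocalization.mk'_spec]

/-- Since `φ s` is invertible, one piece of the cover used for gluing is already all of `Spec R`, so
the glued morphism is given by the formula on that piece. -/
lemma fromOfGlobalSections_eq_of_isUnit (φ : A →+* R)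
    (hφ : (HomogeneousIdeal.irrelevant 𝒜).toIdeal.map
      ((Scheme.ΓSpecIso (.of R)).inv.hom.comp φ) = ⊤)
    {s : A} {d : ℕ} (hd : s ∈ 𝒜 d) (h0 : 0 < d) (hs : IsUnit (φ s)) :
    Proj.fromOfGlobalSections 𝒜 ((Scheme.ΓSpecIso (.of R)).inv.hom.comp φ) hφ =
      Spec.map (CommRingCat.ofHom (awayLift 𝒜 φ s hs)) ≫ Proj.awayι 𝒜 s hd h0 := by
  set f := ((Scheme.ΓSpecIso (.of R)).inv.hom.comp φ) with hf
  have hu : IsUnit (f s) := hs.map (Scheme.ΓSpecIso (.of R)).inv.hom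
  have htop : (Spec (.of R)).basicOpen (f s) = ⊤ := Scheme.basicOpen_of_isUnit _ hu
  have : IsIso ((Spec (.of R)).basicOpen (f s)).ι := by
    have (U : (Spec (.of R)).Opens) (hU : U = ⊤) : IsIso U.ι := by
      subst hU
      rw [← Scheme.topIso_hom]
      infer_instance
    exact this _ htop
  rw [← cancel_epi ((Spec (.of R)).basicOpen (f s)).ι]
  refine ((Proj.openCoverOfMapIrrelevantEqTop 𝒜 f hφ).ι_glueMorphisms
    (fun ri ↦ Proj.toBasicOpenOfGlobalSections 𝒜 f rfl ri.2.2.1 ri.2.2.2 ≫ Scheme.Opens.ι _)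
    _ ⟨d, s, h0, hd⟩).trans ?_
  simp only [Proj.toBasicOpenOfGlobalSections, Category.assoc]
  let ψ : Localization.Away (f s) →+* R :=
    IsLocalization.Away.lift (g := (Scheme.ΓSpecIso (.of R)).hom.hom) (f s)
      (hu.map (Scheme.ΓSpecIso (.of R)).hom.hom)
  have hψ : ψ.comp (algebraMap _ _) = (Scheme.ΓSpecIso (.of R)).hom.hom :=
    IsLocalization.Away.lift_comp _ _
  have h1 : ((Spec (.of R)).basicOpen (f s)).ι ≫ Spec.map (CommRingCat.ofHom ψ) =
      ((Spec (.of R)).isoOfEq ((Spec (.of R)).toSpecΓ_preimage_basicOpen (f s))).inv ≫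
      (Spec (.of R)).toSpecΓ ∣_ _ ≫ (basicOpenIsoSpecAway _).hom := by
    rw [← cancel_mono (Spec.map (CommRingCat.ofHom
      (algebraMap Γ(Spec (.of R), ⊤) (Localization.Away (f s)))))]
    simp only [Category.assoc, ← Spec.map_comp, ← CommRingCat.ofHom_comp, hψ,
      basicOpenIsoSpecAway_hom_SpecMap, CommRingCat.ofHom_hom, SpecMap_ΓSpecIso_hom]
    refine Eq.trans ?_ (congrArg (_ ≫ ·) (morphismRestrict_ι (Spec (.of R)).toSpecΓ
      (PrimeSpectrum.basicOpen (f s))).symm)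
    exact (Scheme.isoOfEq_inv_ι_assoc _ _ _).symm
  have h2 : (IsLocalization.Away.lift (S := Localization.Away s) (g := φ) s hs) =
      ψ.comp (IsLocalization.map (M := .powers s) (T := .powers (f s)) (Localization.Away (f s)) f
        (by rw [← Submonoid.map_le_iff_le_comap, Submonoid.map_powers])) := by
    refine IsLocalization.ringHom_ext (M := .powers s) ?_
    ext a
    simp only [RingHom.comp_apply, IsLocalization.map_eq, IsLocalization.Away.lift_eq]
    rw [← RingHom.comp_apply, hψ]
    simp [hf]
  have h3 : Spec.map (CommRingCat.ofHom (awayLift 𝒜 φ s hs)) =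
      Spec.map (CommRingCat.ofHom ψ) ≫ Spec.map (CommRingCat.ofHom ((IsLocalization.map
        (M := .powers s) (T := .powers (f s)) (Localization.Away (f s)) f
        (by rw [← Submonoid.map_le_iff_le_comap, Submonoid.map_powers])).comp
        (algebraMap (HomogeneousLocalization.Away 𝒜 s) (Localization.Away s)))) := by
    rw [← Spec.map_comp, ← CommRingCat.ofHom_comp, awayLift, h2, RingHom.comp_assoc]
  rw [h3, Category.assoc, reassoc_of% h1]
  rfl

end fromOfGlobalSections

/-! ### Points of projective space in homogeneous coordinates -/

section projPoint

variable (n : ℕ) (K : Type u) [CommRing K] {R : Type u} [CommRing R] [Algebra K R]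

lemma X_mem_grading (j : Fin (n + 1)) : (X j : MvPolynomial (Fin (n + 1)) K) ∈ grading n K 1 :=
  (mem_homogeneousSubmodule 1 (X j)).mpr (isHomogeneous_X K j)

variable {n}

/-- Evaluation of degree-zero fractions `P / x_j ^ d` at a vector `v` with `v j` invertible. -/
def chartHom (j : Fin (n + 1)) (v : Fin (n + 1) → R) (hj : IsUnit (v j)) :
    HomogeneousLocalization.Away (grading n K) (X j) →+* R :=
  awayLift (grading n K) (aeval v : _ →ₐ[K] R).toRingHom (X j) (by simpa using hj)

/-- The `R`-point of `ℙⁿ_K` with homogeneous coordinates `v`, when `v j` is invertible. -/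
def projPoint (j : Fin (n + 1)) (v : Fin (n + 1) → R) (hj : IsUnit (v j)) :
    Spec (.of R) ⟶ projSpace n K :=
  Spec.map (CommRingCat.ofHom (chartHom K j v hj)) ≫
    Proj.awayι (grading n K) (X j) (X_mem_grading n K j) one_pos

variable {K}

lemma chartHom_mk (j : Fin (n + 1)) (v : Fin (n + 1) → R) (hj : IsUnit (v j)) (d : ℕ)
    (P : MvPolynomial (Fin (n + 1)) K) (hP : P ∈ grading n K (d • 1)) :
    chartHom K j v hj (.mk (grading n K) (X_mem_grading n K j) d P hP) * v j ^ d = aeval v P := by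
  have := awayLift_mk (grading n K) (aeval v : _ →ₐ[K] R).toRingHom (X_mem_grading n K j)
    (by simpa using hj) d P hP
  have hX : (aeval v : _ →ₐ[K] R).toRingHom (X j) ^ d = v j ^ d := congrArg (· ^ d) (aeval_X v j)
  exact (congrArg (_ * ·) hX.symm).trans this

omit [Algebra K R] in
lemma chartHom_ext (j : Fin (n + 1)) (φ ψ : HomogeneousLocalization.Away (grading n K) (X j) →+* R)
    (h : ∀ d P hP, φ (.mk (grading n K) (X_mem_grading n K j) d P hP) =
      ψ (.mk (grading n K) (X_mem_grading n K j) d P hP)) : φ = ψ := by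
  ext a
  obtain ⟨d, P, hP, rfl⟩ := a.mk_surjective _ (X_mem_grading n K j)
  exact h d P hP

lemma X_mem_irrelevant (j : Fin (n + 1)) :
    (X j : MvPolynomial (Fin (n + 1)) K) ∈
      (HomogeneousIdeal.irrelevant (grading n K)).toIdeal :=
  (HomogeneousIdeal.mem_irrelevant_iff (grading n K) _).mpr
    (DirectSum.decompose_of_mem_ne _ (X_mem_grading n K j) one_ne_zero)

lemma map_irrelevant_eq_top (j : Fin (n + 1)) (v : Fin (n + 1) → R) (hj : IsUnit (v j)) :
    (HomogeneousIdeal.irrelevant (grading n K)).toIdeal.map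
      ((Scheme.ΓSpecIso (.of R)).inv.hom.comp (aeval v : _ →ₐ[K] R).toRingHom) = ⊤ := by
  refine Ideal.eq_top_of_isUnit_mem _ (Ideal.mem_map_of_mem _ (X_mem_irrelevant j)) ?_
  have : IsUnit ((aeval v : _ →ₐ[K] R).toRingHom (X j : MvPolynomial (Fin (n + 1)) K)) := by
    simpa using hj
  exact this.map (Scheme.ΓSpecIso (.of R)).inv.hom

lemma projPoint_eq_fromOfGlobalSections (j : Fin (n + 1)) (v : Fin (n + 1) → R)
    (hj : IsUnit (v j)) :
    projPoint K j v hj = Proj.fromOfGlobalSections (grading n K) _ (map_irrelevant_eq_top j v hj) :=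
  (fromOfGlobalSections_eq_of_isUnit _ _ _ (X_mem_grading n K j) one_pos _).symm

/-- Both sides are the chart-free morphism `Proj.fromOfGlobalSections`. This is what allows one
point to be computed on several charts. -/
lemma projPoint_congr_index {i j : Fin (n + 1)} {v : Fin (n + 1) → R} (hi : IsUnit (v i))
    (hj : IsUnit (v j)) : projPoint K i v hi = projPoint K j v hj := by
  rw [projPoint_eq_fromOfGlobalSections, projPoint_eq_fromOfGlobalSections]

lemma comp_projPoint {R' : Type u} [CommRing R'] [Algebra K R'] (φ : R →ₐ[K] R') (j : Fin (n + 1))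
    (v : Fin (n + 1) → R) (hj : IsUnit (v j)) :
    Spec.map (CommRingCat.ofHom φ.toRingHom) ≫ projPoint K j v hj =
      projPoint K j (fun i ↦ φ (v i)) (hj.map φ) := by
  rw [projPoint, projPoint, ← Category.assoc, ← Spec.map_comp, ← CommRingCat.ofHom_comp]
  congr 3
  refine chartHom_ext j _ _ fun d P hP ↦ ?_
  refine ((hj.map φ).pow d).mul_right_cancel ?_
  rw [chartHom_mk, RingHom.comp_apply, ← map_pow]
  change φ _ * _ = _
  rw [← map_mul, chartHom_mk]
  exact (comp_aeval_apply v φ P)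

lemma _root_.MvPolynomial.IsHomogeneous.aeval_smul {σ : Type*} {P : MvPolynomial σ K} {d : ℕ}
    (hP : P.IsHomogeneous d) (c : R) (v : σ → R) : aeval (c • v) P = c ^ d * aeval v P := by
  rw [aeval_def, aeval_def, eval₂_eq, eval₂_eq, Finset.mul_sum]
  refine Finset.sum_congr rfl fun m hm ↦ ?_
  have hd : ∑ i ∈ m.support, m i = d := by
    rw [← hP (mem_support_iff.mp hm), Finsupp.weight_apply]
    simp [Finsupp.sum]
  simp only [Pi.smul_apply, smul_eq_mul, mul_pow, Finset.prod_mul_distrib, Finset.prod_pow_eq_pow_sum,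
    hd]
  ring

lemma projPoint_smul (j : Fin (n + 1)) (v w : Fin (n + 1) → R) (c : R) (hw : ∀ i, w i = c * v i)
    (hj : IsUnit (v j)) (hj' : IsUnit (w j)) : projPoint K j w hj' = projPoint K j v hj := by
  rw [projPoint, projPoint]
  congr 3
  refine chartHom_ext j _ _ fun d P hP ↦ ?_
  refine (hj'.pow d).mul_right_cancel ?_
  rw [chartHom_mk, hw j, mul_pow, mul_left_comm, chartHom_mk]
  have hP' : P.IsHomogeneous d := by simpa using (mem_homogeneousSubmodule _ _).mp hP
  have : w = c • v := funext hw
  rw [this, hP'.aeval_smul, mul_comm]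

lemma projPoint_str (j : Fin (n + 1)) (v : Fin (n + 1) → R) (hj : IsUnit (v j)) :
    projPoint K j v hj ≫ projSpaceStr n K = Spec.map (CommRingCat.ofHom (algebraMap K R)) := by
  rw [projPoint, projSpaceStr, Category.assoc, Proj.awayι_toSpecZero_assoc, ← Spec.map_comp,
    ← Spec.map_comp, ← CommRingCat.ofHom_comp, ← CommRingCat.ofHom_comp]
  congr 2
  ext a
  have := awayLift_mk (grading n K) (aeval v : _ →ₐ[K] R).toRingHom (X_mem_grading n K j)
    (by simpa using hj) 0 (C a) (by simp)
  rw [pow_zero, mul_one] at this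
  refine Eq.trans ?_ (this.trans (aeval_C v a))
  rw [chartHom, RingHom.comp_apply, RingHom.comp_apply]
  congr 1

lemma toP1_eq_projPoint (z : R) :
    toP1 K z = projPoint K 1 ![z, 1] (by simp) := by
  rw [projPoint_eq_fromOfGlobalSections]
  rfl

end projPoint

/-! ### Charts around an `L`-point -/

section charts

open Limits

variable {L : Type u} [Field L] {X Y : Scheme.{u}}

/-- The morphism `Spec L ⟶ Spec T` for a subring `T` of a field `L`. -/
abbrev specGen (T : Subring L) : Spec (.of L) ⟶ Spec (.of T) :=
  Spec.map (CommRingCat.ofHom T.subtype)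

instance (T : Subring L) : IsDominant (specGen T) where
  denseRange := by
    have := (PrimeSpectrum.denseRange_comap_iff_ker_le_nilRadical T.subtype).mpr (by
      rw [(RingHom.injective_iff_ker_eq_bot _).mp T.subtype_injective]; exact bot_le)
    exact this

/-- `c : Spec T ⟶ X` is an open subscheme compatible with the `L`-point `q` of `X`. -/
structure IsChart (q : Spec (.of L) ⟶ X) (T : Subring L) (c : Spec (.of T) ⟶ X) : Prop where
  isOpenImmersion : IsOpenImmersion c
  fac : specGen T ≫ c = q

lemma isDominant_of_comp_isOpenImmersion {W X' X : Scheme.{u}} (g : W ⟶ X') (o : X' ⟶ X)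
    [IsOpenImmersion o] [IsDominant (g ≫ o)] : IsDominant g where
  denseRange := by
    have h := (g ≫ o).denseRange
    have h2 := h.preimage o.isOpenEmbedding.isOpenMap
    refine h2.mono ?_
    rintro x ⟨w, hw⟩
    exact ⟨w, o.isOpenEmbedding.injective (by simpa using hw)⟩

/-- Subrings of `L` whose spectra are jointly surjective charts of `X` around the `L`-point `q`. -/
structure ChartCover (q : Spec (.of L) ⟶ X) {ι : Type u} (T : ι → Subring L) where
  map : ∀ i, Spec (.of (T i)) ⟶ X
  isChart : ∀ i, IsChart q (T i) (map i)
  covers : ∀ x, ∃ i, x ∈ Set.range (map i)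

namespace ChartCover

variable {q : Spec (.of L) ⟶ X} {ι : Type u} {T : ι → Subring L} (𝒞 : ChartCover q T)
include 𝒞

/-- The affine open cover underlying a cover by charts. -/
def openCover : X.OpenCover :=
  have := fun i ↦ (𝒞.isChart i).isOpenImmersion
  Scheme.AffineOpenCover.openCover
  { I₀ := ι
    X := fun i ↦ .of (T i)
    f := 𝒞.map
    idx := fun x ↦ (𝒞.covers x).choose
    covers := fun x ↦ (𝒞.covers x).choose_spec }

lemma isReduced : AlgebraicGeometry.IsReduced X := by
  have (i : 𝒞.openCover.I₀) : AlgebraicGeometry.IsReduced (𝒞.openCover.X i) := by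
    change AlgebraicGeometry.IsReduced (Spec (.of (T i)))
    infer_instance
  exact IsReduced.of_openCover _ 𝒞.openCover

lemma isDominant : IsDominant q where
  denseRange := by
    intro x
    obtain ⟨i, y, rfl⟩ := 𝒞.covers x
    have hq := (𝒞.isChart i).fac
    have := (specGen (T i)).denseRange y
    have := image_closure_subset_closure_image (𝒞.map i).continuous ⟨y, this, rfl⟩
    rw [← Set.range_comp] at this
    convert this using 2
    conv_lhs => rw [← hq]
    rfl

lemma nonempty_index : Nonempty ι :=
  ⟨(𝒞.covers (q default)).choose⟩

/-- The overlap of two charts is reduced and `Spec L` is dominant in it. Morphisms to a separated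
scheme that agree on `Spec L` therefore agree on the overlap, and gluing is automatic. -/
theorem exists_hom [Y.IsSeparated] (ρ : Spec (.of L) ⟶ Y) (φ : ∀ i, Spec (.of (T i)) ⟶ Y)
    (hφ : ∀ i, specGen (T i) ≫ φ i = ρ) :
    ∃ ψ : X ⟶ Y, (∀ i, 𝒞.map i ≫ ψ = φ i) ∧ q ≫ ψ = ρ := by
  have hopen (i : ι) : IsOpenImmersion (𝒞.map i) := (𝒞.isChart i).isOpenImmersion
  have key (i j : ι) : pullback.fst (𝒞.map i) (𝒞.map j) ≫ φ i =
      pullback.snd (𝒞.map i) (𝒞.map j) ≫ φ j := by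
    have hred : IsReduced (pullback (𝒞.map i) (𝒞.map j)) :=
      isReduced_of_isOpenImmersion (pullback.fst (𝒞.map i) (𝒞.map j))
    let l : Spec (.of L) ⟶ pullback (𝒞.map i) (𝒞.map j) :=
      pullback.lift (specGen (T i)) (specGen (T j))
        ((𝒞.isChart i).fac.trans (𝒞.isChart j).fac.symm)
    have hl : l ≫ pullback.fst _ _ = specGen (T i) := pullback.lift_fst _ _ _
    have : IsDominant (l ≫ pullback.fst _ _) := by rw [hl]; infer_instance
    have : IsDominant l := isDominant_of_comp_isOpenImmersion l (pullback.fst _ _)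
    refine ext_of_isDominant l ?_
    rw [← Category.assoc, hl, hφ, ← Category.assoc, pullback.lift_snd, hφ]
  refine ⟨𝒞.openCover.glueMorphisms φ key, fun i ↦ 𝒞.openCover.ι_glueMorphisms φ key i, ?_⟩
  obtain ⟨i⟩ := 𝒞.nonempty_index
  refine (congrArg (· ≫ _) (𝒞.isChart i).fac.symm).trans ?_
  rw [Category.assoc]
  exact (congrArg (_ ≫ ·) (𝒞.openCover.ι_glueMorphisms φ key i)).trans (hφ i)

theorem hom_ext [Y.IsSeparated] {f g : X ⟶ Y} (h : q ≫ f = q ≫ g) : f = g := by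
  have := 𝒞.isReduced
  have := 𝒞.isDominant
  exact ext_of_isDominant q h

/-- The charts of each cover glue to a morphism, and the composites are the identity because they
are so on `Spec L`. Hence a separated scheme with a chart cover is determined by its family of
subrings. -/
theorem exists_iso [X.IsSeparated] [Y.IsSeparated] {q' : Spec (.of L) ⟶ Y}
    (𝒞' : ChartCover q' T) : ∃ e : X ≅ Y, q ≫ e.hom = q' := by
  obtain ⟨ψ, -, h⟩ := 𝒞.exists_hom q' 𝒞'.map fun i ↦ (𝒞'.isChart i).fac
  obtain ⟨ψ', -, h'⟩ := 𝒞'.exists_hom q 𝒞.map fun i ↦ (𝒞.isChart i).fac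
  refine ⟨⟨ψ, ψ', 𝒞.hom_ext ?_, 𝒞'.hom_ext ?_⟩, h⟩
  · rw [reassoc_of% h, h', Category.comp_id]
  · rw [reassoc_of% h', h, Category.comp_id]

end ChartCover

lemma isDominant_specMap_of_injective {A : Type u} [CommRing A] (θ : A →+* L)
    (h : Function.Injective θ) : IsDominant (Spec.map (CommRingCat.ofHom θ)) where
  denseRange := (PrimeSpectrum.denseRange_comap_iff_ker_le_nilRadical θ).mpr (by
    rw [(RingHom.injective_iff_ker_eq_bot _).mp h]; exact bot_le)

lemma injective_of_isDominant_specMap {A : Type u} [CommRing A] [_root_.IsReduced A] (θ : A →+* L)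
    [h : IsDominant (Spec.map (CommRingCat.ofHom θ))] : Function.Injective θ := by
  rw [RingHom.injective_iff_ker_eq_bot, ← le_bot_iff]
  refine le_of_le_of_eq ?_ (nilradical_eq_zero A)
  exact (PrimeSpectrum.denseRange_comap_iff_ker_le_nilRadical θ).mp h.denseRange

/-- An injective ring homomorphism to `L` gives a chart by its range. -/
lemma exists_isChart_of_injective {q : Spec (.of L) ⟶ X} {A : Type u} [CommRing A] (θ : A →+* L)
    (hθ : Function.Injective θ) (a : Spec (.of A) ⟶ X) [IsOpenImmersion a]
    (h : Spec.map (CommRingCat.ofHom θ) ≫ a = q) :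
    ∃ c : Spec (.of θ.range) ⟶ X, IsChart q θ.range c ∧ Set.range c = Set.range a ∧
      Spec.map (CommRingCat.ofHom θ.rangeRestrict) ≫ a = c := by
  have hb : Function.Bijective θ.rangeRestrict :=
    ⟨fun x y hxy ↦ hθ (congrArg Subtype.val hxy), θ.rangeRestrict_surjective⟩
  let e := RingEquiv.ofBijective _ hb
  have : IsIso (CommRingCat.ofHom θ.rangeRestrict) :=
    (inferInstance : IsIso e.toCommRingCatIso.hom)
  refine ⟨Spec.map (CommRingCat.ofHom θ.rangeRestrict) ≫ a, ⟨inferInstance, ?_⟩, ?_, rfl⟩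
  · rw [specGen, ← Category.assoc, ← Spec.map_comp, ← CommRingCat.ofHom_comp, ← h]
    rfl
  · rw [Scheme.Hom.comp_base, TopCat.coe_comp, Set.range_comp,
      Set.range_eq_univ.mpr (Spec.map (CommRingCat.ofHom θ.rangeRestrict)).surjective,
      Set.image_univ]

/-- Sections of the image over affine opens inject into sections of `Spec L`, which gives
reducedness; the closure of the image of one point is irreducible. -/
lemma isIntegral_image (q : Spec (.of L) ⟶ Y) [QuasiCompact q] : IsIntegral q.image := by
  have hred : AlgebraicGeometry.IsReduced q.image := by
    have : IsSchemeTheoreticallyDominant q.toImage := by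
      rw [isSchemeTheoreticallyDominant_iff]
      have hcov : ⨆ U : Y.affineOpens, q.imageι ⁻¹ᵁ U.1 = ⊤ := by
        rw [← Scheme.Hom.preimage_iSup, iSup_affineOpens_eq_top, Scheme.Hom.preimage_top]
      refine Scheme.IdealSheafData.ext_of_iSup_eq_top
        (fun U : Y.affineOpens ↦ ⟨q.imageι ⁻¹ᵁ U.1, U.2.preimage q.imageι⟩) hcov fun U ↦ ?_
      rw [Scheme.Hom.ker_apply]
      exact ((RingHom.injective_iff_ker_eq_bot _).mp (q.toImage_app_injective U))
    exact IsSchemeTheoreticallyDominant.isReduced q.toImage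
  have : IrreducibleSpace q.image := by
    have h : IsIrreducible (closure (Set.range q.toImage)) := by
      rw [← Set.image_univ]
      exact ((IrreducibleSpace.isIrreducible_univ _).image _
        q.toImage.continuous.continuousOn).closure
    rw [q.toImage.denseRange.closure_range] at h
    exact (irreducibleSpace_def _).mpr h
  exact isIntegral_of_irreducibleSpace_of_isReduced _

/-- Over `Spec A` the image is `Spec (A / I)`. This ring is reduced and `Spec L` is dominant in its
spectrum, so `A / I` embeds into `L`, with the same range as `θ`. -/
theorem exists_isChart_image (q : Spec (.of L) ⟶ Y) [QuasiCompact q] {A : Type u} [CommRing A]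
    (θ : A →+* L) (a : Spec (.of A) ⟶ Y) [IsOpenImmersion a]
    (h : Spec.map (CommRingCat.ofHom θ) ≫ a = q) :
    ∃ c : Spec (.of θ.range) ⟶ q.image, IsChart q.toImage θ.range c ∧
      Set.range c = q.imageι ⁻¹' Set.range a ∧
      c ≫ q.imageι = Spec.map (CommRingCat.ofHom θ.rangeRestrict) ≫ a := by
  have hcl : IsClosedImmersion (pullback.snd q.imageι a) := inferInstance
  obtain ⟨I, e, he⟩ := IsClosedImmersion.Spec_iff.mp hcl
  let p : Spec (.of (A ⧸ I)) ⟶ q.image := e.inv ≫ pullback.fst _ _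
  have hp : IsOpenImmersion p := inferInstance
  have hp' : p ≫ q.imageι = Spec.map (CommRingCat.ofHom (Ideal.Quotient.mk I)) ≫ a := by
    simp only [p, Category.assoc, pullback.condition, he, Iso.inv_hom_id_assoc]
  have := isIntegral_image q
  have hred : AlgebraicGeometry.IsReduced (Spec (.of (A ⧸ I))) := isReduced_of_isOpenImmersion p
  have hred' : _root_.IsReduced (A ⧸ I) := (affine_isReduced_iff (.of (A ⧸ I))).mp hred
  let l : Spec (.of L) ⟶ Spec (.of (A ⧸ I)) :=
    pullback.lift q.toImage (Spec.map (CommRingCat.ofHom θ)) (by simp [h]) ≫ e.hom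
  have hlp : l ≫ p = q.toImage := by
    simp only [l, p, Category.assoc, Iso.hom_inv_id_assoc]
    exact pullback.lift_fst _ _ _
  have hls : l ≫ Spec.map (CommRingCat.ofHom (Ideal.Quotient.mk I)) =
      Spec.map (CommRingCat.ofHom θ) := by
    simp only [l, Category.assoc]
    rw [← he, pullback.lift_snd]
  have : IsDominant (l ≫ p) := by rw [hlp]; infer_instance
  have hl : IsDominant l := isDominant_of_comp_isOpenImmersion l p
  obtain ⟨θ', hlθ⟩ : ∃ θ' : A ⧸ I →+* L, l = Spec.map (CommRingCat.ofHom θ') :=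
    ⟨(Spec.preimage l).hom, by simp⟩
  rw [hlθ] at hls hlp hl
  have hθ' : θ'.comp (Ideal.Quotient.mk I) = θ := by
    rw [← Spec.map_comp] at hls
    exact congrArg CommRingCat.Hom.hom (Spec.map_injective hls)
  have hinj := injective_of_isDominant_specMap θ'
  obtain ⟨c, hc, hr, hc'⟩ := exists_isChart_of_injective θ' hinj p hlp
  have hrange : θ'.range = θ.range := by
    rw [← hθ']
    ext y
    simp only [RingHom.mem_range, RingHom.comp_apply]
    exact ⟨fun ⟨x, hx⟩ ↦ by obtain ⟨x, rfl⟩ := Ideal.Quotient.mk_surjective x; exact ⟨x, hx⟩,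
      fun ⟨x, hx⟩ ↦ ⟨_, hx⟩⟩
  have hpr : Set.range p = q.imageι ⁻¹' Set.range a := by
    rw [Scheme.Hom.comp_base, TopCat.coe_comp, Set.range_comp,
      Set.range_eq_univ.mpr e.inv.surjective, Set.image_univ,
      IsOpenImmersion.range_pullbackFst]
    rfl
  subst hθ'
  -- The subring occurs in the type of the chart, so the equality of ranges is used with a variable
  -- `T` in place of the range.
  have key : ∀ (T : Subring L) (hT : θ'.range = T) (hx : ∀ x, θ' (Ideal.Quotient.mk I x) ∈ T),
      ∃ c : Spec (.of T) ⟶ q.image, IsChart q.toImage T c ∧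
      Set.range c = q.imageι ⁻¹' Set.range a ∧
      c ≫ q.imageι = Spec.map (CommRingCat.ofHom
        ((θ'.comp (Ideal.Quotient.mk I)).codRestrict T hx)) ≫ a := by
    rintro T rfl hx
    refine ⟨c, hc, hr.trans hpr, ?_⟩
    rw [← hc', Category.assoc, hp', ← Category.assoc, ← Spec.map_comp, ← CommRingCat.ofHom_comp]
    rfl
  exact key _ hrange fun x ↦ ⟨x, rfl⟩

end charts

/-! ### Closures of points in projective space -/

section projectiveImage

variable {n : ℕ} {K L : Type u} [Field K] [Field L] [Algebra K L]

/-- The coordinate ring of the `j`-th chart of the closure of the `L`-point `v` of `ℙⁿ_K`. -/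
def ratioRing (K : Type u) [Field K] [Algebra K L] (v : Fin (n + 1) → L) (j : Fin (n + 1)) :
    Subring L :=
  (Algebra.adjoin K (Set.range fun i ↦ v i / v j)).toSubring

lemma chartHom_mk_X (v : Fin (n + 1) → L) (i j : Fin (n + 1)) (hj : v j ≠ 0) (hX) :
    chartHom K j v hj.isUnit (.mk (grading n K) (X_mem_grading n K j) 1 (X i) hX) = v i / v j := by
  have := chartHom_mk (K := K) j v hj.isUnit 1 (X i) hX
  rw [eq_div_iff hj, ← aeval_X (R := K) v i, ← this, pow_one]

lemma chartHom_eq_aeval (v : Fin (n + 1) → L) (j : Fin (n + 1)) (hj : v j ≠ 0) (d : ℕ)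
    (P : MvPolynomial (Fin (n + 1)) K) (hP : P ∈ grading n K (d • 1)) :
    chartHom K j v hj.isUnit (.mk (grading n K) (X_mem_grading n K j) d P hP) =
      aeval (fun i ↦ v i / v j) P := by
  have hP' : P.IsHomogeneous d := by simpa using (mem_homogeneousSubmodule _ _).mp hP
  have h1 := chartHom_mk (K := K) j v hj.isUnit d P hP
  have h2 : v = v j • fun i ↦ v i / v j := by
    ext i; simp [mul_div_cancel₀ _ hj]
  have h3 : aeval v P = v j ^ d * aeval (fun i ↦ v i / v j) P := by
    conv_lhs => rw [h2]
    exact hP'.aeval_smul _ _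
  rw [h3, mul_comm] at h1
  exact mul_left_cancel₀ (pow_ne_zero d hj) h1

lemma range_chartHom (v : Fin (n + 1) → L) (j : Fin (n + 1)) (hj : v j ≠ 0) :
    (chartHom K j v hj.isUnit).range = ratioRing K v j := by
  apply le_antisymm
  · rintro _ ⟨a, rfl⟩
    obtain ⟨d, P, hP, rfl⟩ := a.mk_surjective _ (X_mem_grading n K j)
    rw [chartHom_eq_aeval v j hj]
    change _ ∈ Algebra.adjoin K _
    rw [Algebra.adjoin_range_eq_range_aeval]
    exact ⟨P, rfl⟩
  · intro a ha
    change a ∈ Algebra.adjoin K _ at ha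
    induction ha using Algebra.adjoin_induction with
    | mem x hx =>
      obtain ⟨i, rfl⟩ := hx
      exact ⟨_, chartHom_mk_X v i j hj (X_mem_grading n K i)⟩
    | algebraMap r =>
      refine ⟨.mk (grading n K) (X_mem_grading n K j) 0 (C r) ?_, ?_⟩
      · simp
      · rw [chartHom_eq_aeval v j hj, aeval_C]
    | add x y _ _ hx hy => exact add_mem hx hy
    | mul x y _ _ hx hy => exact mul_mem hx hy

omit [Field K] in
lemma iSup_basicOpen_X (n : ℕ) (K : Type u) [CommRing K] :
    ⨆ k, Proj.basicOpen (grading n K) (X k : MvPolynomial (Fin (n + 1)) K) = ⊤ := by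
  refine Proj.iSup_basicOpen_eq_top' (grading n K) _ (fun i ↦ ⟨1, X_mem_grading n K i⟩) ?_
  rw [eq_top_iff]
  rintro p -
  induction p using MvPolynomial.induction_on with
  | C a =>
    exact Subalgebra.algebraMap_mem _
      (⟨C a, (mem_homogeneousSubmodule 0 _).mpr (isHomogeneous_C _ a)⟩ : grading n K 0)
  | add p q hp hq => exact add_mem hp hq
  | mul_X p i hp => exact mul_mem hp (Algebra.subset_adjoin ⟨i, rfl⟩)

theorem exists_isChart_image_projPoint (v : Fin (n + 1) → L) (j k : Fin (n + 1)) (hj : v j ≠ 0)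
    (hk : v k ≠ 0) :
    ∃ (c : Spec (.of (ratioRing K v k)) ⟶ (projPoint K j v hj.isUnit).image)
      (θ : HomogeneousLocalization.Away (grading n K) (X k) →+* ratioRing K v k),
      IsChart (projPoint K j v hj.isUnit).toImage (ratioRing K v k) c ∧
      Set.range c = (projPoint K j v hj.isUnit).imageι ⁻¹'
        (Proj.basicOpen (grading n K) (X k)) ∧
      (∀ a, (θ a : L) = chartHom K k v hk.isUnit a) ∧
      c ≫ (projPoint K j v hj.isUnit).imageι = Spec.map (CommRingCat.ofHom θ) ≫
        Proj.awayι (grading n K) (X k) (X_mem_grading n K k) one_pos := by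
  obtain ⟨c, hc, hc', hc''⟩ := exists_isChart_image (projPoint K j v hj.isUnit)
    (chartHom K k v hk.isUnit)
    (Proj.awayι (grading n K) (X k) (X_mem_grading n K k) one_pos) (projPoint_congr_index _ _)
  rw [← range_chartHom v k hk]
  refine ⟨c, _, hc, hc'.trans ?_, fun a ↦ ?_, hc''⟩
  · rw [← Proj.opensRange_awayι _ _ (X_mem_grading n K k) one_pos]
    rfl
  · rfl

/-- By `hJ`, on the part of the closure in D₊(x_k) some ratio `x_(J i) / x_k` is invertible, so this
part lies in D₊(x_(J i)). The selected charts thus suffice. -/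
theorem exists_chartCover_image {ι : Type u} (v : Fin (n + 1) → L) (hv : ∀ i, v i ≠ 0)
    (j : Fin (n + 1)) (J : ι → Fin (n + 1))
    (hJ : ∀ k, ∃ i, v k / v (J i) ∈ ratioRing K v k) :
    Nonempty (ChartCover (projPoint K j v (hv j).isUnit).toImage fun i ↦ ratioRing K v (J i)) := by
  set q := projPoint K j v (hv j).isUnit with hq
  choose c θ hc hc' hθ hcθ using fun k ↦
    exists_isChart_image_projPoint (K := K) v j k (hv j) (hv k)
  refine ⟨⟨fun i ↦ c (J i), fun i ↦ hc (J i), fun x ↦ ?_⟩⟩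
  obtain ⟨k, hk⟩ := TopologicalSpace.Opens.mem_iSup.mp
    ((iSup_basicOpen_X n K).ge (Set.mem_univ (q.imageι x)))
  obtain ⟨i, hi⟩ := hJ k
  refine ⟨i, ?_⟩
  rw [hc']
  have hxk : x ∈ Set.range (c k) := by rw [hc']; exact hk
  obtain ⟨y, rfl⟩ := hxk
  have h1 : q.imageι (c k y) = Proj.awayι (grading n K) (X k) (X_mem_grading n K k) one_pos
      (Spec.map (CommRingCat.ofHom (θ k)) y) := by
    rw [← Scheme.Hom.comp_apply, hcθ, Scheme.Hom.comp_apply]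
  rw [Set.mem_preimage, h1]
  change Spec.map (CommRingCat.ofHom (θ k)) y ∈ Proj.awayι (grading n K) (X k)
    (X_mem_grading n K k) one_pos ⁻¹ᵁ Proj.basicOpen (grading n K) (X (J i))
  rw [Proj.awayι_preimage_basicOpen _ (X_mem_grading n K k) one_pos (X_mem_grading n K (J i))
    one_pos]
  change θ k _ ∉ y.asIdeal
  intro hmem
  refine y.2.ne_top (Ideal.eq_top_of_isUnit_mem _ hmem (.of_mul_eq_one ⟨_, hi⟩ ?_))
  ext
  change (θ k _ : L) * (v k / v (J i)) = 1
  rw [hθ, chartHom_eq_aeval v k (hv k)]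
  have h2 := hv k
  have h3 := hv (J i)
  simp
  field_simp

end projectiveImage

/-! ### Charts of the fibres of a morphism -/

section fiber
open Limits TensorProduct

/-- The residue field is the fraction field of `R` modulo a prime; the last clause records the
denominators. -/
lemma exists_specMap_eq_fromSpecResidueField {P : Scheme.{u}} {R : Type u} [CommRing R]
    (a : Spec (.of R) ⟶ P) [IsOpenImmersion a] (y : P) (hy : y ∈ Set.range a) :
    ∃ φ : R →+* P.residueField y,
      Spec.map (CommRingCat.ofHom φ) ≫ a = P.fromSpecResidueField y ∧
      ∀ s, ∃ r t, φ t ≠ 0 ∧ s * φ t = φ r := by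
  obtain ⟨p, rfl⟩ := hy
  have hp : p.asIdeal.IsPrime := PrimeSpectrum.isPrime (R := R) p
  have hiso : IsIso (a.residueFieldMap p) := inferInstance
  let e := (asIso (a.residueFieldMap p)).commRingCatIsoToRingEquiv
  let ι := (Scheme.Spec.residueFieldIso (.of R) p).commRingCatIsoToRingEquiv
  let φ : R →+* P.residueField (a p) :=
    (e.symm.toRingHom.comp ι.symm.toRingHom).comp (algebraMap R p.asIdeal.ResidueField)
  refine ⟨φ, ?_, fun s ↦ ?_⟩
  · have h1 := a.SpecMap_residueFieldMap_fromSpecResidueField p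
    have h2 := Scheme.Spec.map_residueFieldIso_inv_eq_fromSpecResidueField (.of R) p
    have h3 : Spec.map (inv (a.residueFieldMap p)) ≫ Spec.map (a.residueFieldMap p) = 𝟙 _ := by
      rw [← Spec.map_comp, IsIso.hom_inv_id, Spec.map_id]
    rw [← Category.id_comp (P.fromSpecResidueField _), ← h3, Category.assoc, h1, ← h2,
      ← Category.assoc, ← Category.assoc, ← Spec.map_comp, ← Spec.map_comp]
    rfl
  · obtain ⟨r, t, ht, h⟩ := IsFractionRing.div_surjective (A := R ⧸ p.asIdeal) (ι (e s))
    obtain ⟨r, rfl⟩ := Ideal.Quotient.mk_surjective r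
    obtain ⟨t, rfl⟩ := Ideal.Quotient.mk_surjective t
    have ht0 : algebraMap R p.asIdeal.ResidueField t ≠ 0 := by
      intro h0
      have := nonZeroDivisors.ne_zero ht
      rw [Ne, Ideal.Quotient.eq_zero_iff_mem] at this
      exact this (by simpa using h0)
    have ht' : φ t ≠ 0 := by
      intro h0
      have h1 : e.symm (ι.symm (algebraMap R p.asIdeal.ResidueField t)) = 0 := h0
      exact ht0 (by simpa using h1)
    refine ⟨r, t, ht', ?_⟩
    change _ * e.symm (ι.symm (algebraMap R p.asIdeal.ResidueField t)) =
      e.symm (ι.symm (algebraMap R p.asIdeal.ResidueField r))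
    apply e.injective
    apply ι.injective
    rw [map_mul, map_mul, ← h]
    simp only [RingEquiv.apply_symm_apply]
    exact div_mul_cancel₀ _ ht0

variable {L : Type u} [Field L]

/-- The fibre of the chart is the spectrum of the tensor product of `T` and κ(y) over `R`. A common
denominator makes every tensor pure, with second factor the inverse of an element of `R`. Hence the
map to the field `L` is injective, with image the ring generated by `T` and κ(y). -/
theorem exists_isChart_fiber {X P : Scheme.{u}} (f : X ⟶ P) (q : Spec (.of L) ⟶ X) (y : P)
    (σ : P.residueField y →+* L)
    (hσ : q ≫ f = Spec.map (CommRingCat.ofHom σ) ≫ P.fromSpecResidueField y)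
    {R : Type u} [CommRing R] (a : Spec (.of R) ⟶ P) [IsOpenImmersion a] (hy : y ∈ Set.range a)
    (T : Subring L) (c : Spec (.of T) ⟶ X) (hc : IsChart q T c)
    (hca : Set.range (c ≫ f) ⊆ Set.range a) :
    ∃ c' : Spec (.of (T ⊔ σ.range : Subring L)) ⟶ f.fiber y,
      IsChart (pullback.lift q (Spec.map (CommRingCat.ofHom σ)) hσ : _ ⟶ f.fiber y) _ c' ∧
      Set.range c' = f.fiberι y ⁻¹' Set.range c := by
  obtain ⟨φ, hφ, hfrac⟩ := exists_specMap_eq_fromSpecResidueField a y hy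
  have hψ' : IsOpenImmersion.lift a (c ≫ f) hca ≫ a = c ≫ f := IsOpenImmersion.lift_fac _ _ _
  obtain ⟨ψ, hψ0⟩ : ∃ ψ : R →+* T,
      Spec.map (CommRingCat.ofHom ψ) = IsOpenImmersion.lift a (c ≫ f) hca :=
    ⟨(Spec.preimage (IsOpenImmersion.lift a (c ≫ f) hca)).hom, Spec.map_preimage _⟩
  rw [← hψ0] at hψ'
  clear hψ0
  have hcomp : T.subtype.comp ψ = σ.comp φ := by
    have h : Spec.map (CommRingCat.ofHom (T.subtype.comp ψ)) ≫ a =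
        Spec.map (CommRingCat.ofHom (σ.comp φ)) ≫ a := by
      rw [CommRingCat.ofHom_comp, CommRingCat.ofHom_comp, Spec.map_comp, Spec.map_comp,
        Category.assoc, Category.assoc, hψ', hφ, ← hσ, ← hc.fac, Category.assoc]
    rw [cancel_mono] at h
    exact congrArg CommRingCat.Hom.hom (Spec.map_injective h)
  let := ψ.toAlgebra
  let := φ.toAlgebra
  let : Algebra R L := (σ.comp φ).toAlgebra
  let sA : T →ₐ[R] L := { T.subtype with commutes' := fun r ↦ DFunLike.congr_fun hcomp r }
  let σA : P.residueField y →ₐ[R] L := { σ with commutes' := fun r ↦ rfl }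
  let θ : T ⊗[R] P.residueField y →ₐ[R] L := Algebra.TensorProduct.lift sA σA fun _ _ ↦ .all _ _
  have hθ (t s) : θ (t ⊗ₜ s) = t * σ s := by simp [θ, sA, σA]
  have hform (w : T ⊗[R] P.residueField y) :
      ∃ t r, φ r ≠ 0 ∧ w = t ⊗ₜ (φ r)⁻¹ := by
    have hal (r : R) : algebraMap R (P.residueField y) r = φ r := rfl
    have hal' (r : R) (t : T) : r • t = ψ r * t := Algebra.smul_def r t
    induction w with
    | zero => exact ⟨0, 1, by simp, by simp⟩
    | tmul t s =>
      obtain ⟨r, r', hr', h⟩ := hfrac s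
      refine ⟨r • t, r', hr', ?_⟩
      rw [TensorProduct.smul_tmul, Algebra.smul_def, hal, ← h, mul_assoc, mul_inv_cancel₀ hr',
        mul_one]
    | add w w' hw hw' =>
      obtain ⟨t, r, hr, rfl⟩ := hw
      obtain ⟨t', r', hr', rfl⟩ := hw'
      refine ⟨r' • t + r • t', r * r', by simp [hr, hr'], ?_⟩
      rw [TensorProduct.add_tmul, TensorProduct.smul_tmul, TensorProduct.smul_tmul,
        Algebra.smul_def, Algebra.smul_def, hal, hal, map_mul]
      congr 2
      · field_simp
      · field_simp
  have hinj : Function.Injective θ.toRingHom := by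
    rw [injective_iff_map_eq_zero]
    intro w hw
    obtain ⟨t, r, hr, rfl⟩ := hform w
    have h1 : (t : L) * σ (φ r)⁻¹ = 0 := (hθ t _).symm.trans hw
    have h2 : σ (φ r)⁻¹ ≠ 0 := by simpa using hr
    have h3 : t = 0 := by
      rcases mul_eq_zero.mp h1 with h | h
      · exact Subtype.ext h
      · exact absurd h h2
    rw [h3, TensorProduct.zero_tmul]
  have hran : θ.toRingHom.range = T ⊔ σ.range := by
    apply le_antisymm
    · rintro _ ⟨w, rfl⟩
      obtain ⟨t, r, hr, rfl⟩ := hform w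
      have : θ.toRingHom (t ⊗ₜ (φ r)⁻¹) = t * σ (φ r)⁻¹ := hθ _ _
      rw [this]
      exact mul_mem (le_sup_left (a := T) t.2) (le_sup_right (b := σ.range) ⟨_, rfl⟩)
    · refine sup_le (fun t ht ↦ ⟨⟨t, ht⟩ ⊗ₜ 1, ?_⟩) ?_
      · exact (hθ _ _).trans (by simp)
      · rintro _ ⟨s, rfl⟩
        exact ⟨1 ⊗ₜ s, (hθ _ _).trans (by simp)⟩
  let A₁ := Spec.map (CommRingCat.ofHom (algebraMap R T))
  let A₂ := Spec.map (CommRingCat.ofHom (algebraMap R (P.residueField y)))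
  have hψ₁ : A₁ ≫ a = c ≫ f := hψ'
  have hφ₁ : A₂ ≫ a = 𝟙 _ ≫ P.fromSpecResidueField y := hφ.trans (Category.id_comp _).symm
  let m : pullback A₁ A₂ ⟶ pullback f (P.fromSpecResidueField y) :=
    pullback.map A₁ A₂ f (P.fromSpecResidueField y) c (𝟙 _) a hψ₁ hφ₁
  have hcO := hc.isOpenImmersion
  have hm : IsOpenImmersion m :=
    Scheme.pullback_map_isOpenImmersion A₁ A₂ f (P.fromSpecResidueField y) c (𝟙 _) a hψ₁ hφ₁
  let b : Spec (.of (T ⊗[R] P.residueField y)) ⟶ pullback f (P.fromSpecResidueField y) :=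
    (pullbackSpecIso R T (P.residueField y)).inv ≫ m
  have hb : IsOpenImmersion b := inferInstanceAs (IsOpenImmersion (_ ≫ m))
  have hfac : Spec.map (CommRingCat.ofHom θ.toRingHom) ≫ b =
      (pullback.lift q (Spec.map (CommRingCat.ofHom σ)) hσ) := by
    apply pullback.hom_ext
    · have h1 : m ≫ pullback.fst _ _ = pullback.fst A₁ A₂ ≫ c := pullback.lift_fst _ _ _
      have h2 : b ≫ pullback.fst _ _ = Spec.map (CommRingCat.ofHom
          (Algebra.TensorProduct.includeLeftRingHom (R := R) (A := T) (B := P.residueField y))) ≫ c :=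
        (Category.assoc _ _ _).trans ((congrArg (_ ≫ ·) h1).trans
          ((Category.assoc _ _ _).symm.trans (congrArg (· ≫ c) (pullbackSpecIso_inv_fst R T _))))
      rw [pullback.lift_fst, Category.assoc, h2, ← hc.fac, ← Category.assoc, ← Spec.map_comp,
        ← CommRingCat.ofHom_comp]
      congr 3
      ext t
      exact (hθ t 1).trans (by simp)
    · have h1 : m ≫ pullback.snd _ _ = pullback.snd A₁ A₂ :=
        (pullback.lift_snd _ _ _).trans (Category.comp_id _)
      have h2 : b ≫ pullback.snd _ _ = Spec.map (CommRingCat.ofHom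
          (Algebra.TensorProduct.includeRight (R := R) (A := T) (B := P.residueField y)).toRingHom) :=
        (Category.assoc _ _ _).trans ((congrArg (_ ≫ ·) h1).trans (pullbackSpecIso_inv_snd R T _))
      rw [pullback.lift_snd, Category.assoc, h2, ← Spec.map_comp, ← CommRingCat.ofHom_comp]
      congr 2
      ext t
      exact (hθ 1 t).trans (by simp)
  obtain ⟨c', hc', hr', -⟩ := exists_isChart_of_injective θ.toRingHom hinj b hfac
  have hrb : Set.range b = pullback.fst f (P.fromSpecResidueField y) ⁻¹' Set.range c := by
    have h : Set.range b = Set.range m := by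
      simp only [b]
      rw [Scheme.Hom.comp_base, TopCat.coe_comp, Set.range_comp]
      rw [Set.range_eq_univ.mpr (Scheme.Hom.surjective _), Set.image_univ]
    rw [h]
    refine (Scheme.Pullback.range_map ..).trans ?_
    exact Set.inter_eq_left.mpr fun x _ ↦ ⟨pullback.snd f (P.fromSpecResidueField y) x, rfl⟩
  rw [hrb] at hr'
  have key : ∀ S : Subring L, θ.toRingHom.range = S → ∃ c' : Spec (.of S) ⟶ f.fiber y,
      IsChart (pullback.lift q (Spec.map (CommRingCat.ofHom σ)) hσ : _ ⟶ f.fiber y) S c' ∧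
      Set.range c' = f.fiberι y ⁻¹' Set.range c := by
    rintro S rfl
    exact ⟨c', hc', hr'⟩
  exact key _ hran

/-- Charts of the fibre through an `L`-point, obtained from charts of the total space. -/
theorem exists_chartCover_fiber {X P : Scheme.{u}} (f : X ⟶ P) (q : Spec (.of L) ⟶ X) (y : P)
    (σ : P.residueField y →+* L)
    (hσ : q ≫ f = Spec.map (CommRingCat.ofHom σ) ≫ P.fromSpecResidueField y)
    {ι : Type u} {T : ι → Subring L} (𝒞 : ChartCover q T)
    (h : ∀ i, ∃ (R : CommRingCat.{u}) (a : Spec R ⟶ P), IsOpenImmersion a ∧ y ∈ Set.range a ∧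
      Set.range (𝒞.map i ≫ f) ⊆ Set.range a) :
    Nonempty (ChartCover (pullback.lift q (Spec.map (CommRingCat.ofHom σ)) hσ : _ ⟶ f.fiber y)
      fun i ↦ T i ⊔ σ.range) := by
  choose R a ha hy hca using h
  choose c hc hr using fun i ↦
    exists_isChart_fiber f q y σ hσ (a i) (hy i) (T i) (𝒞.map i) (𝒞.isChart i) (hca i)
  refine ⟨⟨c, hc, fun x ↦ ?_⟩⟩
  obtain ⟨i, hi⟩ := 𝒞.covers (f.fiberι y x)
  exact ⟨i, (hr i).ge hi⟩

end fiber

/-! ### Relations between the generators of a conic function field -/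

section relations

open IntermediateField

variable {k M : Type*} [Field k] [Field M] [Algebra k M] {n : ℕ}

lemma aeval_finCons (a : M) (b : Fin n → M) (P : MvPolynomial (Fin (n + 1)) k) :
    aeval (Fin.cons a b : Fin (n + 1) → M) P =
      Polynomial.eval₂ (aeval b : MvPolynomial (Fin n) k →ₐ[k] M).toRingHom a
        (finSuccEquiv k n P) := by
  induction P using MvPolynomial.induction_on with
  | C r =>
    have h : finSuccEquiv k n (C r) = Polynomial.C (C r) := by simp [finSuccEquiv_apply]
    rw [h, Polynomial.eval₂_C, aeval_C]
    exact (aeval_C b r).symm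
  | add p q hp hq => rw [map_add, map_add, Polynomial.eval₂_add, hp, hq]
  | mul_X p i hp =>
    rw [map_mul, map_mul, Polynomial.eval₂_mul, hp]
    congr 1
    refine Fin.cases ?_ (fun i ↦ ?_) i
    · simp [finSuccEquiv_X_zero]
    · simp [finSuccEquiv_X_succ]

/-- If `b` is algebraically independent in an intermediate field `E` and `a ∉ E` is a square root
of a polynomial in `b`, then this quadratic relation generates all relations. -/
theorem ker_aeval_finCons (E : IntermediateField k M) (a : M) (b : Fin n → M)
    (hb : AlgebraicIndependent k b) (hbE : ∀ i, b i ∈ E) (ha : a ∉ E) (H : MvPolynomial (Fin n) k)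
    (haH : a ^ 2 = aeval b H) :
    RingHom.ker (aeval (Fin.cons a b : Fin (n + 1) → M) : MvPolynomial (Fin (n + 1)) k →ₐ[k] M) =
      Ideal.span {X 0 ^ 2 - rename Fin.succ H} := by
  have hE (A : MvPolynomial (Fin n) k) : aeval b A ∈ E := by
    have h1 : aeval b A ∈ Algebra.adjoin k (Set.range b) := by
      rw [Algebra.adjoin_range_eq_range_aeval]; exact ⟨A, rfl⟩
    have h2 : Algebra.adjoin k (Set.range b) ≤ E.toSubalgebra :=
      Algebra.adjoin_le (Set.range_subset_iff.mpr hbE)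
    exact h2 h1
  have hren : finSuccEquiv k n (rename Fin.succ H) = Polynomial.C H := by
    clear haH
    induction H using MvPolynomial.induction_on with
    | C r => simp [finSuccEquiv_apply]
    | add p q hp hq => rw [map_add, map_add, hp, hq, map_add]
    | mul_X p i hp =>
      rw [map_mul, map_mul, hp, rename_X, finSuccEquiv_X_succ, map_mul]
  apply le_antisymm
  · intro P hP
    rw [RingHom.mem_ker] at hP
    have hP' : aeval (Fin.cons a b : Fin (n + 1) → M) P = 0 := hP
    rw [aeval_finCons] at hP'
    set p := finSuccEquiv k n P with hp
    -- Division by the monic `X² - H` leaves a remainder `B X + A`. If `B ≠ 0`, then `a` would be a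
    -- quotient of elements of `E`; so `B = 0`, and `A = 0` by independence of `b`.
    let m : Polynomial (MvPolynomial (Fin n) k) := Polynomial.X ^ 2 - Polynomial.C H
    have hm : m.Monic := Polynomial.monic_X_pow_sub_C H two_ne_zero
    have hdiv := Polynomial.modByMonic_add_div p m
    have hdeg : (p %ₘ m).degree < 2 := by
      refine (Polynomial.degree_modByMonic_lt p hm).trans_eq ?_
      exact Polynomial.degree_X_pow_sub_C two_pos H
    obtain ⟨B, A, hBA⟩ := Polynomial.exists_eq_X_add_C_of_natDegree_le_one
      (p := p %ₘ m) (by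
        by_cases h0 : p %ₘ m = 0
        · simp [h0]
        · exact Nat.le_of_lt_succ ((Polynomial.natDegree_lt_iff_degree_lt h0).mpr hdeg))
    have hm0 : m.eval₂ (aeval b : MvPolynomial (Fin n) k →ₐ[k] M).toRingHom a = 0 := by
      simp [m, haH]
    have h1 : aeval b B * a + aeval b A = 0 := by
      have := congrArg (Polynomial.eval₂ (aeval b : MvPolynomial (Fin n) k →ₐ[k] M).toRingHom a) hdiv
      rw [Polynomial.eval₂_add, Polynomial.eval₂_mul, hm0, zero_mul, add_zero, hP', hBA] at this
      simpa using this
    have hB : B = 0 := by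
      by_contra hB
      have hB' : aeval b B ≠ 0 := fun h ↦ hB (hb (h.trans (map_zero _).symm))
      refine ha ?_
      have : a = - aeval b A / aeval b B := by field_simp; linear_combination h1
      rw [this]
      exact div_mem (neg_mem (hE A)) (hE B)
    have hA : A = 0 := by
      rw [hB, map_zero, zero_mul, zero_add] at h1
      exact hb (h1.trans (map_zero _).symm)
    rw [hBA, hA, hB, Polynomial.C_0, zero_mul, zero_add, zero_add] at hdiv
    rw [Ideal.mem_span_singleton]
    refine ⟨(finSuccEquiv k n).symm (p /ₘ m), (finSuccEquiv k n).injective ?_⟩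
    rw [map_mul, map_sub, map_pow, finSuccEquiv_X_zero, hren, AlgEquiv.apply_symm_apply]
    exact hdiv.symm
  · rw [Ideal.span_singleton_le_iff_mem, RingHom.mem_ker]
    change aeval (Fin.cons a b : Fin (n + 1) → M) _ = 0
    rw [map_sub, map_pow, aeval_X, aeval_rename, Fin.cons_zero, haH]
    simp [Function.comp_def]

lemma algebraicIndependent_finCons {K : Type*} [Field K] [Algebra k K] [Algebra K M]
    [IsScalarTower k K M] (b : M) (hb : Transcendental K b) (c : Fin n → K)
    (hc : AlgebraicIndependent k c) :
    AlgebraicIndependent k (Fin.cons b (algebraMap K M ∘ c) : Fin (n + 1) → M) := by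
  rw [algebraicIndependent_iff]
  intro P hP
  rw [aeval_finCons] at hP
  have h1 : (aeval (algebraMap K M ∘ c) : MvPolynomial (Fin n) k →ₐ[k] M).toRingHom =
      (algebraMap K M).comp (aeval c : MvPolynomial (Fin n) k →ₐ[k] K).toRingHom := by
    apply MvPolynomial.ringHom_ext
    · intro r; simp [← IsScalarTower.algebraMap_apply]
    · intro i; simp
  rw [h1, ← Polynomial.eval₂_map] at hP
  have h2 := (transcendental_iff.mp hb) _ hP
  rw [Polynomial.map_eq_zero_iff (show Function.Injective _ from hc)] at h2
  exact (map_eq_zero_iff _ (finSuccEquiv k n).injective).mp h2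

variable {K L : Type*} [Field K] [Field L] [Algebra K L]

/-- Writing `y = r(x) / s(x)` gives `(X s)² + r² = g s²` in `K[X]`. By `hK` the leading coefficients
on the left cannot cancel, so the left side has degree at least `2 deg s + 2`, more than the right
side. -/
theorem notMem_adjoin_of_sq_add_sq (hK : ∀ a b : K, a ^ 2 + b ^ 2 = 0 → a = 0) {x y : L} {g : K}
    (hx : Transcendental K x) (h : x ^ 2 + y ^ 2 = algebraMap K L g) : y ∉ K⟮x⟯ := by
  intro hy
  obtain ⟨r, s, hrs⟩ := (mem_adjoin_simple_iff K y).mp hy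
  have hs : s ≠ 0 := by
    rintro rfl
    have hy0 : y = 0 := by simpa using hrs
    apply hx
    refine ⟨Polynomial.X ^ 2 - Polynomial.C g, Polynomial.X_pow_sub_C_ne_zero two_pos g, ?_⟩
    simp [← h, hy0]
  have hs' : Polynomial.aeval x s ≠ 0 := fun h0 ↦ hs (transcendental_iff.mp hx _ h0)
  have hpoly : (Polynomial.X * s) ^ 2 + r ^ 2 = Polynomial.C g * s ^ 2 := by
    rw [← sub_eq_zero]
    refine transcendental_iff.mp hx _ ?_
    simp only [map_sub, map_add, map_mul, map_pow, Polynomial.aeval_X, Polynomial.aeval_C, ← h]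
    rw [hrs]
    field_simp
    ring
  set N := max r.natDegree (Polynomial.X * s).natDegree with hN
  have hXs : (Polynomial.X * s).natDegree = s.natDegree + 1 := by
    rw [mul_comm, Polynomial.natDegree_mul_X hs]
  have h1 := congrArg (Polynomial.coeff · (N * 2)) hpoly
  simp only [Polynomial.coeff_add] at h1
  rw [mul_comm N 2, Polynomial.coeff_pow_of_natDegree_le (le_max_right _ _),
    Polynomial.coeff_pow_of_natDegree_le (le_max_left _ _),
    Polynomial.coeff_eq_zero_of_natDegree_lt (p := Polynomial.C g * s ^ 2)] at h1
  · have h2 := hK _ _ h1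
    have h3 := hK _ _ ((add_comm _ _).trans h1)
    rcases max_choice r.natDegree (Polynomial.X * s).natDegree with h | h
    · rw [h] at h3
      have hr : r = 0 := Polynomial.leadingCoeff_eq_zero.mp h3
      rw [hr] at h
      simp at h
      have := le_max_right r.natDegree (Polynomial.X * s).natDegree
      omega
    · rw [h] at h2
      exact hs (by simpa using Polynomial.leadingCoeff_eq_zero.mp h2)
  · have := le_max_right r.natDegree (Polynomial.X * s).natDegree
    refine (Polynomial.natDegree_C_mul_le _ _).trans_lt ?_
    refine Polynomial.natDegree_pow_le.trans_lt ?_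
    omega

lemma transcendental_of_sq_add_sq {x y : L} {g : K} (hx : Transcendental K x)
    (h : x ^ 2 + y ^ 2 = algebraMap K L g) : Transcendental K y := by
  intro hy
  apply hx
  have h1 : IsAlgebraic K (x ^ 2) := by
    rw [eq_sub_of_add_eq h]
    exact (isAlgebraic_algebraMap g).sub (hy.pow 2)
  exact h1.of_pow two_pos

lemma transcendental_inv {x : L} (hx : Transcendental K x) : Transcendental K x⁻¹ :=
  fun h ↦ hx (by simpa using h.inv)

end relations

/-! ### Sections over standard opens of Proj -/

section awaySections
variable {A : Type u} {S : Type*} [CommRing A] [SetLike S A] [AddSubgroupClass S A]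
  (𝒜 : ℕ → S) [GradedRing 𝒜]

/-- Plane conics are defined through sections over D₊(s), whereas kernels are computed in the
degree-zero localization; this identity translates between the two. -/
lemma awayToSection_awayι_appLE {s : A} {d : ℕ} (hs : s ∈ 𝒜 d) (hd : 0 < d) (h) :
    Proj.awayToSection 𝒜 s ≫ (Proj.awayι 𝒜 s hs hd).appLE (Proj.basicOpen 𝒜 s) ⊤ h =
      (Scheme.ΓSpecIso _).inv := by
  have h1 := Proj.basicOpenToSpec_app_top 𝒜 s
  have h2 : (Proj.basicOpenIsoSpec 𝒜 s hs hd).hom.appTop ≫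
      (Proj.basicOpenIsoSpec 𝒜 s hs hd).inv.appTop = 𝟙 _ := by
    rw [← Scheme.Hom.comp_appTop, Iso.inv_hom_id, Scheme.Hom.id_appTop]
  have h3 : (Proj.awayι 𝒜 s hs hd).appLE (Proj.basicOpen 𝒜 s) ⊤ h =
      (Proj.basicOpen 𝒜 s).topIso.inv ≫ (Proj.basicOpenIsoSpec 𝒜 s hs hd).inv.appTop := by
    simp only [Proj.awayι]
    rw [Scheme.Hom.comp_appLE]
    have h4 : (Proj.basicOpen 𝒜 s).topIso.inv = (Proj.basicOpen 𝒜 s).ι.app (Proj.basicOpen 𝒜 s) ≫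
        (Proj.basicOpen 𝒜 s).toScheme.presheaf.map
          (homOfLE (le_of_eq (Proj.basicOpen 𝒜 s).ι_preimage_self.symm)).op := by
      rw [Scheme.Opens.ι_app]
      refine Eq.trans ?_ (Functor.map_comp (Proj 𝒜).presheaf _ _)
      rfl
    rw [h4, Category.assoc]
    refine congrArg (_ ≫ ·) ?_
    exact (Scheme.Hom.map_appLE (Proj.basicOpenIsoSpec 𝒜 s hs hd).inv le_top _).symm.trans
      (congrArg (_ ≫ ·) (Scheme.Hom.app_eq_appLE _).symm)
  rw [Proj.basicOpenIsoSpec_hom] at h2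
  have h4 := congrArg ((Scheme.ΓSpecIso _).inv ≫ · ≫
    (Proj.basicOpenIsoSpec 𝒜 s hs hd).inv.appTop) h1
  simp only [Category.assoc, Iso.inv_hom_id_assoc] at h4
  rw [h3, ← h4]
  exact (congrArg (_ ≫ ·) h2).trans (Category.comp_id _)

end awaySections

/-! ### Dehomogenisation and the ideal of the closure of a point -/

variable {n : ℕ} {K : Type u} [Field K]

/-- Dehomogenisation at `x_j`. -/
def dehom (K : Type u) [Field K] (j : Fin (n + 1)) :
    MvPolynomial (Fin (n + 1)) K →+* HomogeneousLocalization.Away (grading n K) (X j) :=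
  eval₂Hom ((HomogeneousLocalization.fromZeroRingHom (grading n K) (.powers (X j))).comp
      (algebraMap K (grading n K 0)))
    fun i ↦ .mk (grading n K) (X_mem_grading n K j) 1 (X i) (by simpa using X_mem_grading n K i)

lemma dehom_eq_mk (j : Fin (n + 1)) (d : ℕ) (P : MvPolynomial (Fin (n + 1)) K)
    (hP : P ∈ grading n K (d • 1)) :
    dehom K j P = .mk (grading n K) (X_mem_grading n K j) d P hP := by
  have hP' : P.IsHomogeneous d := by simpa using (mem_homogeneousSubmodule _ _).mp hP
  apply HomogeneousLocalization.val_injective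
  let w : Fin (n + 1) → Localization.Away (X j : MvPolynomial (Fin (n + 1)) K) :=
    fun i ↦ Localization.mk (X i) ⟨X j ^ 1, 1, rfl⟩
  let x : Localization.Away (X j : MvPolynomial (Fin (n + 1)) K) :=
    algebraMap (MvPolynomial (Fin (n + 1)) K) _ (X j)
  have hw : ∀ p, (dehom K j p).val = aeval w p := by
    intro p
    have : (algebraMap (HomogeneousLocalization.Away (grading n K)
        (X j : MvPolynomial (Fin (n + 1)) K))
        (Localization.Away (X j : MvPolynomial (Fin (n + 1)) K))).comp (dehom K j) = (aeval w : MvPolynomial (Fin (n + 1)) K →ₐ[K] Localization.Away (X j : MvPolynomial (Fin (n + 1)) K)).toRingHom := by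
      apply MvPolynomial.ringHom_ext
      · intro r
        simp [dehom]
        exact (Localization.mk_one_eq_algebraMap _).trans (by
          rw [IsScalarTower.algebraMap_apply K (MvPolynomial (Fin (n + 1)) K)
            (Localization.Away (X j : MvPolynomial (Fin (n + 1)) K))]
          rfl)
      · intro i
        simp [dehom, w, HomogeneousLocalization.Away.val_mk]
    exact DFunLike.congr_fun this p
  have h1 : aeval (x • w) P = x ^ d * aeval w P := hP'.aeval_smul _ _
  have hxw : x • w = fun i ↦ algebraMap (MvPolynomial (Fin (n + 1)) K) _ (X i) := by
    ext i
    simp only [x, w, Pi.smul_apply, smul_eq_mul, Localization.mk_eq_mk']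
    rw [mul_comm]
    simp
  have h2 : aeval (x • w) P = algebraMap (MvPolynomial (Fin (n + 1)) K) (Localization.Away (X j : MvPolynomial (Fin (n + 1)) K)) P := by
    rw [hxw]
    exact (aeval_algebraMap_apply _ _ _).trans (by rw [aeval_X_left_apply])
  rw [hw, HomogeneousLocalization.Away.val_mk, Localization.mk_eq_mk', eq_comm,
    IsLocalization.mk'_eq_iff_eq_mul, ← h2, h1, mul_comm]
  simp [x]


lemma dehom_surjective (j : Fin (n + 1)) : Function.Surjective (dehom K j) := by
  intro a
  obtain ⟨d, P, hP, rfl⟩ := a.mk_surjective _ (X_mem_grading n K j)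
  exact ⟨P, dehom_eq_mk j d P hP⟩

lemma dehom_C (j : Fin (n + 1)) (r : K) : dehom K j (C r) =
    HomogeneousLocalization.fromZeroRingHom (grading n K) (.powers (X j)) (algebraMap _ _ r) :=
  eval₂_C _ _ _

lemma dehom_X_self (j : Fin (n + 1)) : dehom K j (X j) = 1 := by
  rw [dehom_eq_mk j 1 _ (by simpa using X_mem_grading n K j)]
  ext
  rw [HomogeneousLocalization.Away.val_mk, HomogeneousLocalization.val_one]
  simp

variable {L : Type u} [Field L] [Algebra K L]

lemma chartHom_dehom (v : Fin (n + 1) → L) (j : Fin (n + 1)) (hj : v j ≠ 0)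
    (P : MvPolynomial (Fin (n + 1)) K) :
    chartHom K j v hj.isUnit (dehom K j P) = aeval (fun i ↦ v i / v j) P := by
  have : (chartHom K j v hj.isUnit).comp (dehom K j) =
      (aeval (fun i ↦ v i / v j) : MvPolynomial (Fin (n + 1)) K →ₐ[K] L).toRingHom := by
    apply MvPolynomial.ringHom_ext
    · intro r
      have h := dehom_eq_mk j 0 (C r) (by simp)
      change chartHom K j v hj.isUnit (dehom K j (C r)) = aeval (fun i ↦ v i / v j) (C r)
      rw [h, chartHom_eq_aeval v j hj]
    · intro i
      have h := dehom_eq_mk j 1 (X i) (by simpa using X_mem_grading n K i)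
      change chartHom K j v hj.isUnit (dehom K j (X i)) = aeval (fun i ↦ v i / v j) (X i)
      rw [h, chartHom_eq_aeval v j hj]
  exact DFunLike.congr_fun this P

/-- The relations of a point of projective space on a chart, read off from the remaining
coordinates `σ`. -/
lemma ker_chartHom {m : ℕ} (v : Fin (n + 1) → L) (j : Fin (n + 1)) (hj : v j ≠ 0)
    (σ : Fin m → Fin (n + 1)) (τ : Fin (n + 1) → MvPolynomial (Fin m) K)
    (hτ : ∀ i, (i = j ∧ τ i = 1) ∨ rename σ (τ i) = X i)
    (Q : MvPolynomial (Fin (n + 1)) K)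
    (hker : RingHom.ker (aeval (fun i ↦ v (σ i) / v j) : MvPolynomial (Fin m) K →ₐ[K] L) =
      Ideal.span {aeval τ Q}) :
    RingHom.ker (chartHom K j v hj.isUnit) = Ideal.span {dehom K j Q} := by
  -- `τ` puts `x_j = 1` or renames a variable, and `σ` undoes the renaming; dehomogenisation sends
  -- `x_j` to `1` anyway.
  have h1 (P : MvPolynomial (Fin (n + 1)) K) : dehom K j (rename σ (aeval τ P)) = dehom K j P := by
    have : (((dehom K j).comp (rename σ : _ →ₐ[K] _).toRingHom).comp
        (aeval τ : MvPolynomial (Fin (n + 1)) K →ₐ[K] _).toRingHom) = dehom K j := by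
      apply MvPolynomial.ringHom_ext
      · intro r
        simp [← MvPolynomial.algebraMap_eq]
      · intro i
        rcases hτ i with ⟨rfl, h⟩ | h
        · simp [h, dehom_X_self]
        · simp [h]
    exact DFunLike.congr_fun this P
  have h2 (P : MvPolynomial (Fin m) K) : chartHom K j v hj.isUnit (dehom K j (rename σ P)) =
      aeval (fun i ↦ v (σ i) / v j) P := by
    rw [chartHom_dehom v j hj, aeval_rename]
    rfl
  apply le_antisymm
  · intro a ha
    obtain ⟨P, rfl⟩ := dehom_surjective j a
    rw [RingHom.mem_ker, ← h1 P, h2] at ha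
    have h3 : aeval τ P ∈ Ideal.span {aeval τ Q} := by
      rw [← hker]; exact ha
    obtain ⟨R, hR⟩ := Ideal.mem_span_singleton.mp h3
    rw [← h1 P, hR, map_mul, map_mul, h1]
    exact Ideal.mul_mem_right _ _ (Ideal.mem_span_singleton_self _)
  · rw [Ideal.span_singleton_le_iff_mem, RingHom.mem_ker, ← h1 Q, h2]
    have : aeval τ Q ∈ RingHom.ker (aeval (fun i ↦ v (σ i) / v j) :
        MvPolynomial (Fin m) K →ₐ[K] L) := by
      rw [hker]; exact Ideal.mem_span_singleton_self _
    exact this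

lemma appLE_congr_hom {X Y : Scheme.{u}} {f g : X ⟶ Y} (h : f = g) {U : Y.Opens} {V : X.Opens}
    (e : V ≤ f ⁻¹ᵁ U) : f.appLE U V e = g.appLE U V (h ▸ e) := by
  subst h; rfl

lemma appLE_injective {X Y : Scheme.{u}} (f : X ⟶ Y) (W : Y.Opens)
    (h : Function.Injective (f.app W)) (e : ⊤ ≤ f ⁻¹ᵁ W) :
    Function.Injective (f.appLE W ⊤ e) := by
  have key (V : X.Opens) (hV : ⊤ ≤ V) :
      Function.Injective (X.presheaf.map (homOfLE hV).op) := by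
    obtain rfl := top_le_iff.mp hV
    have : X.presheaf.map (homOfLE hV).op = 𝟙 _ := X.presheaf.map_id _
    rw [this]
    exact Function.injective_id
  exact (key _ e).comp h

/-- Over an affine open, sections of the scheme-theoretic image inject into sections of the source.
-/
lemma imageι_app_eq_zero_iff {X Y : Scheme.{u}} (q : X ⟶ Y) [QuasiCompact q] {U : Y.Opens}
    (hU : IsAffineOpen U) (hle : ⊤ ≤ q ⁻¹ᵁ U) (s : Γ(Y, U)) :
    q.imageι.app U s = 0 ↔ q.appLE U ⊤ hle s = 0 := by
  have hle' : ⊤ ≤ q.toImage ⁻¹ᵁ (q.imageι ⁻¹ᵁ U) := by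
    rw [← Scheme.Hom.comp_preimage, Scheme.Hom.toImage_imageι]; exact hle
  have h2 : q.appLE U ⊤ hle = q.imageι.app U ≫ q.toImage.appLE (q.imageι ⁻¹ᵁ U) ⊤ hle' :=
    (appLE_congr_hom (Scheme.Hom.toImage_imageι q).symm hle).trans
      (Scheme.Hom.comp_appLE _ _ _ _ _)
  rw [h2, CommRingCat.comp_apply]
  exact (map_eq_zero_iff _
    (appLE_injective q.toImage _ (q.toImage_app_injective ⟨U, hU⟩) hle')).symm

section awayPoint
variable {A : Type u} {S : Type*} [CommRing A] [SetLike S A] [AddSubgroupClass S A]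
  (𝒜 : ℕ → S) [GradedRing 𝒜] {s : A} {d : ℕ} (hs : s ∈ 𝒜 d) (hd : 0 < d)
  {R : Type u} [CommRing R] (φ : HomogeneousLocalization.Away 𝒜 s →+* R)

lemma le_awayι_preimage : ⊤ ≤ Proj.awayι 𝒜 s hs hd ⁻¹ᵁ Proj.basicOpen 𝒜 s := fun x _ ↦ by
  change Proj.awayι _ _ hs hd _ ∈ Proj.basicOpen 𝒜 s
  rw [← Proj.opensRange_awayι _ _ hs hd]
  exact ⟨_, rfl⟩

lemma le_specMap_awayι_preimage :
    ⊤ ≤ (Spec.map (CommRingCat.ofHom φ) ≫ Proj.awayι 𝒜 s hs hd) ⁻¹ᵁ Proj.basicOpen 𝒜 s :=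
  fun _ _ ↦ le_awayι_preimage 𝒜 hs hd trivial

lemma specMap_awayι_appLE (hle) (a : HomogeneousLocalization.Away 𝒜 s) :
    (Spec.map (CommRingCat.ofHom φ) ≫ Proj.awayι 𝒜 s hs hd).appLE (Proj.basicOpen 𝒜 s) ⊤ hle
      ((Proj.awayToSection 𝒜 s).hom a) = (Scheme.ΓSpecIso (.of R)).inv (φ a) := by
  have h5 := awayToSection_awayι_appLE 𝒜 hs hd (le_awayι_preimage 𝒜 hs hd)
  have h6 : Proj.awayToSection 𝒜 s ≫
      (Spec.map (CommRingCat.ofHom φ) ≫ Proj.awayι 𝒜 s hs hd).appLE (Proj.basicOpen 𝒜 s) ⊤ hle =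
      CommRingCat.ofHom φ ≫ (Scheme.ΓSpecIso (.of R)).inv := by
    rw [← Scheme.Hom.appLE_comp_appLE _ _ _ _ _ (le_awayι_preimage 𝒜 hs hd) le_top,
      reassoc_of% h5, Scheme.ΓSpecIso_inv_naturality]
    exact congrArg (_ ≫ ·) (Scheme.Hom.app_eq_appLE _).symm
  exact congrArg (fun f ↦ f.hom a) h6

lemma awayToSection_bijective (hs : s ∈ 𝒜 d) (hd : 0 < d) :
    Function.Bijective (Proj.awayToSection 𝒜 s).hom := by
  have : IsIso (Proj.awayToSection 𝒜 s) := by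
    rw [← Proj.basicOpenIsoAway_hom _ _ hs hd]; infer_instance
  exact ConcreteCategory.bijective_of_isIso (Proj.awayToSection 𝒜 s)

lemma ker_imageι_app {L : Type u} [Field L] (θ : HomogeneousLocalization.Away 𝒜 s →+* L)
    (q : Spec (.of L) ⟶ Proj 𝒜) (hq : q = Spec.map (CommRingCat.ofHom θ) ≫ Proj.awayι 𝒜 s hs hd)
    (b : HomogeneousLocalization.Away 𝒜 s) (hb : RingHom.ker θ = Ideal.span {b}) :
    RingHom.ker (q.imageι.app (Proj.basicOpen 𝒜 s)).hom =
      Ideal.span {(Proj.awayToSection 𝒜 s).hom b} := by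
  subst hq
  have h7 (a : HomogeneousLocalization.Away 𝒜 s) :
      (Spec.map (CommRingCat.ofHom θ) ≫ Proj.awayι 𝒜 s hs hd).imageι.app (Proj.basicOpen 𝒜 s)
        ((Proj.awayToSection 𝒜 s).hom a) = 0 ↔ a ∈ Ideal.span {b} := by
    rw [imageι_app_eq_zero_iff _ (Proj.isAffineOpen_basicOpen _ _ hs hd)
      (le_specMap_awayι_preimage 𝒜 hs hd θ), specMap_awayι_appLE, ← hb, RingHom.mem_ker]
    exact map_eq_zero_iff _ (ConcreteCategory.bijective_of_isIso (Scheme.ΓSpecIso (.of L)).inv).1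
  apply le_antisymm
  · intro t ht
    obtain ⟨a, rfl⟩ := (awayToSection_bijective 𝒜 hs hd).2 t
    obtain ⟨c, rfl⟩ := Ideal.mem_span_singleton.mp ((h7 a).mp ht)
    rw [map_mul]
    exact Ideal.mul_mem_right _ _ (Ideal.mem_span_singleton_self _)
  · rw [Ideal.span_singleton_le_iff_mem]
    exact (h7 b).mpr (Ideal.mem_span_singleton_self _)

end awayPoint

open IntermediateField in
/-- The closure of the `L`-point `(x : y : 1)` with `x ^ 2 + y ^ 2 = g ∈ K` is a plane conic. -/
theorem isPlaneConic_image (hK : ∀ a b : K, a ^ 2 + b ^ 2 = 0 → a = 0) {x y : L} {g : K}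
    (hx : Transcendental K x) (h : x ^ 2 + y ^ 2 = algebraMap K L g) :
    IsPlaneConic K ((projPoint K 2 ![x, y, 1] isUnit_one).imageι ≫ projSpaceStr 2 K) := by
  have hy : Transcendental K y := transcendental_of_sq_add_sq hx h
  have hx0 : x ≠ 0 := fun h0 ↦ hx (h0 ▸ isAlgebraic_zero)
  have hy0 : y ≠ 0 := fun h0 ↦ hy (h0 ▸ isAlgebraic_zero)
  have hyx := notMem_adjoin_of_sq_add_sq hK hx h
  have hxy := notMem_adjoin_of_sq_add_sq hK hy ((add_comm _ _).trans h)
  let Q : MvPolynomial (Fin 3) K := X 0 ^ 2 + X 1 ^ 2 - C g * X 2 ^ 2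
  have hQ : Q.IsHomogeneous 2 := by
    refine .sub (.add ?_ ?_) ?_
    · simpa using (isHomogeneous_X K (0 : Fin 3)).pow 2
    · simpa using (isHomogeneous_X K (1 : Fin 3)).pow 2
    · simpa using (isHomogeneous_C (Fin 3) g).mul ((isHomogeneous_X K (2 : Fin 3)).pow 2)
  have hQ0 : Q ≠ 0 := by
    intro h0
    have := congrArg (aeval ![(1 : K), 0, 0]) h0
    simp [Q] at this
  refine ⟨Q, hQ, _, hQ0, inferInstance, rfl, fun j ↦ ?_⟩
  have hv : ∀ i, (![x, y, 1] : Fin 3 → L) i ≠ 0 := by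
    intro i; fin_cases i <;> simp [hx0, hy0]
  have hind (b : L) (hb : Transcendental K b) : AlgebraicIndependent K ![b] :=
    (algebraicIndependent_unique_type_iff (x := ![b])).mpr hb
  -- On each chart two ratios remain. One is transcendental, and the other is a square root of a
  -- polynomial in it, outside the field it generates: `(y/x)² = g (1/x)² - 1`, `(x/y)² = g (1/y)² -
  -- 1` and `x² = g - y²`. Now `ker_aeval_finCons` applies.
  have key : RingHom.ker (chartHom K j ![x, y, 1] (hv j).isUnit) = Ideal.span {dehom K j Q} := by
    fin_cases j
    · refine ker_chartHom _ _ (hv 0) ![1, 2] ![1, X 0, X 1] (by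
        intro i; fin_cases i <;> simp) Q ?_
      have := ker_aeval_finCons (k := K) (K⟮x⟯) (y / x) ![1 / x] (hind _ (by
        rw [one_div]; exact transcendental_inv hx)) (by
          intro i; simpa using inv_mem (mem_adjoin_simple_self K x)) (fun hmem ↦ hyx (by
          have := mul_mem hmem (mem_adjoin_simple_self K x)
          rwa [div_mul_cancel₀ _ hx0] at this)) (C g * X 0 ^ 2 - 1) (by
          simp [← h]; field_simp; ring)
      convert this using 2
      · congr 1
        ext i; fin_cases i <;> rfl
      · congr 1
        simp [Q]; ring
    · refine ker_chartHom _ _ (hv 1) ![0, 2] ![X 0, 1, X 1] (by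
        intro i; fin_cases i <;> simp) Q ?_
      have := ker_aeval_finCons (k := K) (K⟮y⟯) (x / y) ![1 / y] (hind _ (by
        rw [one_div]; exact transcendental_inv hy)) (by
          intro i; simpa using inv_mem (mem_adjoin_simple_self K y)) (fun hmem ↦ hxy (by
          have := mul_mem hmem (mem_adjoin_simple_self K y)
          rwa [div_mul_cancel₀ _ hy0] at this)) (C g * X 0 ^ 2 - 1) (by
          simp [← h]; field_simp; ring)
      convert this using 2
      · congr 1
        ext i; fin_cases i <;> rfl
      · congr 1
        simp [Q]; ring
    · refine ker_chartHom _ _ (hv 2) ![0, 1] ![X 0, X 1, 1] (by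
        intro i; fin_cases i <;> simp) Q ?_
      have := ker_aeval_finCons (k := K) (K⟮y⟯) x ![y] (hind _ hy) (by
          intro i; simpa using mem_adjoin_simple_self K y) hxy (C g - X 0 ^ 2) (by
          simp [← h])
      convert this using 2
      · congr 1
        ext i; fin_cases i <;> simp
      · congr 1
        simp [Q]; ring
  have h8 := ker_imageι_app (grading 2 K) (X_mem_grading 2 K j) one_pos
    (chartHom K j ![x, y, 1] (hv j).isUnit) (projPoint K 2 ![x, y, 1] isUnit_one)
    (projPoint_congr_index _ _) _ key
  rw [dehom_eq_mk j 2 Q (by simpa using (mem_homogeneousSubmodule _ Q).mpr hQ)] at h8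
  exact h8

/-! ### Smoothness of hypersurfaces -/

section smooth

open Algebra

/-- The Jacobian criterion for one equation. -/
theorem isStandardSmoothOfRelativeDimension_of_pderiv {k T : Type u} [CommRing k] [CommRing T]
    [Algebra k T] {d : ℕ} (φ : MvPolynomial (Fin (d + 1)) k →ₐ[k] T) (hφ : Function.Surjective φ)
    (h : MvPolynomial (Fin (d + 1)) k) (hker : RingHom.ker φ = Ideal.span {h}) (i : Fin (d + 1))
    (T' : Type u) [CommRing T'] [Algebra k T'] [Algebra T T'] [IsScalarTower k T T']
    [IsLocalization.Away (φ (pderiv i h)) T'] :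
    IsStandardSmoothOfRelativeDimension d k T' := by
  have hI : Ideal.span (Set.range fun _ : Unit ↦ h) = RingHom.ker φ := by
    rw [hker, Set.range_const]
  let e : (MvPolynomial (Fin (d + 1)) k ⧸ Ideal.span (Set.range fun _ : Unit ↦ h)) ≃ₐ[k] T :=
    (Ideal.quotientEquivAlgOfEq k hI).trans (Ideal.quotientKerAlgEquivOfSurjective hφ)
  have he (p) : e (Ideal.Quotient.mk _ p) = φ p := rfl
  let P₀ : PreSubmersivePresentation k _ (Fin (d + 1)) Unit :=
    PreSubmersivePresentation.naive (v := fun _ : Unit ↦ h) (fun _ ↦ i) (fun _ _ _ ↦ rfl)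
  let P := P₀.ofAlgEquiv e
  have hP : P.jacobian = φ (pderiv i h) := by
    rw [PreSubmersivePresentation.jacobian_ofAlgEquiv, ← he]
    congr 1
    rw [PreSubmersivePresentation.jacobian_eq_jacobiMatrix_det, Matrix.det_unique]
    refine (congrArg (algebraMap P₀.Ring _) (PreSubmersivePresentation.jacobiMatrix_naive _ _ _ _
      () ())).trans ?_
    rw [Generators.algebraMap_apply]
    change aeval (fun i ↦ Ideal.Quotient.mk _ (X i)) _ = _
    exact (aeval_algebraMap_apply (B := MvPolynomial (Fin (d + 1)) k ⧸ _) X _).trans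
      (by rw [aeval_X_left_apply]; rfl)
  let Q := PreSubmersivePresentation.localizationAway T' (φ (pderiv i h))
  have hu : IsUnit (algebraMap T T' (φ (pderiv i h))) :=
    IsLocalization.Away.algebraMap_isUnit _
  -- The Jacobian of the composite is the product of two Jacobians, each equal to the partial
  -- derivative that has been inverted.
  let R : SubmersivePresentation k T' (Unit ⊕ Fin (d + 1)) (Unit ⊕ Unit) :=
    { Q.comp P with
      jacobian_isUnit := by
        have := PreSubmersivePresentation.comp_jacobian_eq_jacobian_smul_jacobian Q P
        rw [PreSubmersivePresentation.localizationAway_jacobian, hP] at this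
        change IsUnit (Q.comp P).jacobian
        rw [this, smul_def]
        exact hu.mul hu }
  refine R.isStandardSmoothOfRelativeDimension ?_
  simp [Presentation.dimension]
  omega

theorem locally_isStandardSmoothOfRelativeDimension {k T : Type u} [CommRing k] [CommRing T]
    [Algebra k T] {d : ℕ} (φ : MvPolynomial (Fin (d + 1)) k →ₐ[k] T) (hφ : Function.Surjective φ)
    (h : MvPolynomial (Fin (d + 1)) k) (hker : RingHom.ker φ = Ideal.span {h})
    (hspan : Ideal.span (Set.range fun i ↦ φ (pderiv i h)) = ⊤) :
    RingHom.Locally (RingHom.IsStandardSmoothOfRelativeDimension d) (algebraMap k T) := by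
  refine RingHom.locally_of_exists
    RingHom.isStandardSmoothOfRelativeDimension_respectsIso _ (fun i ↦ φ (pderiv i h)) hspan
    (fun i ↦ Localization.Away (φ (pderiv i h))) fun i ↦ ?_
  rw [← IsScalarTower.algebraMap_eq, RingHom.isStandardSmoothOfRelativeDimension_algebraMap]
  exact isStandardSmoothOfRelativeDimension_of_pderiv φ hφ h hker i _

end smooth

/-! ### Generic points of `x² + y² = G(z)` -/

section standardPoint

open IntermediateField

variable {L : Type} [Field L] [Algebra ℝ L]

/-- ℝ(z) is formally real: after clearing denominators, an identity `p² + q² = 0` between real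
polynomials is tested at all real points. -/
lemma eq_zero_of_sq_add_sq_eq_zero {z : L} (hz : Transcendental ℝ z) (a b : ℝ⟮z⟯)
    (h : a ^ 2 + b ^ 2 = 0) : a = 0 := by
  obtain ⟨p, r, hp⟩ := (mem_adjoin_simple_iff ℝ (a : L)).mp a.2
  obtain ⟨q, s, hq⟩ := (mem_adjoin_simple_iff ℝ (b : L)).mp b.2
  have h' : (a : L) ^ 2 + (b : L) ^ 2 = 0 := by exact_mod_cast congrArg Subtype.val h
  have key : ∀ p q : Polynomial ℝ, p ^ 2 + q ^ 2 = 0 → p = 0 := by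
    intro p q hpq
    by_contra hp
    refine hp (Polynomial.funext fun t ↦ ?_)
    have := congrArg (Polynomial.eval t) hpq
    simp only [Polynomial.eval_add, Polynomial.eval_pow, Polynomial.eval_zero] at this ⊢
    nlinarith [sq_nonneg (p.eval t), sq_nonneg (q.eval t)]
  have hinj := transcendental_iff_injective.mp hz
  have hne (p : Polynomial ℝ) (hp : p ≠ 0) : Polynomial.aeval z p ≠ 0 :=
    fun h ↦ hp (hinj (h.trans (map_zero _).symm))
  by_cases hr : r = 0
  · ext; rw [hp, hr]; simp
  have hr' := hne r hr
  by_cases hs : s = 0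
  · have hb : (b : L) = 0 := by rw [hq, hs]; simp
    rw [hb] at h'
    ext
    simpa using h'
  have hs' := hne s hs
  have h1 : (p * s) ^ 2 + (q * r) ^ 2 = 0 := by
    apply hinj
    simp only [map_add, map_mul, map_pow, map_zero]
    rw [hp, hq] at h'
    field_simp at h'
    linear_combination h'
  have hp0 : p = 0 := by
    rcases mul_eq_zero.mp (key _ _ h1) with h | h
    · exact h
    · exact absurd h hs
  ext; rw [hp, hp0]; simp

/-- A point `(x, y, z)` of the surface `x ^ 2 + y ^ 2 = G(z)` that is generic over `ℝ`. -/
structure IsStandardPoint (x y z : L) (G : Polynomial ℝ) : Prop where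
  transcendental_z : Transcendental ℝ z
  transcendental_x : Transcendental ℝ⟮z⟯ x
  eq : x ^ 2 + y ^ 2 = Polynomial.aeval z G
  separable : G.Separable

/-- The subring of `L` generated by `a`, `b`, `c` over `ℝ`. -/
def coordRing (a b c : L) : Subring L :=
  (Algebra.adjoin ℝ (Set.range ![a, b, c])).toSubring

lemma coordRing_eq_range (a b c : L) : coordRing a b c =
    (aeval ![a, b, c] : MvPolynomial (Fin 3) ℝ →ₐ[ℝ] L).range.toSubring := by
  rw [coordRing, Algebra.adjoin_range_eq_range_aeval]

lemma algebraMap_mem_coordRing (a b c : L) (r : ℝ) : algebraMap ℝ L r ∈ coordRing a b c :=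
  Subalgebra.algebraMap_mem (Algebra.adjoin ℝ (Set.range ![a, b, c])) r

lemma left_mem_coordRing (a b c : L) : a ∈ coordRing a b c :=
  Algebra.subset_adjoin ⟨0, rfl⟩

lemma mid_mem_coordRing (a b c : L) : b ∈ coordRing a b c :=
  Algebra.subset_adjoin ⟨1, rfl⟩

lemma right_mem_coordRing (a b c : L) : c ∈ coordRing a b c :=
  Algebra.subset_adjoin ⟨2, rfl⟩

lemma coordRing_le {a b c : L} {T : Subring L} (hT : ∀ r, algebraMap ℝ L r ∈ T) (ha : a ∈ T)
    (hb : b ∈ T) (hc : c ∈ T) : coordRing a b c ≤ T := by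
  let S : Subalgebra ℝ L := { T with algebraMap_mem' := hT }
  have : Algebra.adjoin ℝ (Set.range ![a, b, c]) ≤ S := by
    refine Algebra.adjoin_le ?_
    rintro _ ⟨i, rfl⟩
    fin_cases i
    exacts [ha, hb, hc]
  exact this

namespace IsStandardPoint

variable {x y z : L} {G : Polynomial ℝ} (h : IsStandardPoint x y z G)
include h

lemma exists_algebraMap_eq : ∃ g : ℝ⟮z⟯, x ^ 2 + y ^ 2 = algebraMap ℝ⟮z⟯ L g :=
  ⟨⟨Polynomial.aeval z G, (mem_adjoin_simple_iff ℝ _).mpr ⟨G, 1, by simp⟩⟩, h.eq⟩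

lemma swap : IsStandardPoint y x z G where
  transcendental_z := h.transcendental_z
  transcendental_x := by
    obtain ⟨g, hg⟩ := h.exists_algebraMap_eq
    exact transcendental_of_sq_add_sq h.transcendental_x hg
  eq := (add_comm _ _).trans h.eq
  separable := h.separable

lemma x_ne_zero : x ≠ 0 := fun h0 ↦ h.transcendental_x (h0 ▸ isAlgebraic_zero)

lemma y_ne_zero : y ≠ 0 := h.swap.x_ne_zero

lemma z_ne_zero : z ≠ 0 := fun h0 ↦ h.transcendental_z (h0 ▸ isAlgebraic_zero)

/-- This is the passage to `z = ∞`. Dividing `x` and `y` by `zᵐ` divides `G(z)` by `z ^ (2 * m)`;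
for `G` of degree `2m` the result is the reversed polynomial in `1 / z`, and this is where the even
degree enters. -/
lemma inv {m : ℕ} {G' : Polynomial ℝ} (hG' : G'.Separable)
    (hGG' : Polynomial.aeval z⁻¹ G' = Polynomial.aeval z G / z ^ (2 * m)) :
    IsStandardPoint (x / z ^ m) (y / z ^ m) z⁻¹ G' where
  transcendental_z := transcendental_inv h.transcendental_z
  transcendental_x := by
    have : ℝ⟮z⁻¹⟯ = ℝ⟮z⟯ := by
      apply le_antisymm
      · rw [adjoin_simple_le_iff]
        exact inv_mem (mem_adjoin_simple_self ℝ z)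
      · rw [adjoin_simple_le_iff]
        simpa using inv_mem (mem_adjoin_simple_self ℝ z⁻¹)
    rw [this]
    intro halg
    apply h.transcendental_x
    have hz : z ^ m ≠ 0 := pow_ne_zero _ h.z_ne_zero
    have h1 : IsAlgebraic ℝ⟮z⟯ (z ^ m) :=
      isAlgebraic_algebraMap (⟨z ^ m, pow_mem (mem_adjoin_simple_self ℝ z) m⟩ : ℝ⟮z⟯)
    have h2 := halg.mul h1
    rwa [div_mul_cancel₀ _ hz] at h2
  eq := by
    rw [hGG', ← h.eq]
    have := h.z_ne_zero
    field_simp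
    ring
  separable := hG'

lemma notMem : y ∉ ℝ⟮z⟯⟮x⟯ := by
  obtain ⟨g, hg⟩ := h.exists_algebraMap_eq
  exact notMem_adjoin_of_sq_add_sq (eq_zero_of_sq_add_sq_eq_zero h.transcendental_z)
    h.transcendental_x hg

lemma algebraicIndependent {b : L} (hb : Transcendental ℝ⟮z⟯ b) :
    AlgebraicIndependent ℝ ![b, z] := by
  have := algebraicIndependent_finCons b hb ![AdjoinSimple.gen ℝ z]
    ((algebraicIndependent_unique_type_iff (x := ![AdjoinSimple.gen ℝ z])).mpr (by
      intro halg
      exact h.transcendental_z (halg.algHom (val ℝ⟮z⟯))))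
  have hfun : (Fin.cons b (algebraMap ℝ⟮z⟯ L ∘ ![AdjoinSimple.gen ℝ z]) : Fin 2 → L) = ![b, z] := by
    ext i; fin_cases i <;> simp
  rw [hfun] at this
  exact this

/-- Over ℝ(z)(y), where `y` and `z` are independent, `x` is a new square root of `G(z) - y²`, so
`ker_aeval_finCons` applies. -/
theorem ker_affine : RingHom.ker (aeval ![x, y, z] : MvPolynomial (Fin 3) ℝ →ₐ[ℝ] L) =
    Ideal.span {X 0 ^ 2 + X 1 ^ 2 - Polynomial.aeval (X 2) G} := by
  have := ker_aeval_finCons (k := ℝ) (ℝ⟮z⟯⟮y⟯.restrictScalars ℝ) x ![y, z]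
    (h.algebraicIndependent h.swap.transcendental_x) (fun i ↦ by
      fin_cases i
      · exact mem_adjoin_simple_self ℝ⟮z⟯ y
      · exact IntermediateField.algebraMap_mem ℝ⟮z⟯⟮y⟯ (AdjoinSimple.gen ℝ z)) h.swap.notMem
    (Polynomial.aeval (X 1) G - X 0 ^ 2) (by
      rw [map_sub, map_pow, ← Polynomial.aeval_algHom_apply]
      simp [← h.eq])
  convert this using 2
  congr 1
  rw [map_sub, map_pow, ← Polynomial.aeval_algHom_apply]
  simp
  ring

/-- These are the coordinates around the points of the conic where `x` is infinite; here `y / x` is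
a square root of `G(z) (1/x)² - 1` outside ℝ(z)(x). -/
theorem ker_infinity : RingHom.ker (aeval ![y / x, 1 / x, z] : MvPolynomial (Fin 3) ℝ →ₐ[ℝ] L) =
    Ideal.span {1 + X 0 ^ 2 - Polynomial.aeval (X 2) G * X 1 ^ 2} := by
  have hx := h.x_ne_zero
  have := ker_aeval_finCons (k := ℝ) (ℝ⟮z⟯⟮x⟯.restrictScalars ℝ) (y / x) ![1 / x, z]
    (h.algebraicIndependent (by
      rw [one_div]; exact transcendental_inv h.transcendental_x)) (fun i ↦ by
      fin_cases i
      · simpa using inv_mem (mem_adjoin_simple_self ℝ⟮z⟯ x)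
      · exact IntermediateField.algebraMap_mem ℝ⟮z⟯⟮x⟯ (AdjoinSimple.gen ℝ z)) (fun hmem ↦ h.notMem (by
      have := mul_mem hmem (mem_adjoin_simple_self ℝ⟮z⟯ x)
      rwa [div_mul_cancel₀ _ hx] at this))
    (Polynomial.aeval (X 1) G * X 0 ^ 2 - 1) (by
      rw [map_sub, map_mul, map_pow, ← Polynomial.aeval_algHom_apply]
      simp [← h.eq]
      field_simp
      ring)
  convert this using 2
  congr 1
  rw [map_sub, map_mul, map_pow, ← Polynomial.aeval_algHom_apply]
  simp
  ring

omit h in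
lemma pderiv_aeval_X (G : Polynomial ℝ) (i j : Fin 3) :
    pderiv i (Polynomial.aeval (X j : MvPolynomial (Fin 3) ℝ) G) =
      Polynomial.aeval (X j) (Polynomial.derivative G) * (Pi.single i 1 : Fin 3 → _) j := by
  rw [Derivation.map_aeval, pderiv_X, smul_eq_mul, Pi.single_comm]

omit h in
/-- A subring generated by a smooth point of a hypersurface is smooth of relative dimension two. -/
lemma locally_coordRing (a b c : L) (H : MvPolynomial (Fin 3) ℝ)
    (hker : RingHom.ker (aeval ![a, b, c] : MvPolynomial (Fin 3) ℝ →ₐ[ℝ] L) = Ideal.span {H})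
    (A B C' D : MvPolynomial (Fin 3) ℝ)
    (hH : D * H + A * pderiv 0 H + B * pderiv 1 H + C' * pderiv 2 H = 1)
    (T : Subring L) (hT : T = coordRing a b c) (hr : ∀ r, algebraMap ℝ L r ∈ T) :
    RingHom.Locally (RingHom.IsStandardSmoothOfRelativeDimension 2)
      ((algebraMap ℝ L).codRestrict T hr) := by
  have hT' := hT.trans (coordRing_eq_range a b c)
  subst hT'
  let φ := (aeval ![a, b, c] : MvPolynomial (Fin 3) ℝ →ₐ[ℝ] L).rangeRestrict
  have hker' : RingHom.ker φ = Ideal.span {H} := by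
    rw [← hker]
    ext p
    simp only [RingHom.mem_ker]
    exact ⟨fun h ↦ congrArg Subtype.val h, fun h ↦ Subtype.ext h⟩
  refine locally_isStandardSmoothOfRelativeDimension φ (AlgHom.rangeRestrict_surjective _) H
    hker' ?_
  rw [Ideal.eq_top_iff_one]
  have h1 := congrArg φ hH
  have h0 : φ H = 0 := by
    have : H ∈ RingHom.ker φ := by rw [hker']; exact Ideal.mem_span_singleton_self _
    exact this
  simp only [map_add, map_mul, map_one, h0, mul_zero, zero_add] at h1
  rw [← h1]
  exact add_mem (add_mem (Ideal.mul_mem_left _ _ (Ideal.subset_span ⟨0, rfl⟩))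
    (Ideal.mul_mem_left _ _ (Ideal.subset_span ⟨1, rfl⟩)))
    (Ideal.mul_mem_left _ _ (Ideal.subset_span ⟨2, rfl⟩))

/-- With `H = x² + y² - G` and a Bézout relation `u G + v G' = 1`, the combination `-u H + (u/2) x
∂ₓH + (u/2) y ∂ᵧH - v ∂_z H` equals `1`. -/
lemma locally_affine (T : Subring L) (hT : T = coordRing x y z)
    (hr : ∀ r, algebraMap ℝ L r ∈ T) :
    RingHom.Locally (RingHom.IsStandardSmoothOfRelativeDimension 2)
      ((algebraMap ℝ L).codRestrict T hr) := by
  obtain ⟨u, v, huv⟩ := h.separable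
  have huv' := congrArg (Polynomial.aeval (X 2 : MvPolynomial (Fin 3) ℝ)) huv
  simp only [map_add, map_mul, map_one] at huv'
  refine locally_coordRing x y z _ h.ker_affine
    (Polynomial.aeval (X 2) u * C 2⁻¹ * X 0) (Polynomial.aeval (X 2) u * C 2⁻¹ * X 1)
    (-Polynomial.aeval (X 2) v) (-Polynomial.aeval (X 2) u) ?_ T hT hr
  have h2 : (C 2⁻¹ : MvPolynomial (Fin 3) ℝ) * 2 = 1 := by
    rw [show (2 : MvPolynomial (Fin 3) ℝ) = C 2 from rfl, ← C_mul]; norm_num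
  simp only [map_sub, map_add, pderiv_aeval_X, Derivation.leibniz_pow, pderiv_X, Pi.single_apply]
  simp
  linear_combination huv' + (Polynomial.aeval (X 2) u * (X 0 ^ 2 + X 1 ^ 2)) * h2

/-- With `H = 1 + a² - G b²`, the combination `H - (a/2) ∂ₐH - (b/2) ∂_b H` equals `1`. -/
lemma locally_infinity (T : Subring L) (hT : T = coordRing (y / x) (1 / x) z)
    (hr : ∀ r, algebraMap ℝ L r ∈ T) :
    RingHom.Locally (RingHom.IsStandardSmoothOfRelativeDimension 2)
      ((algebraMap ℝ L).codRestrict T hr) := by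
  have h2 : (C 2⁻¹ : MvPolynomial (Fin 3) ℝ) * 2 = 1 := by
    rw [show (2 : MvPolynomial (Fin 3) ℝ) = C 2 from rfl, ← C_mul]; norm_num
  refine locally_coordRing _ _ _ _ h.ker_infinity (-(C 2⁻¹ * X 0)) (-(C 2⁻¹ * X 1))
    0 1 ?_ T hT hr
  simp only [map_sub, map_add, pderiv_aeval_X, Derivation.leibniz_pow, Derivation.leibniz,
    pderiv_X, Pi.single_apply]
  simp
  linear_combination (- X 0 ^ 2 + Polynomial.aeval (X 2) G * X 1 ^ 2) * h2

end IsStandardPoint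

end standardPoint

/-! ### The generic point of the projective line -/

section projLine

open IntermediateField

variable {L : Type} [Field L] [Algebra ℝ L]

lemma chartHom_one_injective {z : L} (hz : Transcendental ℝ z) :
    Function.Injective (chartHom ℝ 1 ![z, 1] isUnit_one) := by
  have hker := ker_chartHom (K := ℝ) ![z, 1] 1 one_ne_zero ![0] ![X 0, 1] (by
    intro i; fin_cases i <;> simp) 0 (by
    rw [map_zero, Ideal.span_singleton_zero]
    refine (RingHom.injective_iff_ker_eq_bot _).mp ?_
    have : AlgebraicIndependent ℝ (fun i : Fin 1 ↦ (![z, 1] : Fin 2 → L) (![0] i) / ![z, 1] 1) :=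
      (algebraicIndependent_unique_type_iff (ι := Fin 1)).mpr (by simpa using hz)
    exact this)
  rw [map_zero, Ideal.span_singleton_zero] at hker
  exact (RingHom.injective_iff_ker_eq_bot _).mpr hker

/-- Evaluation at a transcendental `z` is injective on the coordinate ring of the affine line, so
`Spec L` is dominant in ℙ¹ and its only point maps to the generic point. -/
lemma isGenericPoint_of_transcendental [IsIntegral (projSpace 1 ℝ)] {z : L}
    (hz : Transcendental ℝ z) :
    IsGenericPoint (projPoint ℝ 1 ![z, 1] isUnit_one default) Set.univ := by
  have h1 := isDominant_specMap_of_injective _ (chartHom_one_injective hz)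
  have h2 : IsDominant (projPoint ℝ 1 ![z, 1] isUnit_one : _ ⟶ projSpace 1 ℝ) := by
    have h4 : IsDominant (Proj.awayι (grading 1 ℝ) (X 1) (X_mem_grading 1 ℝ 1) one_pos) :=
      ⟨(Scheme.Hom.opensRange _).2.dense
        ⟨_, Spec.map (CommRingCat.ofHom (chartHom ℝ 1 ![z, 1] isUnit_one)) default, rfl⟩⟩
    exact inferInstanceAs (IsDominant (Spec.map _ ≫ Proj.awayι _ _ _ _))
  have h3 := h2.denseRange.closure_range
  rw [IsGenericPoint, ← h3]
  congr 1
  ext p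
  constructor
  · rintro rfl; exact ⟨_, rfl⟩
  · rintro ⟨t, rfl⟩; rw [Subsingleton.elim t default]; rfl

omit [Algebra ℝ L] in
lemma exists_specMap_residueField {X : Scheme.{0}} (g : Spec (.of L) ⟶ X) {η : X} (t)
    (h : g t = η) :
    ∃ σ : X.residueField η →+* L,
      g = Spec.map (CommRingCat.ofHom σ) ≫ X.fromSpecResidueField η := by
  obtain rfl : IsLocalRing.closedPoint L = t := Subsingleton.elim (α := PrimeSpectrum L) _ _
  subst h
  exact ⟨(Scheme.descResidueField (Scheme.stalkClosedPointTo g)).hom,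
    (Scheme.descResidueField_stalkClosedPointTo_fromSpecResidueField L X g).symm⟩

lemma exists_residueField_hom [IsIntegral (projSpace 1 ℝ)] {z : L} (hz : Transcendental ℝ z)
    {η : projSpace 1 ℝ} (hη : IsGenericPoint η Set.univ) :
    ∃ σ : (projSpace 1 ℝ).residueField η →+* L,
      projPoint ℝ 1 ![z, 1] isUnit_one =
        Spec.map (CommRingCat.ofHom σ) ≫ (projSpace 1 ℝ).fromSpecResidueField η := by
  exact exists_specMap_residueField _ default
    ((isGenericPoint_of_transcendental hz).eq hη)

lemma mem_range_awayι (i : Fin 2) {η : projSpace 1 ℝ} (hη : IsGenericPoint η Set.univ) :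
    η ∈ Set.range (Proj.awayι (grading 1 ℝ) (X i) (X_mem_grading 1 ℝ i) one_pos) := by
  have h : (Proj.awayι (grading 1 ℝ) (X i) (X_mem_grading 1 ℝ i) one_pos).opensRange.1.Nonempty := by
    have : Nontrivial (HomogeneousLocalization.Away (grading 1 ℝ) (X i)) :=
      (chartHom ℝ i (fun _ ↦ (1 : ℝ)) isUnit_one).domain_nontrivial
    obtain ⟨p⟩ : Nonempty (PrimeSpectrum (HomogeneousLocalization.Away (grading 1 ℝ) (X i))) :=
      inferInstance
    exact ⟨_, ⟨p, rfl⟩⟩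
  obtain ⟨p, hp⟩ := h
  exact (hη.specializes (Set.mem_univ p)).mem_open
    (Proj.awayι (grading 1 ℝ) (X i) (X_mem_grading 1 ℝ i) one_pos).opensRange.2 hp

/-- Elements of the residue field are quotients of functions on the affine line, and `σ` carries
those functions onto ℝ[z]. -/
lemma range_residueField_hom {z : L} (hz : Transcendental ℝ z)
    {η : projSpace 1 ℝ} (hη : IsGenericPoint η Set.univ)
    (σ : (projSpace 1 ℝ).residueField η →+* L)
    (hσ : projPoint ℝ 1 ![z, 1] isUnit_one =
        Spec.map (CommRingCat.ofHom σ) ≫ (projSpace 1 ℝ).fromSpecResidueField η) :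
    σ.range = ℝ⟮z⟯.toSubfield.toSubring := by
  obtain ⟨φ, hφ, hfrac⟩ := exists_specMap_eq_fromSpecResidueField
    (Proj.awayι (grading 1 ℝ) (X 1) (X_mem_grading 1 ℝ 1) one_pos) η (mem_range_awayι 1 hη)
  have hcomp : chartHom ℝ 1 ![z, 1] isUnit_one = σ.comp φ := by
    have h0 : Spec.map (CommRingCat.ofHom (chartHom ℝ 1 ![z, 1] isUnit_one)) ≫
        Proj.awayι (grading 1 ℝ) (X 1) (X_mem_grading 1 ℝ 1) one_pos =
        Spec.map (CommRingCat.ofHom (σ.comp φ)) ≫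
        Proj.awayι (grading 1 ℝ) (X 1) (X_mem_grading 1 ℝ 1) one_pos := by
      rw [CommRingCat.ofHom_comp, Spec.map_comp, Category.assoc, hφ]
      exact hσ
    rw [cancel_mono] at h0
    exact congrArg CommRingCat.Hom.hom (Spec.map_injective h0)
  have hran := range_chartHom (K := ℝ) ![z, 1] 1 one_ne_zero
  have hle : ratioRing ℝ ![z, 1] 1 ≤ ℝ⟮z⟯.toSubfield.toSubring := by
    have : Algebra.adjoin ℝ (Set.range fun i ↦ (![z, 1] : Fin 2 → L) i / ![z, 1] 1) ≤
        ℝ⟮z⟯.toSubalgebra := by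
      refine Algebra.adjoin_le ?_
      rintro _ ⟨i, rfl⟩
      fin_cases i
      · simpa using mem_adjoin_simple_self ℝ z
      · simp
    exact this
  have hmem (p : Polynomial ℝ) : ∃ r, σ (φ r) = Polynomial.aeval z p := by
    have : Polynomial.aeval z p ∈ (chartHom ℝ 1 ![z, 1] isUnit_one).range := by
      rw [hran]
      change _ ∈ Algebra.adjoin ℝ _
      refine Algebra.adjoin_mono ?_ (Polynomial.aeval_mem_adjoin_singleton ℝ z)
      rintro _ rfl
      exact ⟨0, by simp⟩
    obtain ⟨r, hr⟩ := this
    exact ⟨r, by rw [← hr, hcomp]; rfl⟩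
  apply le_antisymm
  · rintro _ ⟨s, rfl⟩
    obtain ⟨r, t, ht, hrt⟩ := hfrac s
    have h1 (r) : σ (φ r) ∈ ℝ⟮z⟯ := by
      have : σ (φ r) ∈ (chartHom ℝ 1 ![z, 1] isUnit_one).range := by rw [hcomp]; exact ⟨r, rfl⟩
      rw [hran] at this
      exact hle this
    have h2 : σ s = σ (φ r) / σ (φ t) := by
      rw [eq_div_iff (by simpa using ht), ← map_mul, hrt]
    rw [h2]
    exact div_mem (S := IntermediateField ℝ L) (h1 r) (h1 t)
  · intro s hs
    obtain ⟨p, q, rfl⟩ := (mem_adjoin_simple_iff ℝ s).mp hs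
    obtain ⟨r, hr⟩ := hmem p
    obtain ⟨t, ht⟩ := hmem q
    exact ⟨φ r / φ t, by rw [map_div₀, hr, ht]⟩

lemma isPlaneConic_of_iso {K : Type} [Field K] {C C' : Scheme.{0}}
    {sC : C ⟶ Spec (.of K)} {sC' : C' ⟶ Spec (.of K)} (e : C ≅ C')
    (he : e.hom ≫ sC' = sC) (h : IsPlaneConic K sC') : IsPlaneConic K sC := by
  obtain ⟨Q, hQ, i, hQ0, hi, hs, hker⟩ := h
  refine ⟨Q, hQ, e.hom ≫ i, hQ0, inferInstance, by rw [Category.assoc, hs, he], fun j ↦ ?_⟩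
  rw [← hker j]
  have hinj : Function.Injective (e.hom.app (i ⁻¹ᵁ Proj.basicOpen (grading 2 K) (X j))) :=
    (ConcreteCategory.bijective_of_isIso _).1
  ext t
  rw [RingHom.mem_ker, RingHom.mem_ker]
  have h1 : (e.hom ≫ i).app (Proj.basicOpen (grading 2 K) (X j)) t =
      e.hom.app (i ⁻¹ᵁ Proj.basicOpen (grading 2 K) (X j))
        (i.app (Proj.basicOpen (grading 2 K) (X j)) t) := by
    rw [Scheme.Hom.comp_app]; rfl
  exact (Eq.congr_left h1).trans (map_eq_zero_iff _ hinj)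

end projLine

/-! ### Coordinate rings of the projective model -/

section model

open IntermediateField

lemma div_mem_ratioRing {n : ℕ} {K L : Type u} [Field K] [Field L] [Algebra K L]
    (v : Fin (n + 1) → L) (i j : Fin (n + 1)) : v i / v j ∈ ratioRing K v j :=
  Algebra.subset_adjoin ⟨i, rfl⟩

lemma algebraMap_mem_ratioRing {n : ℕ} {K L : Type u} [Field K] [Field L] [Algebra K L]
    (v : Fin (n + 1) → L) (j : Fin (n + 1)) (r : K) : algebraMap K L r ∈ ratioRing K v j :=
  Subalgebra.algebraMap_mem (Algebra.adjoin K (Set.range fun i ↦ v i / v j)) r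

lemma ratioRing_le {n : ℕ} {K L : Type u} [Field K] [Field L] [Algebra K L]
    {v : Fin (n + 1) → L} {j : Fin (n + 1)} {T : Subring L} (hT : ∀ r, algebraMap K L r ∈ T)
    (h : ∀ i, v i / v j ∈ T) : ratioRing K v j ≤ T := by
  let S : Subalgebra K L := { T with algebraMap_mem' := hT }
  have : Algebra.adjoin K (Set.range fun i ↦ v i / v j) ≤ S :=
    Algebra.adjoin_le (Set.range_subset_iff.mpr h)
  exact this

variable {L : Type} [Field L] [Algebra ℝ L]

/-- The exponents `ea`, `eb`, `ec` write each ratio as a monomial in `a`, `b`, `c`, and `ia`, `ib`,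
`ic` point to the coordinates whose ratios are `a`, `b`, `c` themselves. These two facts are the two
inclusions. -/
lemma ratioRing_eq_coordRing {n : ℕ} (v : Fin (n + 1) → L) (j : Fin (n + 1)) (hj : v j ≠ 0)
    (a b c : L) (ea eb ec : Fin (n + 1) → ℕ) (h : ∀ i, v i = v j * (a ^ ea i * b ^ eb i * c ^ ec i))
    (ia ib ic : Fin (n + 1)) (ha : v ia = v j * a) (hb : v ib = v j * b) (hc : v ic = v j * c) :
    ratioRing ℝ v j = coordRing a b c := by
  apply le_antisymm
  · refine ratioRing_le (algebraMap_mem_coordRing a b c) fun i ↦ ?_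
    rw [h i, mul_div_cancel_left₀ _ hj]
    exact mul_mem (mul_mem (pow_mem (left_mem_coordRing a b c) _)
      (pow_mem (mid_mem_coordRing a b c) _)) (pow_mem (right_mem_coordRing a b c) _)
  · refine coordRing_le (algebraMap_mem_ratioRing v j) ?_ ?_ ?_
    · simpa [ha, mul_div_cancel_left₀ _ hj] using div_mem_ratioRing (K := ℝ) v ia j
    · simpa [hb, mul_div_cancel_left₀ _ hj] using div_mem_ratioRing (K := ℝ) v ib j
    · simpa [hc, mul_div_cancel_left₀ _ hj] using div_mem_ratioRing (K := ℝ) v ic j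

/-- Once κ is adjoined, `c` becomes a constant and nonzero scalars in `a` and `b` are immaterial,
which leaves the two affine coordinates of a chart of ℙ²_κ. -/
lemma coordRing_sup_eq_ratioRing {κ : Type} [Field κ] [Algebra κ L]
    (hκ : ∀ r, algebraMap ℝ L r ∈ (algebraMap κ L).range) (v : Fin 3 → L) (j ia ib : Fin 3)
    (hcov : ∀ i, i = j ∨ i = ia ∨ i = ib) (hj : v j ≠ 0) {a b c : L} (ka kb kc : κ)
    (hka : ka ≠ 0) (hkb : kb ≠ 0)
    (ha : a = algebraMap κ L ka * (v ia / v j)) (hb : b = algebraMap κ L kb * (v ib / v j))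
    (hc : c = algebraMap κ L kc) :
    coordRing a b c ⊔ (algebraMap κ L).range = ratioRing κ v j := by
  apply le_antisymm
  · have hle : (algebraMap κ L).range ≤ ratioRing κ v j := by
      rintro _ ⟨r, rfl⟩
      exact algebraMap_mem_ratioRing v j r
    refine sup_le (coordRing_le (fun r ↦ hle (hκ r)) ?_ ?_ ?_) hle
    · rw [ha]; exact mul_mem (algebraMap_mem_ratioRing v j _) (div_mem_ratioRing v _ j)
    · rw [hb]; exact mul_mem (algebraMap_mem_ratioRing v j _) (div_mem_ratioRing v _ j)
    · rw [hc]; exact algebraMap_mem_ratioRing v j _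
  · have hr (r : κ) : algebraMap κ L r ∈ coordRing a b c ⊔ (algebraMap κ L).range :=
      le_sup_right (a := coordRing a b c) (⟨r, rfl⟩ : _ ∈ (algebraMap κ L).range)
    have hl {t : L} (ht : t ∈ coordRing a b c) : t ∈ coordRing a b c ⊔ (algebraMap κ L).range :=
      le_sup_left (b := (algebraMap κ L).range) ht
    refine ratioRing_le hr fun i ↦ ?_
    rcases hcov i with rfl | rfl | rfl
    · rw [div_self hj]; exact one_mem _
    · have : v i / v j = algebraMap κ L ka⁻¹ * a := by
        rw [ha, ← mul_assoc, ← map_mul, inv_mul_cancel₀ hka, map_one, one_mul]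
      rw [this]
      exact mul_mem (hr _) (hl (left_mem_coordRing _ _ _))
    · have : v i / v j = algebraMap κ L kb⁻¹ * b := by
        rw [hb, ← mul_assoc, ← map_mul, inv_mul_cancel₀ hkb, map_one, one_mul]
      rw [this]
      exact mul_mem (hr _) (hl (mid_mem_coordRing _ _ _))

/-- Homogeneous coordinates on `ℙ⁷` of the smooth model of `x ^ 2 + y ^ 2 = G(z)`. -/
def embVec (x y z : L) (m : ℕ) : Fin 8 → L :=
  ![x, x * z, y, y * z, 1, z, z ^ m, z ^ (m + 1)]

/-- Coordinates of the six affine charts of the smooth model. -/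
def chartCoord (x y z : L) (m : ℕ) : Fin 6 → Subring L :=
  ![coordRing (y / x) (1 / x) z, coordRing ((y / z ^ m) / (x / z ^ m)) (1 / (x / z ^ m)) z⁻¹,
    coordRing (x / y) (1 / y) z, coordRing ((x / z ^ m) / (y / z ^ m)) (1 / (y / z ^ m)) z⁻¹,
    coordRing x y z, coordRing (x / z ^ m) (y / z ^ m) z⁻¹]

/-- The standard charts of `ℙ⁷` that cover the smooth model. -/
def chartIndex : Fin 6 → Fin 8 := ![0, 1, 2, 3, 4, 7]

omit [Algebra ℝ L] in
lemma embVec_ne_zero {x y z : L} (hx : x ≠ 0) (hy : y ≠ 0) (hz : z ≠ 0) (m : ℕ) (i : Fin 8) :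
    embVec x y z m i ≠ 0 := by
  fin_cases i <;> simp [embVec, hx, hy, hz]

/-- The exponents are read off from the eight coordinates. For example, over the coordinate `z ^ (m
+ 1)`, with `a = x / zᵐ` and `c = 1 / z`, the ratios of `x`, `x z` and `1` are `a c`, `a` and `c ^
(m + 1)`. -/
lemma ratioRing_embVec {x y z : L} (hx : x ≠ 0) (hy : y ≠ 0) (hz : z ≠ 0) (m : ℕ) (i : Fin 6) :
    ratioRing ℝ (embVec x y z m) (chartIndex i) = chartCoord x y z m i := by
  fin_cases i
  · refine ratioRing_eq_coordRing _ _ (embVec_ne_zero hx hy hz m _) _ _ _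
      ![0, 0, 1, 1, 0, 0, 0, 0] ![0, 0, 0, 0, 1, 1, 1, 1] ![0, 1, 0, 1, 0, 1, m, m + 1] ?_ 2 4 1
      ?_ ?_ ?_
    · intro i; fin_cases i <;> simp [embVec, chartIndex] <;> field_simp
    all_goals simp [embVec, chartIndex] <;> try field_simp
  · refine ratioRing_eq_coordRing _ _ (embVec_ne_zero hx hy hz m _) _ _ _
      ![0, 0, 1, 1, 0, 0, 0, 0] ![0, 0, 0, 0, 1, 1, 1, 1] ![1, 0, 1, 0, m + 1, m, 1, 0] ?_ 3 7 0
      ?_ ?_ ?_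
    · intro i; fin_cases i <;> simp [embVec, chartIndex] <;> field_simp <;>
        try ring
    all_goals simp [embVec, chartIndex] <;> try (field_simp <;> try ring)
  · refine ratioRing_eq_coordRing _ _ (embVec_ne_zero hx hy hz m _) _ _ _
      ![1, 1, 0, 0, 0, 0, 0, 0] ![0, 0, 0, 0, 1, 1, 1, 1] ![0, 1, 0, 1, 0, 1, m, m + 1] ?_ 0 4 3
      ?_ ?_ ?_
    · intro i; fin_cases i <;> simp [embVec, chartIndex] <;> field_simp
    all_goals simp [embVec, chartIndex] <;> try field_simp
  · refine ratioRing_eq_coordRing _ _ (embVec_ne_zero hx hy hz m _) _ _ _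
      ![1, 1, 0, 0, 0, 0, 0, 0] ![0, 0, 0, 0, 1, 1, 1, 1] ![1, 0, 1, 0, m + 1, m, 1, 0] ?_ 1 7 2
      ?_ ?_ ?_
    · intro i; fin_cases i <;> simp [embVec, chartIndex] <;> field_simp <;>
        try ring
    all_goals simp [embVec, chartIndex] <;> try (field_simp <;> try ring)
  · refine ratioRing_eq_coordRing _ _ (embVec_ne_zero hx hy hz m _) _ _ _
      ![1, 1, 0, 0, 0, 0, 0, 0] ![0, 0, 1, 1, 0, 0, 0, 0] ![0, 1, 0, 1, 0, 1, m, m + 1] ?_ 0 2 5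
      ?_ ?_ ?_
    · intro i; fin_cases i <;> simp [embVec, chartIndex]
    all_goals simp [embVec, chartIndex]
  · refine ratioRing_eq_coordRing _ _ (embVec_ne_zero hx hy hz m _) _ _ _
      ![1, 1, 0, 0, 0, 0, 0, 0] ![0, 0, 1, 1, 0, 0, 0, 0] ![1, 0, 1, 0, m + 1, m, 1, 0] ?_ 1 3 6
      ?_ ?_ ?_
    · intro i; fin_cases i <;> simp [embVec, chartIndex] <;> field_simp <;>
        try ring
    all_goals simp [embVec, chartIndex] <;> try (field_simp <;> try ring)

/-- Only the coordinates `z` and `zᵐ` have no chart of their own. Where `z` is the denominator, the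
ratio of `z ^ (m + 1)` is invertible with inverse `(1/z)ᵐ`. Where `zᵐ` is the denominator, the ratio
of `1` is invertible with inverse `zᵐ = (z ^ (m + 1) / zᵐ)ᵐ`. -/
lemma exists_embVec_div_mem {x y z : L} (hx : x ≠ 0) (hy : y ≠ 0) (hz : z ≠ 0) (m : ℕ) (k : Fin 8) :
    ∃ i, embVec x y z m k / embVec x y z m (chartIndex i) ∈ ratioRing ℝ (embVec x y z m) k := by
  have hself (i : Fin 6) (hi : chartIndex i = k) : embVec x y z m k /
      embVec x y z m (chartIndex i) ∈ ratioRing ℝ (embVec x y z m) k := by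
    rw [hi, div_self (embVec_ne_zero hx hy hz m k)]; exact one_mem _
  fin_cases k
  · exact ⟨0, hself 0 rfl⟩
  · exact ⟨1, hself 1 rfl⟩
  · exact ⟨2, hself 2 rfl⟩
  · exact ⟨3, hself 3 rfl⟩
  · exact ⟨4, hself 4 rfl⟩
  · refine ⟨5, ?_⟩
    have : embVec x y z m 5 / embVec x y z m (chartIndex 5) =
        (embVec x y z m 4 / embVec x y z m 5) ^ m := by
      simp [embVec, chartIndex, pow_succ]; field_simp
    exact this ▸ pow_mem (div_mem_ratioRing (K := ℝ) (embVec x y z m) 4 5) m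
  · refine ⟨4, ?_⟩
    have : embVec x y z m 6 / embVec x y z m (chartIndex 4) =
        (embVec x y z m 7 / embVec x y z m 6) ^ m := by
      simp [embVec, chartIndex, pow_succ, mul_div_cancel_left₀ _ (pow_ne_zero m hz)]
    exact this ▸ pow_mem (div_mem_ratioRing (K := ℝ) (embVec x y z m) 7 6) m
  · exact ⟨5, hself 5 rfl⟩

lemma chartCoord_locally {x y z : L} {G G' : Polynomial ℝ} {m : ℕ} (h : IsStandardPoint x y z G)
    (h' : IsStandardPoint (x / z ^ m) (y / z ^ m) z⁻¹ G') (i : Fin 6) (T : Subring L)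
    (hT : T = chartCoord x y z m i) (hr : ∀ r, algebraMap ℝ L r ∈ T) :
    RingHom.Locally (RingHom.IsStandardSmoothOfRelativeDimension 2)
      ((algebraMap ℝ L).codRestrict T hr) := by
  fin_cases i
  · exact h.locally_infinity T hT hr
  · exact h'.locally_infinity T hT hr
  · exact h.swap.locally_infinity T hT hr
  · exact h'.swap.locally_infinity T hT hr
  · exact h.locally_affine T hT hr
  · exact h'.locally_affine T hT hr

lemma chartCoord_sup_eq_ratioRing {κ : Type} [Field κ] [Algebra κ L]
    (hκ : ∀ r, algebraMap ℝ L r ∈ (algebraMap κ L).range) {x y z : L} (hx : x ≠ 0) (hy : y ≠ 0)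
    (hz : z ≠ 0) (m : ℕ) (ζ : κ) (hζ : algebraMap κ L ζ = z) (i : Fin 6) :
    chartCoord x y z m i ⊔ (algebraMap κ L).range =
      ratioRing κ ![x, y, 1] ((![0, 0, 1, 1, 2, 2] : Fin 6 → Fin 3) i) := by
  have hζ0 : ζ ≠ 0 := by rintro rfl; exact hz (by rw [← hζ, map_zero])
  fin_cases i
  · exact coordRing_sup_eq_ratioRing hκ _ 0 1 2 (by decide) hx 1 1 ζ one_ne_zero one_ne_zero
      (by simp) (by simp) hζ.symm
  · exact coordRing_sup_eq_ratioRing hκ _ 0 1 2 (by decide) hx 1 (ζ ^ m) ζ⁻¹ one_ne_zero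
      (pow_ne_zero _ hζ0) (by simp; field_simp) (by simp [hζ]; field_simp) (by simp [hζ])
  · exact coordRing_sup_eq_ratioRing hκ _ 1 0 2 (by decide) hy 1 1 ζ one_ne_zero one_ne_zero
      (by simp) (by simp) hζ.symm
  · exact coordRing_sup_eq_ratioRing hκ _ 1 0 2 (by decide) hy 1 (ζ ^ m) ζ⁻¹ one_ne_zero
      (pow_ne_zero _ hζ0) (by simp; field_simp) (by simp [hζ]; field_simp) (by simp [hζ])
  · exact coordRing_sup_eq_ratioRing hκ _ 2 0 1 (by decide) one_ne_zero 1 1 ζ one_ne_zero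
      one_ne_zero (by simp) (by simp) hζ.symm
  · exact coordRing_sup_eq_ratioRing hκ _ 2 0 1 (by decide) one_ne_zero (ζ ^ m)⁻¹ (ζ ^ m)⁻¹ ζ⁻¹
      (inv_ne_zero (pow_ne_zero _ hζ0)) (inv_ne_zero (pow_ne_zero _ hζ0))
      (by simp [hζ]; field_simp) (by simp [hζ]; field_simp) (by simp [hζ])

/-- Either `z` or `1 / z` is regular on each chart, so the fibration extends to the whole model as a
morphism to ℙ¹. -/
lemma exists_ratioRing_le_chartCoord {x y z : L} (hz : z ≠ 0) (m : ℕ) (i : Fin 6) :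
    ratioRing ℝ ![z, 1] ((![1, 0, 1, 0, 1, 0] : Fin 6 → Fin 2) i) ≤ chartCoord x y z m i := by
  have hr : ∀ r, algebraMap ℝ L r ∈ chartCoord x y z m i := by
    intro r; fin_cases i <;> exact algebraMap_mem_coordRing _ _ _ r
  have h1 (a b : L) : ratioRing ℝ ![z, 1] 1 ≤ coordRing a b z := by
    refine ratioRing_le (algebraMap_mem_coordRing a b z) fun j ↦ ?_
    fin_cases j
    · simpa using right_mem_coordRing a b z
    · simp
  have h2 (a b : L) : ratioRing ℝ ![z, 1] 0 ≤ coordRing a b z⁻¹ := by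
    refine ratioRing_le (algebraMap_mem_coordRing a b z⁻¹) fun j ↦ ?_
    fin_cases j
    · simp [hz]
    · simpa using right_mem_coordRing a b z⁻¹
  fin_cases i
  exacts [h1 _ _, h2 _ _, h1 _ _, h2 _ _, h1 _ _, h2 _ _]

end model

/-! ### The standard conic fibration -/

section standardModel

open IntermediateField Limits

variable {L : Type} [Field L] [Algebra ℝ L]

omit [Algebra ℝ L] in
lemma specGen_comp_specMap {R : Type} [CommRing R] (T : Subring L) (θ : R →+* T) :
    specGen T ≫ Spec.map (CommRingCat.ofHom θ) =
      Spec.map (CommRingCat.ofHom (T.subtype.comp θ)) := by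
  rw [specGen, ← Spec.map_comp, ← CommRingCat.ofHom_comp]

lemma ChartCover.map_comp_str {S : Scheme.{0}} {q : Spec (.of L) ⟶ S} {ι : Type}
    {T : ι → Subring L} (𝒞 : ChartCover q T) (s : S ⟶ Spec (.of ℝ))
    (hs : q ≫ s = Spec.map (CommRingCat.ofHom (algebraMap ℝ L))) (i : ι)
    (hr : ∀ r, algebraMap ℝ L r ∈ T i) :
    𝒞.map i ≫ s = Spec.map (CommRingCat.ofHom ((algebraMap ℝ L).codRestrict (T i) hr)) := by
  refine ext_of_isDominant (specGen (T i)) ?_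
  rw [← Category.assoc, (𝒞.isChart i).fac, hs, specGen_comp_specMap]
  rfl

lemma ChartCover.smoothOfRelativeDimension {S : Scheme.{0}} {q : Spec (.of L) ⟶ S} {ι : Type}
    {T : ι → Subring L} (𝒞 : ChartCover q T) (s : S ⟶ Spec (.of ℝ))
    (hs : q ≫ s = Spec.map (CommRingCat.ofHom (algebraMap ℝ L)))
    (hT : ∀ i r, algebraMap ℝ L r ∈ T i)
    (hsm : ∀ i, RingHom.Locally (RingHom.IsStandardSmoothOfRelativeDimension 2)
      ((algebraMap ℝ L).codRestrict (T i) (hT i))) :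
    SmoothOfRelativeDimension 2 s := by
  have haff (i) : IsAffine (𝒞.openCover.X i) := inferInstanceAs (IsAffine (Spec (.of (T i))))
  refine (HasRingHomProperty.iff_of_source_openCover (P := @SmoothOfRelativeDimension.{0} 2)
    𝒞.openCover).mpr fun i ↦ ?_
  rw [← HasRingHomProperty.iff_of_isAffine (P := @SmoothOfRelativeDimension.{0} 2)]
  have h1 : 𝒞.openCover.f i ≫ s = _ := 𝒞.map_comp_str s hs i (hT i)
  rw [h1]
  exact (HasRingHomProperty.Spec_iff (P := @SmoothOfRelativeDimension.{0} 2)).mpr (hsm i)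

lemma ChartCover.exists_hom_projLine {S : Scheme.{0}} {q : Spec (.of L) ⟶ S} {ι : Type}
    {T : ι → Subring L} (𝒞 : ChartCover q T) {z : L} (hz : z ≠ 0) (e : ι → Fin 2)
    (hT : ∀ i, ratioRing ℝ ![z, 1] (e i) ≤ T i) :
    ∃ f : S ⟶ projSpace 1 ℝ, q ≫ f = projPoint ℝ 1 ![z, 1] isUnit_one ∧
      ∀ i, Set.range (𝒞.map i ≫ f) ⊆
        Set.range (Proj.awayι (grading 1 ℝ) (X (e i)) (X_mem_grading 1 ℝ (e i)) one_pos) := by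
  have hne (j : Fin 2) : ![z, 1] j ≠ 0 := by fin_cases j <;> simp [hz]
  have hmem (i : ι) (t) : chartHom ℝ (e i) ![z, 1] (hne (e i)).isUnit t ∈ T i := by
    refine hT i ?_
    rw [← range_chartHom ![z, 1] (e i) (hne (e i))]
    exact ⟨t, rfl⟩
  obtain ⟨f, hf, hq⟩ := 𝒞.exists_hom (projPoint ℝ 1 ![z, 1] isUnit_one)
    (fun i ↦ Spec.map (CommRingCat.ofHom
      ((chartHom ℝ (e i) ![z, 1] (hne (e i)).isUnit).codRestrict (T i) (hmem i))) ≫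
      Proj.awayι (grading 1 ℝ) (X (e i)) (X_mem_grading 1 ℝ (e i)) one_pos) (fun i ↦ by
    rw [← Category.assoc, specGen_comp_specMap]
    exact projPoint_congr_index (K := ℝ) (hne (e i)).isUnit isUnit_one)
  refine ⟨f, hq, fun i ↦ ?_⟩
  rw [hf]
  rintro _ ⟨t, rfl⟩
  exact ⟨_, rfl⟩

/-- Passing to the generic fibre adjoins the residue field to the charts. The six charts become the
three charts of the closure of `(x : y : 1)` in the projective plane, each occurring twice. By
`ChartCover.exists_iso` the fibre is that closure, a conic by `isPlaneConic_image`. -/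
theorem isPlaneConic_genericFiber {S : Scheme.{0}} [S.IsSeparated] [IsIntegral (projSpace 1 ℝ)]
    {q : Spec (.of L) ⟶ S} {x y z : L} {G : Polynomial ℝ} {m : ℕ} (h : IsStandardPoint x y z G)
    (𝒞 : ChartCover q (chartCoord x y z m)) (f : S ⟶ projSpace 1 ℝ)
    (hf : q ≫ f = projPoint ℝ 1 ![z, 1] isUnit_one) (e : Fin 6 → Fin 2)
    (hfe : ∀ i, Set.range (𝒞.map i ≫ f) ⊆
        Set.range (Proj.awayι (grading 1 ℝ) (X (e i)) (X_mem_grading 1 ℝ (e i)) one_pos))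
    {η : projSpace 1 ℝ} (hη : IsGenericPoint η Set.univ) :
    IsPlaneConic ((projSpace 1 ℝ).residueField η) (f.fiberToSpecResidueField η) := by
  obtain ⟨σ, hσ⟩ := exists_residueField_hom h.transcendental_z hη
  have hrange := range_residueField_hom h.transcendental_z hη σ hσ
  let := σ.toAlgebra
  obtain ⟨𝒟⟩ := exists_chartCover_fiber f q η σ (hf.trans hσ) 𝒞 fun i ↦
    ⟨_, Proj.awayι (grading 1 ℝ) (X (e i)) (X_mem_grading 1 ℝ (e i)) one_pos, inferInstance,
      mem_range_awayι _ hη, hfe i⟩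
  have hmem (s : L) (hs : s ∈ ℝ⟮z⟯) : s ∈ σ.range := hrange.ge hs
  obtain ⟨ζ, hζ⟩ := hmem z (mem_adjoin_simple_self ℝ z)
  have hv (i : Fin 3) : ![x, y, 1] i ≠ 0 := by
    fin_cases i <;> simp [h.x_ne_zero, h.y_ne_zero]
  have hT (i : Fin 6) : chartCoord x y z m i ⊔ σ.range = _ :=
    chartCoord_sup_eq_ratioRing (κ := (projSpace 1 ℝ).residueField η)
      (fun r ↦ hmem _ (IntermediateField.algebraMap_mem ℝ⟮z⟯ r)) h.x_ne_zero h.y_ne_zero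
      h.z_ne_zero m ζ hζ i
  rw [funext hT] at 𝒟
  obtain ⟨𝒟'⟩ := exists_chartCover_image (K := (projSpace 1 ℝ).residueField η) ![x, y, 1] hv 2
    (![0, 0, 1, 1, 2, 2] : Fin 6 → Fin 3) (fun k ↦ by
      obtain ⟨i, hi⟩ : ∃ i, (![0, 0, 1, 1, 2, 2] : Fin 6 → Fin 3) i = k := by
        fin_cases k
        exacts [⟨0, rfl⟩, ⟨2, rfl⟩, ⟨4, rfl⟩]
      refine ⟨i, ?_⟩
      rw [hi, div_self (hv k)]
      exact one_mem _)
  have hsep : (f.fiber η).IsSeparated := by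
    have : IsSeparated (f.fiberToSpecResidueField η) := by
      have : IsSeparated f := inferInstance
      exact inferInstanceAs (IsSeparated (pullback.snd _ _))
    exact ⟨by
      rw [← terminal.comp_from (f.fiberToSpecResidueField η)]
      infer_instance⟩
  have hsep' : (projPoint ((projSpace 1 ℝ).residueField η) 2 ![x, y, 1]
      (hv 2).isUnit).image.IsSeparated := ⟨by
    rw [← terminal.comp_from (projPoint ((projSpace 1 ℝ).residueField η) 2 ![x, y, 1]
      (hv 2).isUnit).imageι]
    infer_instance⟩
  have hsep₂ : (pullback f ((projSpace 1 ℝ).fromSpecResidueField η)).IsSeparated := hsep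
  obtain ⟨iso, hiso⟩ := 𝒟.exists_iso 𝒟'
  have hinj (s : (projSpace 1 ℝ).residueField η) (hs : σ s = 0) : s = 0 := by simpa using hs
  have hσmem (s) : σ s ∈ ℝ⟮z⟯ := hrange.le ⟨s, rfl⟩
  obtain ⟨g, hg⟩ := h.exists_algebraMap_eq
  obtain ⟨g', hg'⟩ := hmem g g.2
  refine isPlaneConic_of_iso iso ?_ (isPlaneConic_image (x := x) (y := y) (g := g') ?_ ?_ ?_)
  · refine 𝒟.hom_ext ?_
    refine Eq.trans ((Category.assoc _ _ _).symm.trans (congrArg (· ≫ ((projPoint _ 2 ![x, y, 1]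
      (hv 2).isUnit).imageι ≫ projSpaceStr 2 _)) hiso)) ?_
    refine Eq.trans (b := Spec.map (CommRingCat.ofHom σ)) ?_ (pullback.lift_snd _ _ _).symm
    rw [← Category.assoc, Scheme.Hom.toImage_imageι]
    exact projPoint_str _ _ _
  · intro a b hab
    refine hinj a (congrArg Subtype.val (eq_zero_of_sq_add_sq_eq_zero h.transcendental_z
      ⟨σ a, hσmem a⟩ ⟨σ b, hσmem b⟩ (Subtype.ext ?_)))
    change σ a ^ 2 + σ b ^ 2 = 0
    rw [← map_pow, ← map_pow, ← map_add, hab, map_zero]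
  · intro halg
    apply h.transcendental_x
    obtain ⟨p, hp0, hp⟩ := halg
    refine ⟨p.map (σ.codRestrict ℝ⟮z⟯.toSubfield.toSubring hσmem), ?_, ?_⟩
    · rw [Polynomial.map_ne_zero_iff (RingHom.injective _)]
      exact hp0
    · rw [Polynomial.aeval_def, Polynomial.eval₂_map]
      exact hp
  · rw [hg]
    exact hg'.symm

lemma standardPoly_eq {ι : Type} [Fintype ι] (ε : ℝ) (a : ι → ℝ) :
    standardPoly ε a = X 0 ^ 2 + X 1 ^ 2 - Polynomial.aeval (X 2)
      (Polynomial.C ε * ∏ i, (Polynomial.X - Polynomial.C (a i))) := by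
  simp [standardPoly, map_prod]

/-- By `ker_affine` the coordinate ring of the affine surface is the subring `coordRing x y z`. Both
compatibilities are then checked on the dense `Spec L`. -/
theorem hasStandardAffineEquation_of_isChart {S : Scheme.{0}} {q : Spec (.of L) ⟶ S}
    {ι : Type} [Fintype ι] {ε : ℝ} {a : ι → ℝ} {x y z : L}
    (h : IsStandardPoint x y z (Polynomial.C ε * ∏ i, (Polynomial.X - Polynomial.C (a i))))
    {c : Spec (.of (coordRing x y z)) ⟶ S} (hc : IsChart q (coordRing x y z) c)
    {s : S ⟶ Spec (.of ℝ)} (hs : q ≫ s = Spec.map (CommRingCat.ofHom (algebraMap ℝ L)))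
    {f : S ⟶ projSpace 1 ℝ} (hf : q ≫ f = projPoint ℝ 1 ![z, 1] isUnit_one) :
    HasStandardAffineEquation s f ε a := by
  have hker := h.ker_affine
  rw [← standardPoly_eq] at hker
  let θ : StandardRing ε a →ₐ[ℝ] L := Ideal.Quotient.liftₐ _ (aeval ![x, y, z]) fun p hp ↦ by
    rw [← hker] at hp; exact hp
  have hθinj : Function.Injective θ := by
    refine (injective_iff_map_eq_zero θ).mpr fun t ht ↦ ?_
    obtain ⟨p, rfl⟩ := Ideal.Quotient.mk_surjective t
    exact Ideal.Quotient.eq_zero_iff_mem.mpr (hker.le ht)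
  have hθmk (p : MvPolynomial (Fin 3) ℝ) : θ (Ideal.Quotient.mk _ p) = aeval ![x, y, z] p := rfl
  have hθmem (t) : θ t ∈ coordRing x y z := by
    obtain ⟨p, rfl⟩ := Ideal.Quotient.mk_surjective t
    rw [coordRing_eq_range]
    exact ⟨p, rfl⟩
  let θ' : StandardRing ε a →+* coordRing x y z := θ.toRingHom.codRestrict _ hθmem
  have hb : Function.Bijective θ' := by
    refine ⟨fun u v huv ↦ hθinj (congrArg Subtype.val huv), ?_⟩
    rintro ⟨t, ht⟩
    have ht' := ht
    rw [coordRing_eq_range] at ht'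
    obtain ⟨p, hp⟩ := ht'
    exact ⟨Ideal.Quotient.mk _ p, Subtype.ext hp⟩
  let e := RingEquiv.ofBijective θ' hb
  let j : Spec (.of (StandardRing ε a)) ⟶ S := Spec.map (e.symm.toCommRingCatIso.hom) ≫ c
  have := hc.isOpenImmersion
  have hj : Spec.map (CommRingCat.ofHom θ.toRingHom) ≫ j = q := by
    rw [← hc.fac]
    simp only [j]
    rw [← Category.assoc, ← Spec.map_comp]
    congr 2
    ext t
    exact congrArg Subtype.val (e.apply_symm_apply t)
  have hdom : IsDominant (Spec.map (CommRingCat.ofHom θ.toRingHom)) :=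
    isDominant_specMap_of_injective _ hθinj
  have hred : AlgebraicGeometry.IsReduced (Spec (.of (StandardRing ε a))) := by
    have : _root_.IsReduced (StandardRing ε a) := isReduced_of_injective θ.toRingHom hθinj
    infer_instance
  refine ⟨j, inferInstance, ?_, ?_⟩
  · refine ext_of_isDominant (Spec.map (CommRingCat.ofHom θ.toRingHom)) ?_
    rw [← Category.assoc, hj, hs, ← Spec.map_comp, ← CommRingCat.ofHom_comp]
    congr 2
    exact θ.comp_algebraMap.symm
  · refine ext_of_isDominant (Spec.map (CommRingCat.ofHom θ.toRingHom)) ?_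
    rw [← Category.assoc, hj, hf, toP1_eq_projPoint, comp_projPoint]
    congr 1
    ext i
    fin_cases i
    · change z = θ (Ideal.Quotient.mk _ (X 2))
      rw [hθmk]; simp
    · simp

/-- A generic point of `x ^ 2 + y ^ 2 = G(z)`, with `G` separable of even degree, extends to a
conic fibration over the projective line. -/
theorem exists_conicFibration (hcurve : IsSmoothCurve ℝ (projSpaceStr 1 ℝ)) {x y z : L}
    {G G' : Polynomial ℝ} {m : ℕ} (h : IsStandardPoint x y z G)
    (h' : IsStandardPoint (x / z ^ m) (y / z ^ m) z⁻¹ G') :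
    ∃ (S : Scheme.{0}) (s : S ⟶ Spec (.of ℝ)) (f : S ⟶ projSpace 1 ℝ) (q : Spec (.of L) ⟶ S)
      (c : Spec (.of (coordRing x y z)) ⟶ S), IsConicFibration ℝ s (projSpaceStr 1 ℝ) f ∧
      IsChart q (coordRing x y z) c ∧
      q ≫ s = Spec.map (CommRingCat.ofHom (algebraMap ℝ L)) ∧
      q ≫ f = projPoint ℝ 1 ![z, 1] isUnit_one := by
  have hP := hcurve.integral
  have hv := embVec_ne_zero h.x_ne_zero h.y_ne_zero h.z_ne_zero m
  have hT := funext (ratioRing_embVec h.x_ne_zero h.y_ne_zero h.z_ne_zero m)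
  obtain ⟨𝒞⟩ := exists_chartCover_image (K := ℝ) (embVec x y z m) hv 4 chartIndex
    (exists_embVec_div_mem h.x_ne_zero h.y_ne_zero h.z_ne_zero m)
  rw [hT] at 𝒞
  let q := projPoint ℝ 4 (embVec x y z m) (hv 4).isUnit
  have hsep : q.image.IsSeparated := ⟨by
    rw [← terminal.comp_from q.imageι]
    infer_instance⟩
  obtain ⟨f, hf, hfe⟩ := 𝒞.exists_hom_projLine h.z_ne_zero ![1, 0, 1, 0, 1, 0]
    (exists_ratioRing_le_chartCoord h.z_ne_zero m)
  have hs : q.toImage ≫ q.imageι ≫ projSpaceStr 7 ℝ =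
      Spec.map (CommRingCat.ofHom (algebraMap ℝ L)) := by
    rw [← Category.assoc, Scheme.Hom.toImage_imageι]
    exact projPoint_str _ _ _
  -- Projectivity holds by construction; chart number 4 is the affine surface itself.
  refine ⟨q.image, q.imageι ≫ projSpaceStr 7 ℝ, f, q.toImage, 𝒞.map 4, ⟨⟨isIntegral_image q, ?_,
    7, q.imageι, inferInstance, rfl⟩, hcurve, ?_, ?_⟩, 𝒞.isChart 4, hs, hf⟩
  · exact 𝒞.smoothOfRelativeDimension _ hs (fun i r ↦ by
      fin_cases i <;> exact algebraMap_mem_coordRing _ _ _ r) fun i ↦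
      chartCoord_locally h h' i _ rfl _
  · refine 𝒞.hom_ext ?_
    refine Eq.trans ?_ hs.symm
    rw [← Category.assoc, hf]
    exact projPoint_str _ _ _
  · have hη := isGenericPoint_of_transcendental h.transcendental_z
    exact ⟨_, hη, isPlaneConic_genericFiber h 𝒞 f hf _ hfe hη⟩

end standardModel

/-! ### Birational maps from subrings with a common fraction field -/

section birational

variable {L : Type} [Field L]

lemma exists_localization_hom {T : Subring L} (s : T) (hs0 : (s : L) ≠ 0) :
    ∃ θ : Localization.Away s →+* L, Function.Injective θ ∧ (∀ r, θ (algebraMap T _ r) = r) ∧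
      θ.range = T ⊔ Subring.closure {(s : L)⁻¹} := by
  obtain ⟨θ, hθ⟩ : ∃ θ : Localization.Away s →+* L, ∀ r, θ (algebraMap T _ r) = r :=
    ⟨IsLocalization.Away.lift s (g := T.subtype) (isUnit_iff_ne_zero.mpr hs0),
      fun r ↦ IsLocalization.Away.lift_eq s _ r⟩
  have hmk (a : Localization.Away s) : ∃ (r : T) (n : ℕ), θ a * (s : L) ^ n = r ∧
      a * algebraMap T _ s ^ n = algebraMap T _ r := by
    obtain ⟨n, r, h⟩ := IsLocalization.Away.surj s a
    refine ⟨r, n, ?_, h⟩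
    have := congrArg θ h
    rwa [map_mul, map_pow, hθ, hθ] at this
  have hu : IsUnit (algebraMap T (Localization.Away s) s) :=
    IsLocalization.Away.algebraMap_isUnit s
  refine ⟨θ, ?_, hθ, ?_⟩
  · refine (injective_iff_map_eq_zero θ).mpr fun a ha ↦ ?_
    obtain ⟨r, n, h1, h2⟩ := hmk a
    rw [ha, zero_mul] at h1
    obtain rfl : r = 0 := Subtype.ext h1.symm
    rw [map_zero] at h2
    exact (hu.pow n).mul_left_eq_zero.mp h2
  · have hT : T ≤ T ⊔ Subring.closure {(s : L)⁻¹} := le_sup_left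
    have hinv : (s : L)⁻¹ ∈ T ⊔ Subring.closure {(s : L)⁻¹} :=
      (le_sup_right : _ ≤ T ⊔ Subring.closure {(s : L)⁻¹}) (Subring.subset_closure rfl)
    apply le_antisymm
    · rintro _ ⟨a, rfl⟩
      obtain ⟨r, n, h1, -⟩ := hmk a
      have : θ a = r * (s : L)⁻¹ ^ n := by
        rw [← h1, mul_assoc, ← mul_pow, mul_inv_cancel₀ hs0, one_pow, mul_one]
      rw [this]
      exact mul_mem (hT r.2) (pow_mem hinv _)
    · refine sup_le (fun r hr ↦ ⟨_, hθ ⟨r, hr⟩⟩) ?_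
      rw [Subring.closure_le, Set.singleton_subset_iff]
      refine ⟨IsLocalization.Away.invSelf s, eq_inv_of_mul_eq_one_right ?_⟩
      have := congrArg θ (IsLocalization.Away.mul_invSelf (S := Localization.Away s) s)
      rwa [map_mul, map_one, hθ] at this

lemma IsChart.exists_localization {S : Scheme.{0}} {q : Spec (.of L) ⟶ S} {T : Subring L}
    {c : Spec (.of T) ⟶ S} (hc : IsChart q T c) {s : L} (hs : s ∈ T) (hs0 : s ≠ 0) :
    ∃ c' : Spec (.of (T ⊔ Subring.closure {s⁻¹} : Subring L)) ⟶ S, IsChart q _ c' := by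
  obtain ⟨θ, hinj, hθ, hrange⟩ := exists_localization_hom ⟨s, hs⟩ hs0
  have := hc.isOpenImmersion
  obtain ⟨c', hc', -⟩ := exists_isChart_of_injective (q := q) θ hinj
    (Spec.map (CommRingCat.ofHom (algebraMap T (Localization.Away (⟨s, hs⟩ : T)))) ≫ c) (by
      rw [← Category.assoc, ← Spec.map_comp, ← CommRingCat.ofHom_comp, ← hc.fac]
      congr 3
      ext r
      exact hθ r)
  exact hrange ▸ ⟨c', hc'⟩

/-- The fraction field of the subring `T` is the whole field `L`. -/
def HasFractions (T : Subring L) : Prop :=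
  ∀ s : L, ∃ r ∈ T, ∃ t ∈ T, t ≠ 0 ∧ s * t = r

/-- The element `t` is a common denominator for the finitely many generators of `T'`. -/
lemma HasFractions.exists_le_sup [Algebra ℝ L] {T T' : Subring L} (h : HasFractions T)
    (hr : ∀ r, algebraMap ℝ L r ∈ T) (E : Finset L)
    (hE : T' = (Algebra.adjoin ℝ (E : Set L)).toSubring) :
    ∃ t ∈ T, t ≠ 0 ∧ T' ≤ T ⊔ Subring.closure {t⁻¹} := by
  classical
  choose r hrT t htT ht0 hst using h
  refine ⟨∏ e ∈ E, t e, prod_mem fun e _ ↦ htT e, Finset.prod_ne_zero_iff.mpr fun e _ ↦ ht0 e, ?_⟩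
  set S := T ⊔ Subring.closure {(∏ e ∈ E, t e)⁻¹}
  have hTS : T ≤ S := le_sup_left
  have hinv : (∏ e ∈ E, t e)⁻¹ ∈ S := le_sup_right (a := T) (Subring.subset_closure rfl)
  let S' : Subalgebra ℝ L := { S with algebraMap_mem' := fun x ↦ hTS (hr x) }
  have : Algebra.adjoin ℝ (E : Set L) ≤ S' := by
    refine Algebra.adjoin_le fun e he ↦ ?_
    have he' : e = r e * (∏ e ∈ E.erase e, t e) * (∏ e ∈ E, t e)⁻¹ := by
      rw [← Finset.mul_prod_erase E t he, ← hst e]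
      have h1 := ht0 e
      have h2 : ∏ e ∈ E.erase e, t e ≠ 0 := Finset.prod_ne_zero_iff.mpr fun e _ ↦ ht0 e
      field_simp
    change e ∈ S
    rw [he']
    exact mul_mem (mul_mem (hTS (hrT e)) (hTS (prod_mem fun e _ ↦ htT e))) hinv
  rw [hE]
  exact this

/-- Both schemes contain `Spec T` as a dense open subscheme. Compatibility with maps to a separated
scheme can be tested on `Spec L`, so one partial isomorphism serves both the structure morphisms and
the fibrations. -/
lemma exists_partialIso_of_isChart {S S' : Scheme.{0}} [IsIntegral S] [IsIntegral S']
    {q : Spec (.of L) ⟶ S} {q' : Spec (.of L) ⟶ S'} {T : Subring L} {c : Spec (.of T) ⟶ S}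
    {c' : Spec (.of T) ⟶ S'} (hc : IsChart q T c) (hc' : IsChart q' T c') :
    ∃ φ : S.PartialIso S', ∀ (B : Scheme.{0}) [B.IsSeparated] (f : S ⟶ B) (f' : S' ⟶ B),
      q ≫ f = q' ≫ f' → φ.IsOver f f' := by
  have := hc.isOpenImmersion
  have := hc'.isOpenImmersion
  refine ⟨⟨c.opensRange, c.opensRange.2.dense ⟨_, specGen T default, rfl⟩, c'.opensRange,
    c'.opensRange.2.dense ⟨_, specGen T default, rfl⟩, c.isoOpensRange.symm ≪≫ c'.isoOpensRange⟩, ?_⟩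
  intro B _ f f' h
  have key : c ≫ f = c' ≫ f' := by
    refine ext_of_isDominant (specGen T) ?_
    rw [← Category.assoc, hc.fac, h, ← Category.assoc, hc'.fac]
  rw [Scheme.PartialIso.IsOver, ← cancel_epi c.isoOpensRange.hom]
  simp [key]

/-- `T[1/t]` contains `T'` and `T'[1/t']` contains `T`, so inverting both `t` and `t'` produces the
same subring from either side. -/
theorem exists_partialIso_of_hasFractions [Algebra ℝ L] {S S' : Scheme.{0}} [IsIntegral S]
    [IsIntegral S'] {q : Spec (.of L) ⟶ S} {q' : Spec (.of L) ⟶ S'} {T T' : Subring L}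
    {c : Spec (.of T) ⟶ S} {c' : Spec (.of T') ⟶ S'} (hc : IsChart q T c) (hc' : IsChart q' T' c')
    (hT : HasFractions T) (hT' : HasFractions T') (E E' : Finset L)
    (hE : T = (Algebra.adjoin ℝ (E : Set L)).toSubring)
    (hE' : T' = (Algebra.adjoin ℝ (E' : Set L)).toSubring) :
    ∃ φ : S.PartialIso S', ∀ (B : Scheme.{0}) [B.IsSeparated] (f : S ⟶ B) (f' : S' ⟶ B),
      q ≫ f = q' ≫ f' → φ.IsOver f f' := by
  obtain ⟨t, ht, ht0, hle⟩ := hT.exists_le_sup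
    (fun r ↦ hE ▸ Subalgebra.algebraMap_mem (Algebra.adjoin ℝ (E : Set L)) r) E' hE'
  obtain ⟨t', ht', ht0', hle'⟩ := hT'.exists_le_sup
    (fun r ↦ hE' ▸ Subalgebra.algebraMap_mem (Algebra.adjoin ℝ (E' : Set L)) r) E hE
  obtain ⟨c₁, hc₁⟩ := hc.exists_localization ht ht0
  obtain ⟨c₂, hc₂⟩ := hc₁.exists_localization (hle ht') ht0'
  obtain ⟨c₁', hc₁'⟩ := hc'.exists_localization ht' ht0'
  obtain ⟨c₂', hc₂'⟩ := hc₁'.exists_localization (hle' ht) ht0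
  have : T' ⊔ Subring.closure {t'⁻¹} ⊔ Subring.closure {t⁻¹} =
      T ⊔ Subring.closure {t⁻¹} ⊔ Subring.closure {t'⁻¹} := by
    apply le_antisymm
    · exact sup_le (sup_le (hle.trans le_sup_left) le_sup_right) (le_sup_right.trans le_sup_left)
    · exact sup_le (sup_le (hle'.trans le_sup_left) le_sup_right) (le_sup_right.trans le_sup_left)
  revert c₂' hc₂'
  rw [this]
  exact fun c₂' hc₂' ↦ exists_partialIso_of_isChart hc₂ hc₂'

open IntermediateField in
lemma hasFractions_adjoin [Algebra ℝ L] (E : Set L) (hE : IntermediateField.adjoin ℝ E = ⊤) :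
    HasFractions (Algebra.adjoin ℝ E).toSubring := by
  intro s
  have hs : s ∈ IntermediateField.adjoin ℝ E := hE ▸ mem_top
  obtain ⟨r, hr, t, ht, h⟩ := mem_adjoin_iff_div.mp hs
  by_cases ht0 : t = 0
  · exact ⟨0, zero_mem _, 1, one_mem _, one_ne_zero, by rw [mul_one, h, ht0, div_zero]⟩
  · exact ⟨r, hr, t, ht, ht0, by rw [h, div_mul_cancel₀ _ ht0]⟩

end birational

/-! ### Linear changes of coordinates on projective space -/

section linearChange

open HomogeneousIdeal

variable {K R : Type u} [Field K] [CommRing R] [Algebra K R] {n : ℕ}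

/-- The graded endomorphism of `K[x₀, …, xₙ]` given by a linear substitution. -/
def gradedSubst (l : Fin (n + 1) → MvPolynomial (Fin (n + 1)) K)
    (hl : ∀ i, (l i).IsHomogeneous 1) : (grading n K) →+*ᵍ (grading n K) where
  __ := (aeval l : MvPolynomial (Fin (n + 1)) K →ₐ[K] _).toRingHom
  map_mem {d} {P} hP := by
    have hP' : P.IsHomogeneous d := (mem_homogeneousSubmodule _ _).mp hP
    have := hP'.aeval l hl
    rw [one_mul] at this
    exact (mem_homogeneousSubmodule _ _).mpr this

/-- By `hll'` the substitution `l` has a right inverse, so the irrelevant ideal is generated by its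
image and the induced morphism is defined everywhere. By `hij` the preimage of D₊(x_i) is D₊(x_j),
where the image of the point is computed. -/
theorem exists_linearChange (l l' : Fin (n + 1) → MvPolynomial (Fin (n + 1)) K)
    (hl : ∀ i, (l i).IsHomogeneous 1) (hl' : ∀ i, (l' i).IsHomogeneous 1)
    (hll' : ∀ i, aeval l (l' i) = X i) (v : Fin (n + 1) → R) (w : Fin (n + 1) → R)
    (hw : ∀ i, w i = aeval v (l i)) (i j : Fin (n + 1))
    (hij : l i = X j) (hj : IsUnit (v j)) (hi : IsUnit (w i)) :
    ∃ ψ : projSpace n K ⟶ projSpace n K, projPoint K j v hj ≫ ψ = projPoint K i w hi := by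
  let f := gradedSubst l hl
  have hf (P) : f P = aeval l P := rfl
  have hirr : irrelevant (grading n K) ≤ (irrelevant (grading n K)).map f := by
    rw [← toIdeal_le_toIdeal_iff, toIdeal_irrelevant_le]
    intro d hd x hx
    have hx' : x = f (gradedSubst l' hl' x) := by
      rw [hf]
      change x = aeval l (aeval l' x)
      rw [← AlgHom.comp_apply, comp_aeval, funext hll', aeval_X_left_apply]
    rw [hx']
    refine Ideal.mem_map_of_mem _ ?_
    exact (mem_irrelevant_of_mem _ hd ((gradedSubst l' hl').map_mem hx))
  refine ⟨Proj.map f hirr, ?_⟩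
  have hfX : f (X i) = X j := by rw [hf, aeval_X, hij]
  have h1 := Proj.awayι_comp_map f hirr one_pos (X i) (X_mem_grading n K i)
  have key : ∀ t (ht : t ∈ grading n K 1), t = X j →
      ∃ θ : HomogeneousLocalization.Away (grading n K) t →+* R,
        Spec.map (CommRingCat.ofHom θ) ≫ Proj.awayι (grading n K) t ht one_pos =
          projPoint K j v hj ∧
        ∀ d P hP, θ (.mk (grading n K) ht d P hP) * v j ^ d = aeval v P := by
    rintro _ ht rfl
    exact ⟨chartHom K j v hj, rfl, fun d P hP ↦ chartHom_mk j v hj d P hP⟩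
  obtain ⟨θ, hθ, hθ'⟩ := key (f (X i)) (f.map_mem (X_mem_grading n K i)) hfX
  rw [← hθ, Category.assoc, h1, ← Category.assoc, ← Spec.map_comp, ← CommRingCat.ofHom_comp,
    projPoint]
  congr 3
  refine chartHom_ext i _ _ fun d P hP ↦ ?_
  refine (hi.pow d).mul_right_cancel ?_
  rw [chartHom_mk, RingHom.comp_apply, HomogeneousLocalization.Away.map_mk, hw i, hij, aeval_X,
    hθ', hf, funext hw]
  change ((aeval v).comp (aeval l)) P = _
  rw [comp_aeval]

/-- The automorphism `z ↦ 1 / (z - c)` of the projective line. -/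
theorem exists_iso_projLine {L : Type} [Field L] [Algebra ℝ L] [IsIntegral (projSpace 1 ℝ)]
    {z t : L} (hz : Transcendental ℝ z) (ht : Transcendental ℝ t) (c : ℝ)
    (h : t * (z - algebraMap ℝ L c) = 1) :
    ∃ τ : projSpace 1 ℝ ≅ projSpace 1 ℝ, τ.hom ≫ projSpaceStr 1 ℝ = projSpaceStr 1 ℝ ∧
      projPoint ℝ 1 ![z, 1] isUnit_one ≫ τ.hom = projPoint ℝ 1 ![t, 1] isUnit_one := by
  have hX (i : Fin 2) : (X i : MvPolynomial (Fin 2) ℝ).IsHomogeneous 1 := isHomogeneous_X ℝ i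
  have hCX (i : Fin 2) : (C c * X i : MvPolynomial (Fin 2) ℝ).IsHomogeneous 1 := by
    simpa using (isHomogeneous_C (Fin 2) c).mul (hX i)
  have ht0 : t ≠ 0 := left_ne_zero_of_mul_eq_one h
  have hz0 : z - algebraMap ℝ L c ≠ 0 := right_ne_zero_of_mul_eq_one h
  -- In homogeneous coordinates `(z : 1)` goes to `(1 : z - c)`, which is `(t : 1)`; the inverse
  -- sends `(t : 1)` to `(1 + c t : t)`.
  let l : Fin 2 → MvPolynomial (Fin 2) ℝ := ![X 1, X 0 - C c * X 1]
  let l' : Fin 2 → MvPolynomial (Fin 2) ℝ := ![X 1 + C c * X 0, X 0]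
  have hl (i) : (l i).IsHomogeneous 1 := by
    fin_cases i
    exacts [hX 1, (hX 0).sub (hCX 1)]
  have hl' (i) : (l' i).IsHomogeneous 1 := by
    fin_cases i
    exacts [(hX 1).add (hCX 0), hX 0]
  obtain ⟨ψ, hψ⟩ := exists_linearChange (R := L) l l' hl hl'
    (by intro i; fin_cases i <;> simp [l, l']) ![z, 1] ![1, z - algebraMap ℝ L c]
    (by intro i; fin_cases i <;> simp [l]) 0 1 rfl isUnit_one isUnit_one
  obtain ⟨ψ', hψ'⟩ := exists_linearChange (R := L) l' l hl' hl
    (by intro i; fin_cases i <;> simp [l, l']) ![t, 1] ![1 + algebraMap ℝ L c * t, t]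
    (by intro i; fin_cases i <;> simp [l']) 1 0 rfl ht0.isUnit ht0.isUnit
  have h1 : projPoint ℝ 1 ![z, 1] isUnit_one ≫ ψ = projPoint ℝ 1 ![t, 1] isUnit_one := by
    refine hψ.trans ((projPoint_smul (K := ℝ) 0 ![t, 1] ![1, z - algebraMap ℝ L c]
      (z - algebraMap ℝ L c) ?_ ht0.isUnit isUnit_one).trans (projPoint_congr_index _ _))
    intro i
    fin_cases i <;> simp [mul_comm _ t, h]
  have h2 : projPoint ℝ 1 ![t, 1] isUnit_one ≫ ψ' = projPoint ℝ 1 ![z, 1] isUnit_one := by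
    have h3 : projPoint ℝ 1 ![t, 1] isUnit_one = projPoint ℝ 0 ![t, 1] ht0.isUnit :=
      projPoint_congr_index _ _
    refine (congrArg (· ≫ ψ') h3).trans (hψ'.trans (projPoint_smul (K := ℝ) 1 ![z, 1]
      ![1 + algebraMap ℝ L c * t, t] t ?_ isUnit_one ht0.isUnit))
    intro i
    fin_cases i
    · simp; linear_combination -h
    · simp
  have hdom {s : L} (hs : Transcendental ℝ s) :
      IsDominant (projPoint ℝ 1 ![s, 1] isUnit_one : _ ⟶ projSpace 1 ℝ) := by
    refine ⟨?_⟩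
    intro p
    have := (isGenericPoint_of_transcendental hs).ge (Set.mem_univ p)
    exact closure_mono (Set.singleton_subset_iff.mpr (Set.mem_range_self _)) this
  have := hdom hz
  have := hdom ht
  refine ⟨⟨ψ, ψ', ?_, ?_⟩, ?_, h1⟩
  · refine ext_of_isDominant (projPoint ℝ 1 ![z, 1] isUnit_one) ?_
    rw [reassoc_of% h1, h2, Category.comp_id]
  · refine ext_of_isDominant (projPoint ℝ 1 ![t, 1] isUnit_one) ?_
    rw [reassoc_of% h2, h1, Category.comp_id]
  · refine ext_of_isDominant (projPoint ℝ 1 ![z, 1] isUnit_one) ?_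
    rw [reassoc_of% h1]
    exact (projPoint_str (K := ℝ) 1 ![t, 1] isUnit_one).trans (projPoint_str _ _ _).symm

end linearChange

/-! ### Comparison with the standard model -/

section comparison

variable {L : Type} [Field L] [Algebra ℝ L]

lemma separable_C_mul {ε : ℝ} (hε : ε ≠ 0) {p : Polynomial ℝ} (hp : p.Separable) :
    (Polynomial.C ε * p).Separable := by
  have : IsUnit (Polynomial.C ε) := Polynomial.isUnit_C.mpr hε.isUnit
  rw [Polynomial.separable_def, Polynomial.derivative_C_mul]
  exact (isCoprime_mul_unit_left this _ _).mpr hp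

/-- This is the polynomial `G` seen from `z = ∞`, without its sign. Two factors are coprime because
`a j - a i` is invertible; this includes the case of a zero `a i`, whose factor is `1`. -/
lemma separable_prod_one_sub {ι : Type} [Fintype ι] {a : ι → ℝ} (ha : Function.Injective a) :
    (∏ i, (1 - Polynomial.C (a i) * Polynomial.X) : Polynomial ℝ).Separable := by
  refine Polynomial.separable_prod (fun i j hij ↦ ?_) fun i ↦ ?_
  · have h : a j - a i ≠ 0 := sub_ne_zero.mpr fun h ↦ hij (ha h).symm
    refine ⟨Polynomial.C (a j / (a j - a i)), -Polynomial.C (a i / (a j - a i)), ?_⟩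
    have h1 : (Polynomial.C (a j / (a j - a i)) - Polynomial.C (a i / (a j - a i))) = 1 := by
      rw [← Polynomial.C_sub, ← sub_div, div_self h, Polynomial.C_1]
    have h2 : Polynomial.C (a j / (a j - a i)) * Polynomial.C (a i) =
        Polynomial.C (a i / (a j - a i)) * Polynomial.C (a j) := by
      rw [← Polynomial.C_mul, ← Polynomial.C_mul]
      congr 1
      ring
    linear_combination h1 - Polynomial.X * h2
  · refine ⟨1, -Polynomial.X, ?_⟩
    simp

/-- A generic point of a standard affine surface of even degree gives a conic fibration. -/
theorem exists_standardModel (hcurve : IsSmoothCurve ℝ (projSpaceStr 1 ℝ)) {x y z : L} {m : ℕ}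
    {a : Fin (2 * m) → ℝ} (ha : Function.Injective a) {ε : ℝ} (hε : ε ≠ 0)
    (h : IsStandardPoint x y z (Polynomial.C ε * ∏ i, (Polynomial.X - Polynomial.C (a i)))) :
    ∃ (S : Scheme.{0}) (s : S ⟶ Spec (.of ℝ)) (f : S ⟶ projSpace 1 ℝ) (q : Spec (.of L) ⟶ S)
      (c : Spec (.of (coordRing x y z)) ⟶ S), IsConicFibration ℝ s (projSpaceStr 1 ℝ) f ∧
      HasStandardAffineEquation s f ε a ∧ IsChart q (coordRing x y z) c ∧
      q ≫ s = Spec.map (CommRingCat.ofHom (algebraMap ℝ L)) ∧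
      q ≫ f = projPoint ℝ 1 ![z, 1] isUnit_one := by
  have h' := h.inv (m := m) (separable_C_mul hε (separable_prod_one_sub ha)) (by
    have hz := h.z_ne_zero
    have hpow : z ^ (2 * m) = ∏ _i : Fin (2 * m), z := by simp
    simp only [map_mul, map_prod, Polynomial.aeval_C, map_sub, Polynomial.aeval_X, map_one]
    rw [hpow, mul_div_assoc, ← Finset.prod_div_distrib]
    congr 1
    refine Finset.prod_congr rfl fun i _ ↦ ?_
    field_simp)
  obtain ⟨S, s, f, q, c, hS, hc, hs, hf⟩ := exists_conicFibration hcurve h h'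
  exact ⟨S, s, f, q, c, hS, hasStandardAffineEquation_of_isChart h hc hs hf, hc, hs, hf⟩

/-- Both `F` and the model have a finitely generated chart with fraction field `L`. The automorphism
`τ` accounts for the change of coordinate on the base. -/
theorem exists_birational_standardModel {F : Scheme.{0}} {sF : F ⟶ Spec (.of ℝ)}
    {f : F ⟶ projSpace 1 ℝ} (hf : IsConicFibration ℝ sF (projSpaceStr 1 ℝ) f)
    {q : Spec (.of L) ⟶ F} {T : Subring L} {c : Spec (.of T) ⟶ F} (hc : IsChart q T c)
    (hT : HasFractions T) (E : Finset L) (hE : T = (Algebra.adjoin ℝ (E : Set L)).toSubring)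
    (hs : q ≫ sF = Spec.map (CommRingCat.ofHom (algebraMap ℝ L)))
    (τ : projSpace 1 ℝ ≅ projSpace 1 ℝ) (hτ : τ.hom ≫ projSpaceStr 1 ℝ = projSpaceStr 1 ℝ)
    {x y z : L} (hq : q ≫ f ≫ τ.hom = projPoint ℝ 1 ![z, 1] isUnit_one) {m : ℕ}
    {a : Fin (2 * m) → ℝ} (ha : Function.Injective a) {ε : ℝ} (hε : ε = 1 ∨ ε = -1)
    (h : IsStandardPoint x y z (Polynomial.C ε * ∏ i, (Polynomial.X - Polynomial.C (a i))))
    (hL : IntermediateField.adjoin ℝ {x, y, z} = (⊤ : IntermediateField ℝ L)) :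
    ∃ (m : ℕ) (a : Fin (2 * m) → ℝ) (ε : ℝ),
      Function.Injective a ∧ (ε = 1 ∨ ε = -1) ∧
      ∃ (F' : Scheme.{0}) (sF' : F' ⟶ Spec (.of ℝ)) (f' : F' ⟶ projSpace 1 ℝ),
        IsConicFibration ℝ sF' (projSpaceStr 1 ℝ) f' ∧
        HasStandardAffineEquation sF' f' ε a ∧
        BirationalConicFibrations ℝ sF (projSpaceStr 1 ℝ) f sF' (projSpaceStr 1 ℝ) f' := by
  obtain ⟨S, s, f', q', c', hS, haff, hc', hs', hf'⟩ := exists_standardModel hf.curve ha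
    (by rcases hε with rfl | rfl <;> norm_num) h
  have := hf.surface.integral
  have := hS.surface.integral
  classical
  have hset : (({x, y, z} : Finset L) : Set L) = Set.range ![x, y, z] := by
    ext t
    simp [eq_comm]
    tauto
  obtain ⟨φ, hφ⟩ := exists_partialIso_of_hasFractions hc hc' hT (by
    rw [coordRing, ← hset]
    refine hasFractions_adjoin _ ?_
    rw [← hL]
    congr 1
    simp) E {x, y, z} hE (by rw [coordRing, hset])
  exact ⟨m, a, ε, ha, hε, S, s, f', hS, haff, φ, τ, hφ _ _ _ (hs.trans hs'.symm), hτ,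
    hφ _ _ _ (hq.trans hf'.symm)⟩

end comparison

/-! ### Tsen's theorem for ternary quadratic forms -/

section tsen

/-- Killing the first `m` variables, for `m = 0, …, n`, gives a strict chain of primes that ends at
the ideal of the origin. -/
lemma le_height_ker_eval {k : Type*} [Field k] {n : ℕ} :
    (n : ℕ∞) ≤ (RingHom.ker (eval (0 : Fin n → k))).height := by
  let s (m : ℕ) : MvPolynomial (Fin n) k →ₐ[k] MvPolynomial (Fin n) k :=
    aeval fun i ↦ if (i : ℕ) < m then 0 else X i
  have hs (m : ℕ) (hm : m ≤ n) : (m : ℕ∞) ≤ (RingHom.ker (s m)).height := by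
    induction m with
    | zero => simp
    | succ m ih =>
      have hprime (j : ℕ) : (RingHom.ker (s j)).IsPrime := RingHom.ker_isPrime _
      have hlt : RingHom.ker (s m) < RingHom.ker (s (m + 1)) := by
        refine lt_of_le_of_ne (fun p hp ↦ ?_) fun h ↦ ?_
        · have hcomp : (s (m + 1)).comp (s m) = s (m + 1) := by
            ext i : 1
            by_cases hi : (i : ℕ) < m
            · simp [s, hi]
              omega
            · simp [s, hi]
          rw [RingHom.mem_ker] at hp ⊢
          rw [← hcomp, AlgHom.comp_apply, hp, map_zero]
        · have hX : X ⟨m, hm⟩ ∈ RingHom.ker (s (m + 1)) := by simp [s]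
          rw [← h, RingHom.mem_ker] at hX
          simp [s] at hX
      refine le_trans ?_ (Order.add_one_le_of_lt (Ideal.height_strict_mono_of_isPrime_of_isPrime hlt))
      push_cast
      exact add_le_add_left (ih (by omega)) 1
  convert hs n le_rfl using 2
  ext p
  have : (s n) = (Algebra.ofId k _).comp (aeval (0 : Fin n → k)) := by
    ext i : 1
    simp [s]
  rw [RingHom.mem_ker, RingHom.mem_ker, this, AlgHom.comp_apply]
  simp [Algebra.ofId_apply]

/-- Fewer equations than unknowns without constant terms have a nontrivial common zero over an
algebraically closed field. -/
theorem exists_ne_zero_forall_eval_eq_zero {k : Type*} [Field k] [IsAlgClosed k] {n r : ℕ}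
    (f : Fin r → MvPolynomial (Fin n) k) (hf : ∀ i, eval 0 (f i) = 0) (hr : r < n) :
    ∃ x ≠ 0, ∀ i, eval x (f i) = 0 := by
  classical
  by_contra! hcon
  let I := Ideal.span (Set.range f)
  have hI : I ≤ RingHom.ker (eval (0 : Fin n → k)) :=
    Ideal.span_le.mpr (Set.range_subset_iff.mpr hf)
  have hzero : zeroLocus k I = {0} := by
    ext x
    rw [Set.mem_singleton_iff, zeroLocus_span]
    simp only [Set.forall_mem_range, Set.mem_ofPred_eq, aeval_eq_eval]
    refine ⟨fun h ↦ ?_, fun h ↦ h ▸ hf⟩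
    by_contra hx
    obtain ⟨i, hi⟩ := hcon x hx
    exact hi (h i)
  -- If the origin is the only zero, its ideal is the radical of `I` by the Nullstellensatz. It is
  -- then minimal over `I`, and Krull's theorem bounds its height by the number of equations,
  -- contrary to height at least `n`.
  have hrad := vanishingIdeal_zeroLocus_eq_radical (K := k) I
  rw [hzero] at hrad
  have hker : RingHom.ker (eval (0 : Fin n → k)) = I.radical := by
    rw [← hrad]
    ext p
    rw [mem_vanishingIdeal_singleton_iff, RingHom.mem_ker, aeval_eq_eval]
  have hmin : RingHom.ker (eval (0 : Fin n → k)) ∈ I.minimalPrimes := by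
    refine ⟨⟨RingHom.ker_isPrime _, hI⟩, fun p hp _ ↦ ?_⟩
    rw [hker]
    exact hp.1.radical_le_iff.mpr hp.2
  have hle : (RingHom.ker (eval (0 : Fin n → k))).height ≤ (Finset.univ.image f).card :=
    Ideal.height_le_card_of_mem_minimalPrimes_span_finset (by simpa using hmin)
  have h1 := le_height_ker_eval.trans hle
  have h2 : (Finset.univ.image f).card ≤ r := Finset.card_image_le.trans (by simp)
  exact absurd (Nat.cast_le.mp h1) (by omega)

/-- Ternary quadratic forms over `k[t]` are isotropic when `k` is algebraically closed. -/
theorem exists_isotropic {k : Type*} [Field k] [IsAlgClosed k] (P : Fin 3 → Fin 3 → Polynomial k) :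
    ∃ y : Fin 3 → Polynomial k, y ≠ 0 ∧ ∑ i, ∑ j, P i j * y i * y j = 0 := by
  obtain ⟨d, hd⟩ : ∃ d, ∀ i j, (P i j).natDegree ≤ d :=
    ⟨∑ i, ∑ j, (P i j).natDegree, fun i j ↦
      (Finset.single_le_sum (f := fun j ↦ (P i j).natDegree) (fun _ _ ↦ Nat.zero_le _)
        (Finset.mem_univ j)).trans
      (Finset.single_le_sum (f := fun i ↦ ∑ j, (P i j).natDegree) (fun _ _ ↦ Nat.zero_le _)
        (Finset.mem_univ i))⟩
  -- The entries have degree at most `d`, and solutions of degree at most `d` are sought. They have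
  -- `3(d + 1)` coefficients, while the value of the form has degree at most `3d` and imposes only
  -- `3d + 1` equations.
  let Y (R : Type _) [CommRing R] (x : Fin (3 * (d + 1)) → R) (i : Fin 3) : Polynomial R :=
    ∑ j : Fin (d + 1), Polynomial.C (x (finProdFinEquiv (i, j))) * Polynomial.X ^ (j : ℕ)
  let B : Polynomial (MvPolynomial (Fin (3 * (d + 1))) k) :=
    ∑ i, ∑ j, (P i j).map C * Y _ X i * Y _ X j
  have hB (x : Fin (3 * (d + 1)) → k) :
      B.map (eval x) = ∑ i, ∑ j, P i j * Y k x i * Y k x j := by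
    have hY (i) : (Y _ X i).map (eval x) = Y k x i := by
      simp [Y, Polynomial.map_sum]
    have hP (i j) : ((P i j).map C).map (eval x) = P i j := by
      rw [Polynomial.map_map]
      convert Polynomial.map_id
      ext
      simp
    simp only [B, Polynomial.map_sum, Polynomial.map_mul, hY, hP]
  obtain ⟨x, hx0, hx⟩ := exists_ne_zero_forall_eval_eq_zero (k := k) (n := 3 * (d + 1))
    (r := 3 * d + 1) (fun i ↦ B.coeff i) (fun i ↦ by
      rw [← Polynomial.coeff_map, hB]
      simp [Y]) (by omega)
  refine ⟨Y k x, fun h ↦ hx0 ?_, ?_⟩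
  · ext t
    obtain ⟨⟨i, j⟩, rfl⟩ := finProdFinEquiv.surjective t
    have := congrArg (Polynomial.coeff · j) (congrFun h i)
    simpa [Y, Polynomial.finsetSum_coeff, Polynomial.coeff_X_pow, Fin.val_inj] using this
  · rw [← hB]
    have hdeg : (B.map (eval x)).natDegree ≤ 3 * d := by
      rw [hB]
      have hY (i) : (Y k x i).natDegree ≤ d := by
        refine Polynomial.natDegree_sum_le_of_forall_le _ _ fun j _ ↦ ?_
        refine (Polynomial.natDegree_C_mul_X_pow_le _ _).trans (by omega)
      refine Polynomial.natDegree_sum_le_of_forall_le _ _ fun i _ ↦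
        Polynomial.natDegree_sum_le_of_forall_le _ _ fun j _ ↦ ?_
      refine Polynomial.natDegree_mul_le.trans ?_
      have := Polynomial.natDegree_mul_le (p := P i j) (q := Y k x i)
      have := hd i j
      have := hY i
      have := hY j
      omega
    ext t
    by_cases ht : t < 3 * d + 1
    · rw [Polynomial.coeff_map]
      exact hx ⟨t, ht⟩
    · rw [Polynomial.coeff_eq_zero_of_natDegree_lt (by omega), Polynomial.coeff_zero]

end tsen

/-! ### Diagonalising ternary forms over ℝ(z) -/

section ternaryForms

open Matrix

variable {K : Type*} [Field K]

lemma gram_apply (M : Matrix (Fin 3) (Fin 3) K) (b : Fin 3 → Fin 3 → K) (i j : Fin 3) :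
    ((of b) * M * (of b)ᵀ) i j = b i ⬝ᵥ M *ᵥ b j := by
  rw [mul_assoc, Matrix.mul_apply]
  rfl

lemma dotProduct_mulVec_comm {M : Matrix (Fin 3) (Fin 3) K} (hM : Mᵀ = M) (v w : Fin 3 → K) :
    v ⬝ᵥ M *ᵥ w = w ⬝ᵥ M *ᵥ v := by
  rw [dotProduct_comm, ← hM, mulVec_transpose, ← dotProduct_mulVec, hM]

/-- A nondegenerate plane has an orthogonal complement in a ternary quadratic space. -/
lemma exists_orthogonal {M : Matrix (Fin 3) (Fin 3) K} (hM : Mᵀ = M) (b₀ b₁ : Fin 3 → K)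
    (h : (b₀ ⬝ᵥ M *ᵥ b₀) * (b₁ ⬝ᵥ M *ᵥ b₁) - (b₀ ⬝ᵥ M *ᵥ b₁) ^ 2 ≠ 0) :
    ∃ b₂, b₀ ⬝ᵥ M *ᵥ b₂ = 0 ∧ b₁ ⬝ᵥ M *ᵥ b₂ = 0 ∧ (of ![b₀, b₁, b₂]).det ≠ 0 := by
  -- The vector `b₂` solves two linear equations in three unknowns; the zero row makes the system
  -- square and singular.
  have hdet : (of ![M *ᵥ b₀, M *ᵥ b₁, 0]).det = 0 := by
    refine det_eq_zero_of_row_eq_zero 2 fun j ↦ rfl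
  obtain ⟨b₂, hb₂, h0⟩ := exists_mulVec_eq_zero_iff.mpr hdet
  have h1 : b₀ ⬝ᵥ M *ᵥ b₂ = 0 := by
    rw [dotProduct_mulVec_comm hM, dotProduct_comm]
    exact congrFun h0 0
  have h2 : b₁ ⬝ᵥ M *ᵥ b₂ = 0 := by
    rw [dotProduct_mulVec_comm hM, dotProduct_comm]
    exact congrFun h0 1
  refine ⟨b₂, h1, h2, fun hd ↦ ?_⟩
  obtain ⟨a, ha, ha0⟩ := exists_vecMul_eq_zero_iff.mpr hd
  have hsum : a 0 • b₀ + a 1 • b₁ + a 2 • b₂ = 0 := by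
    rw [← ha0]
    ext j
    simp [vecMul, dotProduct, Fin.sum_univ_three]
  have e (v : Fin 3 → K) : a 0 * (v ⬝ᵥ M *ᵥ b₀) + a 1 * (v ⬝ᵥ M *ᵥ b₁) +
      a 2 * (v ⬝ᵥ M *ᵥ b₂) = 0 := by
    have := congrArg (fun w ↦ v ⬝ᵥ M *ᵥ w) hsum
    simpa [mulVec_add, mulVec_smul, dotProduct_add, dotProduct_smul] using this
  have e0 := e b₀
  have e1 := e b₁
  rw [h1, mul_zero, add_zero] at e0
  rw [h2, mul_zero, add_zero, dotProduct_mulVec_comm hM] at e1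
  have ha0' : a 0 = 0 := by
    refine (mul_eq_zero.mp ?_).resolve_right h
    linear_combination (b₁ ⬝ᵥ M *ᵥ b₁) * e0 - (b₀ ⬝ᵥ M *ᵥ b₁) * e1
  have ha1' : a 1 = 0 := by
    refine (mul_eq_zero.mp ?_).resolve_right h
    linear_combination (b₀ ⬝ᵥ M *ᵥ b₀) * e1 - (b₀ ⬝ᵥ M *ᵥ b₁) * e0
  rw [ha0', ha1', zero_smul, zero_smul, zero_add, zero_add, smul_eq_zero] at hsum
  refine ha (funext fun i ↦ ?_)
  fin_cases i
  exacts [ha0', ha1', hsum.resolve_right hb₂]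

/-- A nondegenerate ternary form that takes equal values on two orthogonal vectors, not both zero,
is similar to `⟨1, 1, -g⟩`. -/
theorem exists_diagonal [CharZero K] {M : Matrix (Fin 3) (Fin 3) K} (hM : Mᵀ = M) (hdet : M.det ≠ 0)
    {u w : Fin 3 → K} (huw : u ≠ 0 ∨ w ≠ 0) (h1 : u ⬝ᵥ M *ᵥ u = w ⬝ᵥ M *ᵥ w)
    (h2 : u ⬝ᵥ M *ᵥ w = 0) :
    ∃ (T : Matrix (Fin 3) (Fin 3) K) (c g : K), T.det ≠ 0 ∧ c ≠ 0 ∧ g ≠ 0 ∧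
      T * M * Tᵀ = diagonal ![c, c, -c * g] := by
  -- If the common value is nonzero, `u` and `w` span a nondegenerate plane, and the third basis
  -- vector comes from its orthogonal complement.
  have key (u w : Fin 3 → K) (h1 : u ⬝ᵥ M *ᵥ u = w ⬝ᵥ M *ᵥ w) (h2 : u ⬝ᵥ M *ᵥ w = 0)
      (h : u ⬝ᵥ M *ᵥ u ≠ 0) :
      ∃ (T : Matrix (Fin 3) (Fin 3) K) (c g : K), T.det ≠ 0 ∧ c ≠ 0 ∧ g ≠ 0 ∧
        T * M * Tᵀ = diagonal ![c, c, -c * g] := by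
    obtain ⟨b, hb0, hb1, hT⟩ := exists_orthogonal hM u w (by
      rw [← h1, h2]
      simpa using h)
    have hG : of ![u, w, b] * M * (of ![u, w, b])ᵀ = diagonal ![u ⬝ᵥ M *ᵥ u, u ⬝ᵥ M *ᵥ u,
        -(u ⬝ᵥ M *ᵥ u) * (-(b ⬝ᵥ M *ᵥ b) / (u ⬝ᵥ M *ᵥ u))] := by
      ext i j
      rw [gram_apply]
      fin_cases i <;> fin_cases j <;> simp [h1, h2, hb0, hb1, dotProduct_mulVec_comm hM w u,
        dotProduct_mulVec_comm hM b u, dotProduct_mulVec_comm hM b w]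
      rw [← h1]
      field_simp
    refine ⟨_, _, _, hT, h, fun hg ↦ ?_, hG⟩
    have := congrArg det hG
    rw [det_mul, det_mul, det_transpose, det_diagonal, Fin.prod_univ_three, hg] at this
    simp at this
    tauto
  by_cases h : u ⬝ᵥ M *ᵥ u = 0
  -- An isotropic vector `e` lies in a hyperbolic plane with basis `e`, `f'`. If `n` is orthogonal
  -- to this plane and has value `s`, then `e + (s/2) f'` also has value `s` and is orthogonal to
  -- `n`, so `key` applies to this pair.
  · obtain ⟨e, he, hee⟩ : ∃ e ≠ 0, e ⬝ᵥ M *ᵥ e = 0 := by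
      rcases huw with hu | hw
      exacts [⟨u, hu, h⟩, ⟨w, hw, h1 ▸ h⟩]
    have hMe : M *ᵥ e ≠ 0 := fun h0 ↦ hdet (exists_mulVec_eq_zero_iff.mp ⟨e, he, h0⟩)
    obtain ⟨i, hi⟩ := Function.ne_iff.mp hMe
    rw [Pi.zero_apply] at hi
    obtain ⟨f, hf⟩ : ∃ f : Fin 3 → K, f ⬝ᵥ M *ᵥ e = 1 :=
      ⟨Pi.single i ((M *ᵥ e) i)⁻¹, by rw [single_dotProduct, inv_mul_cancel₀ hi]⟩
    have hf' : e ⬝ᵥ M *ᵥ f = 1 := by rw [dotProduct_mulVec_comm hM, hf]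
    obtain ⟨f', hef', hff'⟩ : ∃ f' : Fin 3 → K, e ⬝ᵥ M *ᵥ f' = 1 ∧ f' ⬝ᵥ M *ᵥ f' = 0 := by
      refine ⟨f - ((f ⬝ᵥ M *ᵥ f) / 2) • e, ?_, ?_⟩
      · simp [mulVec_sub, mulVec_smul, hee, hf']
      · simp [mulVec_sub, mulVec_smul, hee, hf', hf]
        ring
    have hfe' : f' ⬝ᵥ M *ᵥ e = 1 := by rw [dotProduct_mulVec_comm hM, hef']
    obtain ⟨n, hn0, hn1, hT⟩ := exists_orthogonal hM e f' (by simp [hee, hff', hef'])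
    have hn0' : n ⬝ᵥ M *ᵥ e = 0 := by rw [dotProduct_mulVec_comm hM, hn0]
    have hn1' : n ⬝ᵥ M *ᵥ f' = 0 := by rw [dotProduct_mulVec_comm hM, hn1]
    have hG : of ![e, f', n] * M * (of ![e, f', n])ᵀ =
        !![0, 1, 0; 1, 0, 0; 0, 0, n ⬝ᵥ M *ᵥ n] := by
      ext i j
      rw [gram_apply]
      fin_cases i <;> fin_cases j <;> simp [hee, hff', hef', hfe', hn0, hn1, hn0', hn1']
    have hs : n ⬝ᵥ M *ᵥ n ≠ 0 := by
      intro hs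
      have := congrArg det hG
      have h0 : (!![0, 1, 0; 1, 0, 0; 0, 0, (0 : K)]).det = 0 := by simp [det_fin_three]
      rw [hs, h0, det_mul, det_mul, det_transpose] at this
      exact mul_ne_zero (mul_ne_zero hT hdet) hT this
    refine key n (e + ((n ⬝ᵥ M *ᵥ n) / 2) • f') ?_ ?_ hs
    · simp [mulVec_add, mulVec_smul, hee, hff', hef', hfe']
    · simp [mulVec_add, mulVec_smul, hn0', hn1']
  · exact key u w h1 h2 h

lemma exists_map_add_I_mul (p : Polynomial ℂ) : ∃ u w : Polynomial ℝ,
    p = u.map Complex.ofRealHom + Polynomial.C Complex.I * w.map Complex.ofRealHom := by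
  induction p using Polynomial.induction_on' with
  | add p q hp hq =>
    obtain ⟨u, w, rfl⟩ := hp
    obtain ⟨u', w', rfl⟩ := hq
    refine ⟨u + u', w + w', ?_⟩
    simp only [Polynomial.map_add]
    ring
  | monomial n a =>
    refine ⟨Polynomial.monomial n a.re, Polynomial.monomial n a.im, ?_⟩
    rw [Polynomial.map_monomial, Polynomial.map_monomial, Polynomial.C_mul_monomial, ← map_add]
    congr 1
    rw [mul_comm]
    exact (Complex.re_add_im a).symm

lemma eq_zero_of_map_add_I_mul {u w : Polynomial ℝ}
    (h : u.map Complex.ofRealHom + Polynomial.C Complex.I * w.map Complex.ofRealHom = 0) :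
    u = 0 ∧ w = 0 := by
  constructor
  · ext n
    simpa using congrArg (fun p ↦ (Polynomial.coeff p n).re) h
  · ext n
    simpa using congrArg (fun p ↦ (Polynomial.coeff p n).im) h

/-- A ternary form over `ℝ(z)` is isotropic over `ℂ(z)`. -/
theorem exists_isotropic_real [Algebra ℝ K] {z : K} (hz : Transcendental ℝ z)
    (hfrac : ∀ s : K, ∃ p r : Polynomial ℝ, Polynomial.aeval z r ≠ 0 ∧
      s * Polynomial.aeval z r = Polynomial.aeval z p)
    {M : Matrix (Fin 3) (Fin 3) K} (hM : Mᵀ = M) :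
    ∃ u w : Fin 3 → K, (u ≠ 0 ∨ w ≠ 0) ∧ u ⬝ᵥ M *ᵥ u = w ⬝ᵥ M *ᵥ w ∧ u ⬝ᵥ M *ᵥ w = 0 := by
  choose p r hr hp using fun i j ↦ hfrac (M i j)
  let D : Polynomial ℝ := ∏ t : Fin 3 × Fin 3, r t.1 t.2
  have hD : Polynomial.aeval z D ≠ 0 := by
    rw [map_prod]
    exact Finset.prod_ne_zero_iff.mpr fun t _ ↦ hr t.1 t.2
  obtain ⟨P, hP⟩ : ∃ P : Fin 3 → Fin 3 → Polynomial ℝ,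
      ∀ i j, Polynomial.aeval z (P i j) = Polynomial.aeval z D * M i j := by
    refine ⟨fun i j ↦ p i j * ∏ t ∈ Finset.univ.erase (i, j), r t.1 t.2, fun i j ↦ ?_⟩
    have : D = r i j * ∏ t ∈ Finset.univ.erase (i, j), r t.1 t.2 :=
      (Finset.mul_prod_erase Finset.univ (fun t : Fin 3 × Fin 3 ↦ r t.1 t.2)
        (Finset.mem_univ (i, j))).symm
    rw [this, map_mul, map_mul, ← hp]
    ring
  obtain ⟨y, hy0, hy⟩ := exists_isotropic fun i j ↦ (P i j).map Complex.ofRealHom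
  choose u w huw using fun i ↦ exists_map_add_I_mul (y i)
  have hI : (Polynomial.C Complex.I) ^ 2 = -1 := by
    rw [← Polynomial.C_pow, Complex.I_sq, Polynomial.C_neg, Polynomial.C_1]
  -- The form at the complex zero `y = u + i w` is split into its real and imaginary parts.
  have hsum : (∑ i, ∑ j, P i j * (u i * u j - w i * w j)).map Complex.ofRealHom +
      Polynomial.C Complex.I * (∑ i, ∑ j, P i j * (u i * w j + w i * u j)).map
        Complex.ofRealHom = 0 := by
    rw [← hy]
    simp only [Polynomial.map_sum, Finset.mul_sum, ← Finset.sum_add_distrib]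
    refine Finset.sum_congr rfl fun i _ ↦ Finset.sum_congr rfl fun j _ ↦ ?_
    rw [huw i, huw j]
    simp only [Polynomial.map_mul, Polynomial.map_add, Polynomial.map_sub]
    linear_combination (-(P i j).map Complex.ofRealHom * (w i).map Complex.ofRealHom *
      (w j).map Complex.ofRealHom) * hI
  obtain ⟨h1, h2⟩ := eq_zero_of_map_add_I_mul hsum
  have hB (a b : Fin 3 → Polynomial ℝ) : Polynomial.aeval z (∑ i, ∑ j, P i j * (a i * b j)) =
      Polynomial.aeval z D * ((fun i ↦ Polynomial.aeval z (a i)) ⬝ᵥ M *ᵥ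
        fun i ↦ Polynomial.aeval z (b i)) := by
    simp only [map_sum, map_mul, hP, dotProduct, mulVec, Finset.mul_sum]
    refine Finset.sum_congr rfl fun i _ ↦ Finset.sum_congr rfl fun j _ ↦ ?_
    ring
  have h1' := congrArg (Polynomial.aeval z) h1
  have h2' := congrArg (Polynomial.aeval z) h2
  simp only [mul_sub, mul_add, Finset.sum_sub_distrib, Finset.sum_add_distrib, map_sub,
    map_add, hB, map_zero] at h1' h2'
  rw [← mul_sub, mul_eq_zero, or_iff_right hD, sub_eq_zero] at h1'
  rw [dotProduct_mulVec_comm hM (fun i ↦ Polynomial.aeval z (w i)), ← mul_add, mul_eq_zero,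
    or_iff_right hD, ← two_mul, mul_eq_zero] at h2'
  have hinj := transcendental_iff_injective.mp hz
  refine ⟨_, _, ?_, h1', h2'.resolve_left ?_⟩
  · by_contra! hcon
    refine hy0 (funext fun i ↦ ?_)
    have hu : u i = 0 := hinj ((congrFun hcon.1 i).trans (map_zero _).symm)
    have hw : w i = 0 := hinj ((congrFun hcon.2 i).trans (map_zero _).symm)
    rw [huw i, hu, hw]
    simp
  · have : CharZero K := charZero_of_injective_algebraMap (algebraMap ℝ K).injective
    exact two_ne_zero

end ternaryForms

/-! ### Real polynomials modulo squares and sums of two squares -/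

section squareClasses

lemma exists_sign_mul_sq (r : ℝ) (hr : r ≠ 0) :
    ∃ ε s : ℝ, (ε = 1 ∨ ε = -1) ∧ s ≠ 0 ∧ r = ε * s ^ 2 := by
  rcases hr.lt_or_gt with h | h
  · refine ⟨-1, √(-r), .inr rfl, (Real.sqrt_pos.mpr (by linarith)).ne', ?_⟩
    rw [Real.sq_sqrt (by linarith)]
    ring
  · refine ⟨1, √r, .inl rfl, (Real.sqrt_pos.mpr h).ne', ?_⟩
    rw [Real.sq_sqrt h.le, one_mul]

open Polynomial in
/-- Up to squares and sums of two squares, a real polynomial is a signed product of distinct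
linear factors. -/
theorem exists_squareClass (p : ℝ[X]) (hp : p ≠ 0) :
    ∃ (ε : ℝ) (S : Finset ℝ) (h u w : ℝ[X]), (ε = 1 ∨ ε = -1) ∧ h ≠ 0 ∧ u ^ 2 + w ^ 2 ≠ 0 ∧
      p = Polynomial.C ε * (u ^ 2 + w ^ 2) * h ^ 2 * ∏ a ∈ S, (Polynomial.X - Polynomial.C a) := by
  classical
  induction p using UniqueFactorizationMonoid.induction_on_prime with
  | h₁ => exact absurd rfl hp
  | h₂ p hu =>
    obtain ⟨r, hr, rfl⟩ := Polynomial.isUnit_iff.mp hu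
    obtain ⟨ε, s, hε, hs, rfl⟩ := exists_sign_mul_sq r hr.ne_zero
    refine ⟨ε, ∅, Polynomial.C s, 1, 0, hε, by simpa using hs, by simp, ?_⟩
    simp [Polynomial.C_mul, Polynomial.C_pow]
  | h₃ p q hp0 hq ih =>
    obtain ⟨ε, S, h, u, w, hε, hh, huw, rfl⟩ := ih hp0
    have hq' : ∃ (ε : ℝ) (S : Finset ℝ) (h u w : ℝ[X]), (ε = 1 ∨ ε = -1) ∧ h ≠ 0 ∧
        u ^ 2 + w ^ 2 ≠ 0 ∧
        q = Polynomial.C ε * (u ^ 2 + w ^ 2) * h ^ 2 *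
          ∏ a ∈ S, (Polynomial.X - Polynomial.C a) := by
      by_cases hroot : ∃ a, q.IsRoot a
      · obtain ⟨a, ha⟩ := hroot
        obtain ⟨b, hb⟩ := Polynomial.dvd_iff_isRoot.mpr ha
        have hbu : IsUnit b := (hq.irreducible.isUnit_or_isUnit hb).resolve_left
          (Polynomial.not_isUnit_X_sub_C a)
        obtain ⟨r, hr, rfl⟩ := Polynomial.isUnit_iff.mp hbu
        obtain ⟨ε, s, hε, hs, rfl⟩ := exists_sign_mul_sq r hr.ne_zero
        refine ⟨ε, {a}, Polynomial.C s, 1, 0, hε, by simpa using hs, by simp, ?_⟩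
        rw [hb]
        simp [Polynomial.C_mul, Polynomial.C_pow]
        ring
      -- A rootless irreducible real polynomial is quadratic with negative discriminant. Completing
      -- the square writes it, up to sign and a square constant, as `(X + b/(2a))² + d²`.
      · push Not at hroot
        have hdeg : q.natDegree ≤ 2 :=
          Polynomial.natDegree_le_of_degree_le hq.irreducible.degree_le_two
        have hexp : q = Polynomial.C (q.coeff 2) * Polynomial.X ^ 2 +
            Polynomial.C (q.coeff 1) * Polynomial.X + Polynomial.C (q.coeff 0) := by
          conv_lhs => rw [q.as_sum_range_C_mul_X_pow' (n := 3) (by omega)]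
          simp [Finset.sum_range_succ]
          ring
        generalize q.coeff 2 = a at hexp
        generalize q.coeff 1 = b at hexp
        generalize q.coeff 0 = c at hexp
        have heval (t : ℝ) : a * t ^ 2 + b * t + c ≠ 0 := by
          have := hroot t
          rw [hexp] at this
          simpa [Polynomial.IsRoot] using this
        have hdisc : discrim a b c < 0 := by
          by_contra! hd
          by_cases ha : a = 0
          · by_cases hb : b = 0
            · refine hq.not_isUnit ?_
              rw [hexp, ha, hb]
              have hc := heval 0
              simp [ha, hb] at hc
              simpa using hc
            · refine heval (-c / b) ?_
              rw [ha]
              field_simp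
              ring
          · obtain ⟨t, ht⟩ := exists_quadratic_eq_zero ha
              ⟨√(discrim a b c), (Real.mul_self_sqrt hd).symm⟩
            exact heval t (by linear_combination ht)
        have ha : a ≠ 0 := by
          rintro rfl
          rw [discrim] at hdisc
          nlinarith [sq_nonneg b]
        obtain ⟨ε, s, hε, hs, rfl⟩ := exists_sign_mul_sq a ha
        have hε2 : ε ^ 2 = 1 := by rcases hε with rfl | rfl <;> norm_num
        have hε0 : ε ≠ 0 := by rcases hε with rfl | rfl <;> norm_num
        obtain ⟨d, hd⟩ : ∃ d : ℝ, d ^ 2 = -discrim (ε * s ^ 2) b c / (4 * (ε * s ^ 2) ^ 2) :=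
          ⟨√_, Real.sq_sqrt (div_nonneg (by linarith) (by positivity))⟩
        have hq0 := hq.ne_zero
        have key : q = Polynomial.C ε * ((Polynomial.X + Polynomial.C (b / (2 * (ε * s ^ 2)))) ^ 2 +
            Polynomial.C d ^ 2) * Polynomial.C s ^ 2 * 1 := by
          rw [hexp]
          refine Polynomial.funext fun t ↦ ?_
          simp only [Polynomial.eval_add, Polynomial.eval_mul, Polynomial.eval_pow,
            Polynomial.eval_X, Polynomial.eval_C, Polynomial.eval_one]
          rw [hd, discrim]
          field_simp
          ring
        exact ⟨ε, ∅, Polynomial.C s, _, Polynomial.C d, hε, by simpa using hs,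
          fun h0 ↦ hq0 (by rw [key, h0]; simp), key⟩
    obtain ⟨ε', S', h', u', w', hε', hh', huw', rfl⟩ := hq'
    -- Common roots contribute a square, so the symmetric difference of the two sets of roots
    -- remains.
    have hprod : (∏ a ∈ S, (Polynomial.X - Polynomial.C a)) *
        ∏ a ∈ S', (Polynomial.X - Polynomial.C a) =
        (∏ a ∈ S ∩ S', (Polynomial.X - Polynomial.C a)) ^ 2 *
          ∏ a ∈ symmDiff S S', (Polynomial.X - Polynomial.C a) := by
      rw [← Finset.prod_union_inter, symmDiff_eq_sup_sdiff_inf, Finset.sup_eq_union,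
        Finset.inf_eq_inter, ← Finset.prod_sdiff (Finset.inter_subset_union (s := S) (t := S'))]
      ring
    have hsq : (u' ^ 2 + w' ^ 2) * (u ^ 2 + w ^ 2) =
        (u' * u - w' * w) ^ 2 + (u' * w + w' * u) ^ 2 := by ring
    refine ⟨ε' * ε, symmDiff S S', h' * h * ∏ a ∈ S ∩ S', (Polynomial.X - Polynomial.C a),
      u' * u - w' * w, u' * w + w' * u, ?_, ?_, hsq ▸ mul_ne_zero huw' huw, ?_⟩
    · rcases hε with rfl | rfl <;> rcases hε' with rfl | rfl <;> norm_num
    · exact mul_ne_zero (mul_ne_zero hh' hh)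
        (Finset.prod_ne_zero_iff.mpr fun a _ ↦ Polynomial.X_sub_C_ne_zero a)
    · rw [← hsq, Polynomial.C_mul]
      linear_combination (Polynomial.C ε' * (u' ^ 2 + w' ^ 2) * h' ^ 2 *
        Polynomial.C ε * (u ^ 2 + w ^ 2) * h ^ 2) * hprod

end squareClasses

/-! ### Reduction to the standard equation -/

section standardForm

open IntermediateField

variable {L : Type} [Field L]

lemma transcendental_of_adjoin_eq_top {K : Type} [Field K] [Algebra K L]
    (hL : ¬ Algebra.IsAlgebraic K L) {x y : L} {g : K} (h : x ^ 2 + y ^ 2 = algebraMap K L g)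
    (htop : adjoin K {x, y} = (⊤ : IntermediateField K L)) : Transcendental K x := by
  intro hx
  have hy : IsAlgebraic K y := by
    refine IsAlgebraic.of_pow (n := 2) two_pos ?_
    rw [eq_sub_of_add_eq' h]
    exact (isAlgebraic_algebraMap g).sub (hx.pow 2)
  have halg : Algebra.IsAlgebraic K (adjoin K {x, y}) := isAlgebraic_adjoin (by
    rintro s (rfl | rfl)
    exacts [hx.isIntegral, hy.isIntegral])
  rw [htop] at halg
  exact hL ((topEquiv (F := K) (E := L)).isAlgebraic)

variable [Algebra ℝ L]

lemma adjoin_triple_eq_top {x y z : L}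
    (h : adjoin ℝ⟮z⟯ {x, y} = (⊤ : IntermediateField ℝ⟮z⟯ L)) :
    adjoin ℝ {x, y, z} = (⊤ : IntermediateField ℝ L) := by
  have h1 := adjoin_adjoin_left ℝ {z} {x, y} (E := L)
  rw [h, restrictScalars_top] at h1
  rw [h1]
  congr 1
  ext t
  simp

omit [Algebra ℝ L] in
lemma adjoin_pair_eq_top {K : Type} [Field K] [Algebra K L] {x y x' y' : L}
    (h : adjoin K {x, y} = (⊤ : IntermediateField K L))
    (hx : x ∈ adjoin K {x', y'}) (hy : y ∈ adjoin K {x', y'}) :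
    adjoin K {x', y'} = (⊤ : IntermediateField K L) := by
  rw [eq_top_iff, ← h, adjoin_le_iff]
  rintro s (rfl | rfl)
  exacts [hx, hy]

/-- For `g = p / r` one has `g = p r / r²`, so the square-class decomposition of the polynomial `p
r` applies. Its square and its sum of two squares are absorbed by a change of `x` and `y` over ℝ(z).
-/
theorem exists_isStandardPoint_finset {z : L} (hz : Transcendental ℝ z)
    (hL : ¬ Algebra.IsAlgebraic ℝ⟮z⟯ L) {x y : L} {g : ℝ⟮z⟯} (hg : g ≠ 0)
    (h : x ^ 2 + y ^ 2 = g) (htop : adjoin ℝ⟮z⟯ {x, y} = (⊤ : IntermediateField ℝ⟮z⟯ L)) :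
    ∃ (ε : ℝ) (S : Finset ℝ) (x' y' : L), (ε = 1 ∨ ε = -1) ∧
      IsStandardPoint x' y' z (Polynomial.C ε * ∏ a ∈ S, (Polynomial.X - Polynomial.C a)) ∧
      adjoin ℝ⟮z⟯ {x', y'} = (⊤ : IntermediateField ℝ⟮z⟯ L) := by
  obtain ⟨p, r, hpr⟩ := (mem_adjoin_simple_iff ℝ (g : L)).mp g.2
  have hinj := transcendental_iff_injective.mp hz
  have hne (p : Polynomial ℝ) (hp : p ≠ 0) : Polynomial.aeval z p ≠ 0 :=
    fun h ↦ hp (hinj (h.trans (map_zero _).symm))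
  have hg0 : (g : L) ≠ 0 := by simpa using hg
  have hr : r ≠ 0 := by rintro rfl; simp at hpr; exact hg hpr
  have hp : p ≠ 0 := by rintro rfl; simp at hpr; exact hg hpr
  obtain ⟨ε, S, k, u, w, hε, hk, huw, hprod⟩ := exists_squareClass (p * r) (mul_ne_zero hp hr)
  have hk' := hne k hk
  have hr' := hne r hr
  have huw' := hne _ huw
  have hprod' := congrArg (Polynomial.aeval z) hprod
  simp only [map_mul, map_add, map_pow] at hprod' huw'
  have hmem (p : Polynomial ℝ) : Polynomial.aeval z p ∈ ℝ⟮z⟯ :=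
    (mem_adjoin_simple_iff ℝ _).mpr ⟨p, 1, by simp⟩
  have hmem' (T : IntermediateField ℝ⟮z⟯ L) (p : Polynomial ℝ) : Polynomial.aeval z p ∈ T :=
    IntermediateField.algebraMap_mem T ⟨_, hmem p⟩
  set U := Polynomial.aeval z u with hU
  set W := Polynomial.aeval z w with hW
  set H := Polynomial.aeval z k with hH
  set R := Polynomial.aeval z r with hR
  -- Formally `x' + i y' = R (x + i y) / (H (U + i W))`; the norm of the divisor removes exactly the
  -- unwanted factors. The inverse formulas below show that the field generated is unchanged.
  let x' := R * (x * U + y * W) / (H * (U ^ 2 + W ^ 2))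
  let y' := R * (y * U - x * W) / (H * (U ^ 2 + W ^ 2))
  have hx' : x = H / R * (x' * U - y' * W) := by
    simp only [x', y']
    field_simp
    ring
  have hy' : y = H / R * (y' * U + x' * W) := by
    simp only [x', y']
    field_simp
    ring
  have htop' : adjoin ℝ⟮z⟯ {x', y'} = (⊤ : IntermediateField ℝ⟮z⟯ L) := by
    have hx₀ : x' ∈ adjoin ℝ⟮z⟯ {x', y'} := subset_adjoin _ _ (by simp)
    have hy₀ : y' ∈ adjoin ℝ⟮z⟯ {x', y'} := subset_adjoin _ _ (by simp)
    refine adjoin_pair_eq_top htop ?_ ?_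
    · rw [hx']
      exact mul_mem (div_mem (hmem' _ _) (hmem' _ _))
        (sub_mem (mul_mem hx₀ (hmem' _ _)) (mul_mem hy₀ (hmem' _ _)))
    · rw [hy']
      exact mul_mem (div_mem (hmem' _ _) (hmem' _ _))
        (add_mem (mul_mem hy₀ (hmem' _ _)) (mul_mem hx₀ (hmem' _ _)))
  have heq : x' ^ 2 + y' ^ 2 = Polynomial.aeval z
      (Polynomial.C ε * ∏ a ∈ S, (Polynomial.X - Polynomial.C a)) := by
    have hε0 : ε ≠ 0 := by rcases hε with rfl | rfl <;> norm_num
    have h1 : x' ^ 2 + y' ^ 2 = R ^ 2 * (x ^ 2 + y ^ 2) / (H ^ 2 * (U ^ 2 + W ^ 2)) := by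
      simp only [x', y']
      field_simp
      ring
    rw [h1, h, hpr, map_mul, div_eq_iff (mul_ne_zero (pow_ne_zero 2 hk') huw')]
    field_simp
    linear_combination hprod'
  refine ⟨ε, S, x', y', hε, ⟨hz, ?_, heq, ?_⟩, htop'⟩
  · exact transcendental_of_adjoin_eq_top hL (g := ⟨_, hmem _⟩) heq htop'
  · refine separable_C_mul (by rcases hε with rfl | rfl <;> norm_num) ?_
    exact Polynomial.separable_prod_X_sub_C_iff'.mpr fun _ _ _ _ h ↦ h

lemma adjoin_simple_eq_of_mul_sub {z t : L} {c : ℝ} (h : t * (z - algebraMap ℝ L c) = 1) :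
    ℝ⟮t⟯ = ℝ⟮z⟯ := by
  have ht0 : t ≠ 0 := left_ne_zero_of_mul_eq_one h
  have hz0 : z - algebraMap ℝ L c ≠ 0 := right_ne_zero_of_mul_eq_one h
  apply le_antisymm
  · rw [adjoin_simple_le_iff, eq_inv_of_mul_eq_one_left h]
    exact inv_mem (sub_mem (mem_adjoin_simple_self ℝ z) (IntermediateField.algebraMap_mem _ c))
  · rw [adjoin_simple_le_iff]
    have : z = t⁻¹ + algebraMap ℝ L c := by
      rw [← eq_inv_of_mul_eq_one_right h]
      ring
    rw [this]
    exact add_mem (inv_mem (mem_adjoin_simple_self ℝ t)) (IntermediateField.algebraMap_mem _ c)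

/-- Moving a point at infinity of a standard surface of odd degree to the affine part. -/
theorem IsStandardPoint.exists_even {x y z : L} {ε : ℝ} {S : Finset ℝ}
    (hε : ε = 1 ∨ ε = -1) (hS : Odd S.card)
    (h : IsStandardPoint x y z (Polynomial.C ε * ∏ a ∈ S, (Polynomial.X - Polynomial.C a)))
    (htop : adjoin ℝ⟮z⟯ {x, y} = (⊤ : IntermediateField ℝ⟮z⟯ L)) :
    ∃ (c : ℝ) (t : L) (ε' : ℝ) (S' : Finset ℝ) (x' y' : L), t * (z - algebraMap ℝ L c) = 1 ∧
      (ε' = 1 ∨ ε' = -1) ∧ Even S'.card ∧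
      IsStandardPoint x' y' t (Polynomial.C ε' * ∏ a ∈ S', (Polynomial.X - Polynomial.C a)) ∧
      adjoin ℝ⟮t⟯ {x', y'} = (⊤ : IntermediateField ℝ⟮t⟯ L) := by
  classical
  -- The point `c`, which is not a root, is to be sent to infinity.
  obtain ⟨c, hc⟩ := Infinite.exists_notMem_finset S
  obtain ⟨k, hk⟩ := hS
  have hε0 : ε ≠ 0 := by rcases hε with rfl | rfl <;> norm_num
  have hca (a : ℝ) (ha : a ∈ S) : a - c ≠ 0 := sub_ne_zero.mpr fun h ↦ hc (h ▸ ha)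
  have hzc : z - algebraMap ℝ L c ≠ 0 := fun h0 ↦
    h.transcendental_z (sub_eq_zero.mp h0 ▸ isAlgebraic_algebraMap c)
  obtain ⟨ε', r, hε', hr, hεr⟩ := exists_sign_mul_sq (ε * ∏ a ∈ S, (c - a))
    (mul_ne_zero hε0 (Finset.prod_ne_zero_iff.mpr fun a ha ↦ by
      rw [← neg_sub, neg_ne_zero]; exact hca a ha))
  have ht : (z - algebraMap ℝ L c)⁻¹ * (z - algebraMap ℝ L c) = 1 := inv_mul_cancel₀ hzc
  generalize (z - algebraMap ℝ L c)⁻¹ = t at ht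
  have ht0 : t ≠ 0 := left_ne_zero_of_mul_eq_one ht
  have hinjOn : Set.InjOn (fun a ↦ 1 / (a - c)) S := fun a _ b _ hab ↦ by
    simpa using hab
  have h0 : (0 : ℝ) ∉ S.image fun a ↦ 1 / (a - c) := by
    rw [Finset.mem_image]
    rintro ⟨a, ha, h0⟩
    exact one_div_ne_zero (hca a ha) h0
  -- With `t = 1 / (z - c)` one has `z - a = (c - a)(t - 1/(a - c)) / t`. The `2k + 1` factors leave
  -- `t ^ -(2k + 1)`; multiplication by the square of `s = t ^ (k + 1) / r` turns this into one
  -- factor `t`, the root `0`, which is the former point `z = ∞`. The constants combine to the sign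
  -- `ε'`.
  let S' := insert 0 (S.image fun a ↦ 1 / (a - c))
  have hcard : S'.card = 2 * k + 2 := by
    rw [Finset.card_insert_of_notMem h0, Finset.card_image_of_injOn hinjOn, hk]
  have hK := adjoin_simple_eq_of_mul_sub ht
  have hr' : algebraMap ℝ L r ≠ 0 := by simpa using hr
  let s := t ^ (k + 1) / algebraMap ℝ L r
  have hs0 : s ≠ 0 := div_ne_zero (pow_ne_zero _ ht0) hr'
  have hs : s ∈ ℝ⟮t⟯ := div_mem (S := IntermediateField ℝ L)
    (pow_mem (mem_adjoin_simple_self ℝ t) _) (IntermediateField.algebraMap_mem _ r)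
  have htz : Transcendental ℝ t := by
    intro halg
    have h1 : z = t⁻¹ + algebraMap ℝ L c := by
      rw [← eq_inv_of_mul_eq_one_right ht]
      ring
    exact h.transcendental_z (h1 ▸ halg.inv.add (isAlgebraic_algebraMap c))
  refine ⟨c, t, ε', S', x * s, y * s, ht, hε', ⟨k + 1, by omega⟩, ⟨htz, ?_, ?_, ?_⟩, ?_⟩
  · intro halg
    have h1 := halg.mul (isAlgebraic_algebraMap (⟨s⁻¹, inv_mem hs⟩ : ℝ⟮t⟯) (A := L))
    change IsAlgebraic ℝ⟮t⟯ (x * s * s⁻¹) at h1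
    rw [mul_assoc, mul_inv_cancel₀ hs0, mul_one, hK] at h1
    exact h.transcendental_x h1
  · have hfac (a : ℝ) (ha : a ∈ S) : z - algebraMap ℝ L a =
        algebraMap ℝ L (c - a) * (t - algebraMap ℝ L (1 / (a - c))) * t⁻¹ := by
      have h1 : z = t⁻¹ + algebraMap ℝ L c := by
        rw [← eq_inv_of_mul_eq_one_right ht]
        ring
      have h2 : algebraMap ℝ L (c - a) * algebraMap ℝ L (1 / (a - c)) = -1 := by
        rw [← map_mul, ← map_one (algebraMap ℝ L), ← map_neg]
        congr 1
        have := hca a ha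
        field_simp
        ring
      rw [mul_sub, h2, h1, map_sub]
      field_simp
      ring
    have heq := h.eq
    simp only [map_mul, map_prod, map_sub, Polynomial.aeval_X, Polynomial.aeval_C] at heq ⊢
    rw [Finset.prod_congr rfl hfac, Finset.prod_mul_distrib, Finset.prod_mul_distrib,
      Finset.prod_const, hk, ← map_prod] at heq
    have hεr' := congrArg (algebraMap ℝ L) hεr
    simp only [map_mul, map_pow] at hεr'
    rw [Finset.prod_insert h0, Finset.prod_image hinjOn, map_zero, sub_zero]
    have h3 : (x * s) ^ 2 + (y * s) ^ 2 = (x ^ 2 + y ^ 2) * s ^ 2 := by ring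
    rw [h3, heq]
    simp only [s]
    generalize ∏ a ∈ S, (t - algebraMap ℝ L (1 / (a - c))) = P
    generalize algebraMap ℝ L (∏ a ∈ S, (c - a)) = Q at hεr'
    have h4 : t⁻¹ ^ (2 * k + 1) * (t ^ (k + 1)) ^ 2 = t := by
      rw [inv_pow]
      field_simp
      ring
    have h5 : algebraMap ℝ L ε * (Q * P * t⁻¹ ^ (2 * k + 1)) * (t ^ (k + 1) / algebraMap ℝ L r) ^ 2 =
        (algebraMap ℝ L ε * Q) * P * (t⁻¹ ^ (2 * k + 1) * (t ^ (k + 1)) ^ 2) /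
          algebraMap ℝ L r ^ 2 := by ring
    rw [h5, h4, hεr']
    field_simp
  · refine separable_C_mul (by rcases hε' with rfl | rfl <;> norm_num) ?_
    exact Polynomial.separable_prod_X_sub_C_iff'.mpr fun _ _ _ _ h ↦ h
  · have htop' : adjoin ℝ⟮t⟯ {x, y} = (⊤ : IntermediateField ℝ⟮t⟯ L) := by rw [hK]; exact htop
    have hs' : s ∈ adjoin ℝ⟮t⟯ {x * s, y * s} :=
      IntermediateField.algebraMap_mem _ (⟨s, hs⟩ : ℝ⟮t⟯)
    refine adjoin_pair_eq_top htop' ?_ ?_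
    · have : x * s / s ∈ adjoin ℝ⟮t⟯ {x * s, y * s} := div_mem (subset_adjoin _ _ (by simp)) hs'
      rwa [mul_div_cancel_right₀ x hs0] at this
    · have : y * s / s ∈ adjoin ℝ⟮t⟯ {x * s, y * s} := div_mem (subset_adjoin _ _ (by simp)) hs'
      rwa [mul_div_cancel_right₀ y hs0] at this

theorem exists_isStandardPoint {z : L} (hz : Transcendental ℝ z)
    (hL : ¬ Algebra.IsAlgebraic ℝ⟮z⟯ L) {x y : L} {g : ℝ⟮z⟯} (hg : g ≠ 0)
    (h : x ^ 2 + y ^ 2 = g) (htop : adjoin ℝ⟮z⟯ {x, y} = (⊤ : IntermediateField ℝ⟮z⟯ L)) :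
    ∃ (t : L) (m : ℕ) (a : Fin (2 * m) → ℝ) (ε : ℝ) (x' y' : L),
      (t = z ∨ ∃ c, t * (z - algebraMap ℝ L c) = 1) ∧ Function.Injective a ∧
      (ε = 1 ∨ ε = -1) ∧
      IsStandardPoint x' y' t (Polynomial.C ε * ∏ i, (Polynomial.X - Polynomial.C (a i))) ∧
      adjoin ℝ {x', y', t} = (⊤ : IntermediateField ℝ L) := by
  have key {S : Finset ℝ} (hS : Even S.card) {ε : ℝ} {x' y' t : L}
      (h : IsStandardPoint x' y' t (Polynomial.C ε * ∏ a ∈ S, (Polynomial.X - Polynomial.C a))) :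
      ∃ (m : ℕ) (a : Fin (2 * m) → ℝ), Function.Injective a ∧
        IsStandardPoint x' y' t (Polynomial.C ε * ∏ i, (Polynomial.X - Polynomial.C (a i))) := by
    obtain ⟨m, hm⟩ := hS
    let e := S.equivFinOfCardEq (hm.trans (two_mul m).symm)
    refine ⟨m, fun i ↦ e.symm i, Subtype.val_injective.comp e.symm.injective, ?_⟩
    have : ∏ i, (Polynomial.X - Polynomial.C ((e.symm i : S) : ℝ)) =
        ∏ a ∈ S, (Polynomial.X - Polynomial.C a) := by
      rw [← Finset.prod_coe_sort S]
      exact Equiv.prod_comp e.symm fun a : S ↦ (Polynomial.X - Polynomial.C (a : ℝ))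
    rw [this]
    exact h
  obtain ⟨ε, S, x', y', hε, h', htop'⟩ := exists_isStandardPoint_finset hz hL hg h htop
  rcases Nat.even_or_odd S.card with hS | hS
  · obtain ⟨m, a, ha, h''⟩ := key hS h'
    exact ⟨z, m, a, ε, x', y', .inl rfl, ha, hε, h'', adjoin_triple_eq_top htop'⟩
  · obtain ⟨c, t, ε', S', x₁, y₁, ht, hε', hS', h₁, htop₁⟩ := h'.exists_even hε hS htop'
    obtain ⟨m, a, ha, h''⟩ := key hS' h₁
    exact ⟨t, m, a, ε', x₁, y₁, .inr ⟨c, ht⟩, ha, hε', h'', adjoin_triple_eq_top htop₁⟩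

end standardForm

/-! ### From a nondegenerate form to `x² + y² = g` -/

section QuadraticForms

open Matrix

lemma _root_.MvPolynomial.IsHomogeneous.exists_eq_sum_C_mul_X {k : Type*} [Field k] {n : ℕ}
    {P : MvPolynomial (Fin n) k} (hP : P.IsHomogeneous 1) :
    ∃ c : Fin n → k, P = ∑ i, C (c i) * X i := by
  refine ⟨fun i ↦ coeff 0 (pderiv i P), ?_⟩
  have h := hP.sum_X_mul_pderiv
  rw [one_smul] at h
  refine h.symm.trans (Finset.sum_congr rfl fun i _ ↦ ?_)
  have h0 : (pderiv i P).totalDegree = 0 := Nat.le_zero.mp hP.pderiv.totalDegree_le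
  rw [mul_comm, ← totalDegree_eq_zero_iff_eq_C.mp h0]

/-- Euler's identity gives `2Q = ∑ c i j * X i * X j`, with `c i j` the coefficients of the partial
derivatives. Adding the transposed expression and dividing by `4` makes the matrix symmetric. -/
lemma _root_.MvPolynomial.IsHomogeneous.exists_symmetric_matrix {k : Type*} [Field k] [CharZero k]
    {n : ℕ} {Q : MvPolynomial (Fin n) k} (hQ : Q.IsHomogeneous 2) :
    ∃ M : Matrix (Fin n) (Fin n) k, Mᵀ = M ∧
      Q = ∑ i, ∑ j, C (M i j) * X i * X j := by
  choose c hc using fun i ↦ (hQ.pderiv (i := i)).exists_eq_sum_C_mul_X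
  have h := hQ.sum_X_mul_pderiv
  refine ⟨of fun i j ↦ (c i j + c j i) / 4, by ext i j; simp [add_comm], ?_⟩
  have h4 : (4 : MvPolynomial (Fin n) k) ≠ 0 := by simp
  refine mul_left_cancel₀ h4 ?_
  have h1 : (2 : ℕ) • Q = ∑ i, ∑ j, C (c i j) * X i * X j := by
    rw [← h]
    refine Finset.sum_congr rfl fun i _ ↦ ?_
    rw [hc i, Finset.mul_sum]
    exact Finset.sum_congr rfl fun j _ ↦ by ring
  have h2 : (2 : ℕ) • Q = ∑ i, ∑ j, C (c j i) * X i * X j := by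
    rw [h1, Finset.sum_comm]
    exact Finset.sum_congr rfl fun i _ ↦ Finset.sum_congr rfl fun j _ ↦ by ring
  have h3 : 4 * Q = 2 • Q + 2 • Q := by simp only [nsmul_eq_mul]; push_cast; ring
  rw [h3]
  nth_rw 1 [h1]
  rw [h2, ← Finset.sum_add_distrib, Finset.mul_sum]
  refine Finset.sum_congr rfl fun i _ ↦ ?_
  rw [← Finset.sum_add_distrib, Finset.mul_sum]
  refine Finset.sum_congr rfl fun j _ ↦ ?_
  have h5 : (4 : MvPolynomial (Fin n) k) * C ((c i j + c j i) / 4) = C (c i j) + C (c j i) := by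
    have : (4 : MvPolynomial (Fin n) k) = C 4 := (map_ofNat C 4).symm
    rw [this, ← C_mul, ← C_add]
    congr 1
    field_simp
  rw [of_apply, ← mul_assoc, ← mul_assoc, h5]
  ring

variable {K L : Type*} [Field K] [Field L] [Algebra K L]

/-- A linear change over `K` keeps all `v i / d` inside `E`, and since `v k = 1` the quotients of
these recover `v i`. -/
lemma adjoin_div_eq_top {n : ℕ} {v : Fin n → L} {k : Fin n} (hk : v k = 1)
    (htop : IntermediateField.adjoin K (Set.range v) = ⊤) (T : Matrix (Fin n) (Fin n) K)
    {a : Fin n → L} (ha : a ᵥ* T.map (algebraMap K L) = v) {d : L} (hd : d ≠ 0)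
    {E : IntermediateField K L} (hE : ∀ i, a i / d ∈ E) : E = ⊤ := by
  have h (i : Fin n) : v i / d ∈ E := by
    rw [← ha, vecMul, dotProduct, Finset.sum_div]
    refine sum_mem fun j _ ↦ ?_
    rw [mul_div_right_comm]
    exact mul_mem (hE j) (E.algebraMap_mem _)
  rw [eq_top_iff, ← htop, IntermediateField.adjoin_le_iff]
  rintro _ ⟨i, rfl⟩
  have h1 : v i = v i / d / (v k / d) := by rw [hk]; field_simp
  rw [h1]
  exact div_mem (h i) (h k)

/-- In the coordinates `a = v T⁻¹` the equation is `a₀² + a₁² = g a₂²`. If `a₂ = 0`, then `a₀ / a₁`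
is a root of `X² + 1`, and `L` would be algebraic over `K`; so division by `a₂` is allowed. -/
theorem exists_sq_add_sq_eq [CharZero K] {M : Matrix (Fin 3) (Fin 3) K} (hM : Mᵀ = M)
    (hdet : M.det ≠ 0) {u w : Fin 3 → K} (huw : u ≠ 0 ∨ w ≠ 0)
    (h1 : u ⬝ᵥ M *ᵥ u = w ⬝ᵥ M *ᵥ w) (h2 : u ⬝ᵥ M *ᵥ w = 0) {v : Fin 3 → L} {k : Fin 3}
    (hk : v k = 1) (hv : v ⬝ᵥ M.map (algebraMap K L) *ᵥ v = 0)
    (htop : IntermediateField.adjoin K (Set.range v) = ⊤) (hL : ¬ Algebra.IsAlgebraic K L) :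
    ∃ (g : K) (x y : L), g ≠ 0 ∧ x ^ 2 + y ^ 2 = algebraMap K L g ∧
      IntermediateField.adjoin K {x, y} = ⊤ := by
  obtain ⟨T, c, g, hT, hc, hg, h⟩ := exists_diagonal hM hdet huw h1 h2
  set TL := T.map (algebraMap K L) with hTL
  have hTL' : IsUnit TL.det := by
    have : TL.det = algebraMap K L T.det := (RingHom.map_det _ _).symm
    rw [this]
    exact (hT.isUnit).map _
  set a := v ᵥ* TL⁻¹ with ha
  have hav : a ᵥ* TL = v := by
    rw [ha, vecMul_vecMul, nonsing_inv_mul _ hTL', vecMul_one]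
  have hD : TL * M.map (algebraMap K L) * TLᵀ =
      (diagonal ![c, c, -c * g]).map (algebraMap K L) := by
    rw [← h, Matrix.map_mul, Matrix.map_mul, hTL, transpose_map]
  have ha0 : a ⬝ᵥ (diagonal ![c, c, -c * g]).map (algebraMap K L) *ᵥ a = 0 := by
    rw [← hD, ← mulVec_mulVec, ← mulVec_mulVec, mulVec_transpose, hav, dotProduct_mulVec, hav, hv]
  have hc' : algebraMap K L c ≠ 0 := by simpa using hc
  have hsum : a 0 ^ 2 + a 1 ^ 2 = algebraMap K L g * a 2 ^ 2 := by
    rw [diagonal_map (map_zero _)] at ha0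
    simp only [dotProduct, mulVec_diagonal, Fin.sum_univ_three] at ha0
    simp only [cons_val_zero, cons_val_one, cons_val, map_mul, map_neg] at ha0
    refine mul_left_cancel₀ hc' ?_
    linear_combination ha0
  have ha2 : a 2 ≠ 0 := by
    intro h0
    refine hL ?_
    have ha1 : a 1 ≠ 0 := by
      intro h1
      have h3 : a 0 = 0 := by simpa [h0, h1] using hsum
      have : a = 0 := by ext i; fin_cases i <;> simp [h0, h1, h3]
      rw [this, zero_vecMul] at hav
      simp [← hav] at hk
    have hal : IsAlgebraic K (a 0 / a 1) := by
      refine ⟨Polynomial.X ^ 2 + 1, Polynomial.Monic.ne_zero (by monicity!), ?_⟩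
      have : a 0 ^ 2 + a 1 ^ 2 = 0 := by simpa [h0] using hsum
      simp only [map_add, map_pow, Polynomial.aeval_X, map_one]
      rw [div_pow, div_add_one (pow_ne_zero 2 ha1), this, zero_div]
    have := adjoin_div_eq_top hk htop T hav ha1 (E := algebraicClosure K L) fun i ↦ by
      fin_cases i
      · exact mem_algebraicClosure_iff.mpr hal
      · simp [ha1]
      · simp [h0]
    exact ⟨fun s ↦ mem_algebraicClosure_iff.mp (this ▸ IntermediateField.mem_top)⟩
  refine ⟨g, a 0 / a 2, a 1 / a 2, hg, ?_, ?_⟩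
  · field_simp
    rw [hsum, mul_comm]
  · refine adjoin_div_eq_top hk htop T hav ha2 fun i ↦ ?_
    fin_cases i
    · exact IntermediateField.subset_adjoin _ _ (by simp)
    · exact IntermediateField.subset_adjoin _ _ (by simp)
    · simp [ha2]

end QuadraticForms

/-! ### Field-valued and infinitesimal points of conics -/

open Limits in
/-- A closed subscheme of `ℙⁿ_K` whose ideal on `D₊(x_j)` is generated by `Q / x_j ^ 2` contains
every point of `D₊(x_j)` at which `Q` vanishes. -/
theorem exists_comp_eq_projPoint {n : ℕ} {K : Type u} [Field K] {C : Scheme.{u}}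
    (i : C ⟶ projSpace n K) [IsClosedImmersion i] {Q : MvPolynomial (Fin (n + 1)) K}
    (hQ : Q.IsHomogeneous 2) (j : Fin (n + 1))
    (hker : RingHom.ker (i.app (Proj.basicOpen (grading n K) (X j))).hom =
      Ideal.span {chartEquation Q hQ j})
    {R : Type u} [CommRing R] [Algebra K R] (v : Fin (n + 1) → R) (hj : IsUnit (v j))
    (hv : aeval v Q = 0) : ∃ l : Spec (.of R) ⟶ C, l ≫ i = projPoint K j v hj := by
  set a := Proj.awayι (grading n K) (X j) (X_mem_grading n K j) one_pos with ha
  have hcl : IsClosedImmersion (pullback.snd i a) := inferInstance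
  obtain ⟨I, e, he⟩ := IsClosedImmersion.Spec_iff.mp hcl
  let p : Spec (.of (_ ⧸ I)) ⟶ C := e.inv ≫ pullback.fst _ _
  have hp' : p ≫ i = Spec.map (CommRingCat.ofHom (Ideal.Quotient.mk I)) ≫ a := by
    simp only [p, Category.assoc, pullback.condition, he, Iso.inv_hom_id_assoc]
  have hpr : p.opensRange = i ⁻¹ᵁ Proj.basicOpen (grading n K) (X j) := by
    ext1
    change Set.range p = i ⁻¹' (Proj.basicOpen (grading n K) (X j) : Set (projSpace n K))
    rw [Scheme.Hom.comp_base, TopCat.coe_comp, Set.range_comp,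
      Set.range_eq_univ.mpr e.inv.surjective, Set.image_univ,
      IsOpenImmersion.range_pullbackFst]
    rw [← Proj.opensRange_awayι _ _ (X_mem_grading n K j) one_pos]
    rfl
  -- A function on the chart that vanishes on `C` is a multiple of `Q / x_j²`, and that vanishes at
  -- `v`.
  have hI (t) (ht : t ∈ I) : chartHom K j v hj t = 0 := by
    have h1 := specMap_awayι_appLE (grading n K) (X_mem_grading n K j) one_pos
      (Ideal.Quotient.mk I) (le_specMap_awayι_preimage _ _ _ _) t
    rw [Ideal.Quotient.eq_zero_iff_mem.mpr ht, map_zero] at h1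
    have hle : ⊤ ≤ p ⁻¹ᵁ i ⁻¹ᵁ Proj.basicOpen (grading n K) (X j) := by
      rw [← hpr]; exact fun x _ ↦ ⟨x, rfl⟩
    have h2 : p.appLE _ ⊤ hle (i.app _ ((Proj.awayToSection (grading n K) (X j)).hom t)) = 0 := by
      rw [← h1, ← appLE_congr_hom hp' hle, Scheme.Hom.comp_appLE]
      rfl
    have hinj : Function.Injective (p.app (i ⁻¹ᵁ Proj.basicOpen (grading n K) (X j))) := by
      have := p.isIso_app (i ⁻¹ᵁ Proj.basicOpen (grading n K) (X j)) hpr.ge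
      exact (ConcreteCategory.bijective_of_isIso _).1
    have h3 : (Proj.awayToSection (grading n K) (X j)).hom t ∈ Ideal.span {chartEquation Q hQ j} := by
      rw [← hker]
      exact (map_eq_zero_iff _ (appLE_injective p _ hinj hle)).mp h2
    obtain ⟨s, hs⟩ := Ideal.mem_span_singleton.mp h3
    obtain ⟨s, rfl⟩ := (awayToSection_bijective (grading n K) (X_mem_grading n K j) one_pos).2 s
    have h4 := (awayToSection_bijective (grading n K) (X_mem_grading n K j) one_pos).1
      (hs.trans (map_mul (Proj.awayToSection (grading n K) (X j)).hom _ _).symm)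
    rw [h4, map_mul]
    refine mul_eq_zero_of_left ((hj.pow 2).mul_right_cancel ?_) _
    rw [zero_mul, ← hv]
    exact chartHom_mk (K := K) j v hj 2 Q _
  refine ⟨Spec.map (CommRingCat.ofHom (Ideal.Quotient.lift I (chartHom K j v hj) hI)) ≫ p, ?_⟩
  rw [Category.assoc, hp', ← Category.assoc, ← Spec.map_comp, ← CommRingCat.ofHom_comp,
    Ideal.Quotient.lift_comp_mk]
  rfl

lemma apply_dehom_eq_zero {n : ℕ} {K : Type u} [Field K] {C : Scheme.{u}}
    {i : C ⟶ projSpace n K} {Q : MvPolynomial (Fin (n + 1)) K}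
    (hQ : Q.IsHomogeneous 2) (j : Fin (n + 1))
    (hker : RingHom.ker (i.app (Proj.basicOpen (grading n K) (X j))).hom =
      Ideal.span {chartEquation Q hQ j})
    {R : Type u} [CommRing R] (l : Spec (.of R) ⟶ C)
    (θ : HomogeneousLocalization.Away (grading n K) (X j) →+* R)
    (h : l ≫ i = Spec.map (CommRingCat.ofHom θ) ≫
      Proj.awayι (grading n K) (X j) (X_mem_grading n K j) one_pos) :
    θ (dehom K j Q) = 0 := by
  have h1 := specMap_awayι_appLE (grading n K) (X_mem_grading n K j) one_pos
      θ (le_specMap_awayι_preimage _ _ _ _) (dehom K j Q)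
  have h2 : i.app _ ((Proj.awayToSection (grading n K) (X j)).hom (dehom K j Q)) = 0 := by
    rw [dehom_eq_mk j 2 Q ((mem_homogeneousSubmodule _ Q).mpr hQ)]
    exact RingHom.mem_ker.mp (hker.ge (Ideal.mem_span_singleton_self _))
  rw [← appLE_congr_hom h (h ▸ le_specMap_awayι_preimage _ _ _ _), Scheme.Hom.comp_appLE] at h1
  refine (map_eq_zero_iff _
    (ConcreteCategory.bijective_of_isIso (Scheme.ΓSpecIso (.of R)).inv).1).mp (h1.symm.trans ?_)
  exact (congrArg (l.appLE _ ⊤ _).hom h2).trans (map_zero (l.appLE _ ⊤ _).hom)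

/-- The images of the ratios `x_i / x_j` determine `θ` and serve as homogeneous coordinates with `v
j = 1`. -/
lemma eq_chartHom {n : ℕ} {K : Type u} [Field K] {L : Type u} [Field L] [Algebra K L]
    (j : Fin (n + 1)) (θ : HomogeneousLocalization.Away (grading n K) (X j) →+* L)
    (hθ : ∀ r, θ (dehom K j (C r)) = algebraMap K L r) :
    ∃ (v : Fin (n + 1) → L) (_ : v j = 1) (hj : IsUnit (v j)), θ = chartHom K j v hj ∧
      ∀ P, θ (dehom K j P) = aeval v P := by
  have hj : θ (dehom K j (X j)) = 1 := by rw [dehom_X_self, map_one]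
  have h (P) : θ (dehom K j P) = aeval (fun i ↦ θ (dehom K j (X i))) P := by
    have : θ.comp (dehom K j) =
        (aeval fun i ↦ θ (dehom K j (X i)) : MvPolynomial _ K →ₐ[K] L).toRingHom := by
      refine ringHom_ext (fun r ↦ ?_) fun i ↦ ?_
      · simp [hθ]
      · simp
    exact congrArg (· P) this
  refine ⟨fun i ↦ θ (dehom K j (X i)), hj, by simp [hj], RingHom.ext fun s ↦ ?_, h⟩
  obtain ⟨P, rfl⟩ := dehom_surjective j s
  rw [h, chartHom_dehom (K := K) (fun i ↦ θ (dehom K j (X i))) j (by simp [hj]) P]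
  simp [hj]

lemma awayι_str_eq {n : ℕ} {K : Type u} [Field K] (j : Fin (n + 1)) :
    Proj.awayι (grading n K) (X j) (X_mem_grading n K j) one_pos ≫ projSpaceStr n K =
      Spec.map (CommRingCat.ofHom ((dehom K j).comp C)) := by
  have h : (dehom K j).comp C = (HomogeneousLocalization.fromZeroRingHom (grading n K)
      (.powers (X j))).comp (algebraMap K (grading n K 0)) := RingHom.ext fun r ↦ dehom_C j r
  rw [h, projSpaceStr, Proj.awayι_toSpecZero_assoc, ← Spec.map_comp, ← CommRingCat.ofHom_comp]

/-- Every `L`-point of `ℙⁿ_K` over `K` has homogeneous coordinates. -/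
theorem exists_eq_projPoint {n : ℕ} {K : Type u} [Field K] {L : Type u} [Field L] [Algebra K L]
    (g : Spec (.of L) ⟶ projSpace n K)
    (hg : g ≫ projSpaceStr n K = Spec.map (CommRingCat.ofHom (algebraMap K L))) :
    ∃ (j : Fin (n + 1)) (v : Fin (n + 1) → L) (_ : v j = 1) (hj : IsUnit (v j)),
      g = projPoint K j v hj := by
  have hmem : g default ∈ (⊤ : (projSpace n K).Opens) := trivial
  rw [← iSup_basicOpen_X n K, TopologicalSpace.Opens.mem_iSup] at hmem
  obtain ⟨j, hj⟩ := hmem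
  set a := Proj.awayι (grading n K) (X j) (X_mem_grading n K j) one_pos with ha
  have hr : Set.range g ⊆ Set.range a := by
    rintro _ ⟨t, rfl⟩
    obtain rfl : t = default := Subsingleton.elim _ _
    rw [← Proj.opensRange_awayι _ _ (X_mem_grading n K j) one_pos] at hj
    exact hj
  have hl := IsOpenImmersion.lift_fac a g hr
  set l := IsOpenImmersion.lift a g hr
  obtain ⟨θ, hθ⟩ : ∃ θ, l = Spec.map (CommRingCat.ofHom θ) := ⟨(Spec.preimage l).hom, by simp⟩
  rw [hθ] at hl
  obtain ⟨v, hv1, hv, rfl, -⟩ := eq_chartHom j θ (fun r ↦ by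
    rw [← hl, Category.assoc, ha, awayι_str_eq, ← Spec.map_comp, ← CommRingCat.ofHom_comp] at hg
    exact congrArg (fun t ↦ t.hom r) (Spec.map_injective hg))
  exact ⟨j, v, hv1, hv, hl.symm⟩

/-! ### Differentials and dimension -/

section Differentials

open IntermediateField TensorProduct

/-- Modulo `dz` the universal derivation kills k(z), so it is k(z)-linear. In characteristic zero an
algebraic extension has no nonzero derivations over its base. -/
theorem span_D_eq_top {k L : Type*} [Field k] [CharZero k] [Field L] [Algebra k L] (z : L)
    [Algebra.IsAlgebraic k⟮z⟯ L] : Submodule.span L {KaehlerDifferential.D k L z} = ⊤ := by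
  set W := Submodule.span L {KaehlerDifferential.D k L z}
  let d : Derivation k L (Ω[L⁄k] ⧸ W) := (W.mkQ).compDer (KaehlerDifferential.D k L)
  have hd (s : L) : d s = W.mkQ (KaehlerDifferential.D k L s) := rfl
  have hz : d z = 0 := by
    rw [hd]
    exact (Submodule.Quotient.mk_eq_zero W).mpr (Submodule.mem_span_singleton_self _)
  have hK (s : L) (hs : s ∈ k⟮z⟯) : d s = 0 := by
    induction hs using IntermediateField.adjoin_induction with
    | mem x hx => rw [Set.mem_singleton_iff.mp hx, hz]
    | algebraMap r => exact d.map_algebraMap r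
    | add x y _ _ hx hy => rw [map_add, hx, hy, add_zero]
    | inv x _ hx => rw [Derivation.leibniz_inv, hx, smul_zero]
    | mul x y _ _ hx hy => rw [Derivation.leibniz, hx, hy, smul_zero, smul_zero, add_zero]
  let d' : Derivation k⟮z⟯ L (Ω[L⁄k] ⧸ W) := Derivation.mk'
    { toFun := d
      map_add' := map_add d
      map_smul' := fun r s ↦ by
        rw [Algebra.smul_def, Derivation.leibniz]
        refine (congrArg (_ + s • ·) (hK _ r.2)).trans ?_
        rw [smul_zero, add_zero]
        exact algebraMap_smul L r (d s) }
    fun a b ↦ d.leibniz a b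
  have hd' : d' = 0 := by
    have : Algebra.FormallyUnramified k⟮z⟯ L := Algebra.FormallyUnramified.of_isSeparable _ _
    have : Subsingleton (Ω[L⁄k⟮z⟯]) := this.1
    have := (Derivation.liftKaehlerDifferential_comp d').symm
    rw [this, Subsingleton.elim (Derivation.liftKaehlerDifferential d') 0]
    ext; rfl
  rw [eq_top_iff, ← KaehlerDifferential.span_range_derivation k L, Submodule.span_le]
  rintro _ ⟨s, rfl⟩
  have h : d s = 0 := congrArg (· s) hd'
  rw [hd] at h
  exact (Submodule.Quotient.mk_eq_zero W).mp h

/-- Localization is formally étale, so Ω of the fraction field is the base change of the free module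
Ω of `A`. -/
theorem finrank_kaehlerDifferential {k A L : Type*} [Field k] [CommRing A] [Algebra k A] [Field L]
    [Algebra k L] [Algebra A L] [IsScalarTower k A L] [IsFractionRing A L] (n : ℕ)
    [Algebra.IsStandardSmoothOfRelativeDimension n k A] : Module.finrank L (Ω[L⁄k]) = n := by
  have : Nontrivial A := (algebraMap A L).domain_nontrivial
  have : Algebra.IsStandardSmooth k A :=
    Algebra.IsStandardSmoothOfRelativeDimension.isStandardSmooth n
  have := Algebra.FormallyEtale.of_isLocalization (Rₘ := L) (nonZeroDivisors A)
  rw [← (KaehlerDifferential.tensorKaehlerEquivOfFormallyEtale k A L).finrank_eq,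
    Module.finrank_baseChange, Module.finrank,
    Algebra.IsStandardSmoothOfRelativeDimension.rank_kaehlerDifferential n, Cardinal.toNat_natCast]

/-- Otherwise the single differential `dz` would span a space of dimension two. This is the form in
which transcendence degree at least two is used. -/
theorem not_isAlgebraic_adjoin_simple {k A L : Type*} [Field k] [CharZero k] [CommRing A]
    [Algebra k A] [Field L] [Algebra k L] [Algebra A L] [IsScalarTower k A L] [IsFractionRing A L]
    [Algebra.IsStandardSmoothOfRelativeDimension 2 k A] (z : L) :
    ¬ Algebra.IsAlgebraic k⟮z⟯ L := by
  intro h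
  have h1 := span_D_eq_top (k := k) z
  have h2 := finrank_kaehlerDifferential (k := k) (A := A) (L := L) 2
  have h3 := finrank_span_le_card (R := L) {KaehlerDifferential.D k L z}
  rw [h1, finrank_top, h2] at h3
  simp at h3

/-- A first-order deformation of a point of a smooth `k`-algebra of dimension `n` involves at most
`n` independent directions. -/
theorem finrank_span_snd_le {k A K M : Type*} [Field k] [CommRing A] [Nontrivial A] [Algebra k A]
    {n : ℕ} [Algebra.IsStandardSmoothOfRelativeDimension n k A] [Field K] [AddCommGroup M]
    [Module K M] (φ : A →+* K) (d : A →+ M) (hd : ∀ a b, d (a * b) = φ a • d b + φ b • d a)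
    (hk : ∀ r, d (algebraMap k A r) = 0) :
    (Submodule.span K (Set.range d)).FG ∧ Module.finrank K (Submodule.span K (Set.range d)) ≤ n := by
  have : Algebra.IsStandardSmooth k A :=
    Algebra.IsStandardSmoothOfRelativeDimension.isStandardSmooth n
  let : Module A M := Module.compHom M φ
  have hsmul (a : A) (m : M) : a • m = φ a • m := rfl
  let : Module k M := Module.compHom M (φ.comp (algebraMap k A))
  have : IsScalarTower k A M := ⟨fun r a m ↦ by
    rw [Algebra.smul_def, mul_smul]; rfl⟩
  let D : Derivation k A M := Derivation.mk'
    { toFun := d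
      map_add' := map_add d
      map_smul' := fun r s ↦ by
        rw [Algebra.smul_def, hd, hk, smul_zero, add_zero]; rfl }
    hd
  have hrank := Algebra.IsStandardSmoothOfRelativeDimension.rank_kaehlerDifferential (R := k)
    (S := A) n
  have hfr : Module.finrank A (Ω[A⁄k]) = n := by rw [Module.finrank, hrank, Cardinal.toNat_natCast]
  have hfin : Module.Finite A (Ω[A⁄k]) := Module.finite_of_rank_eq_nat hrank
  let b := Module.finBasisOfFinrankEq A (Ω[A⁄k]) hfr
  have hle : Submodule.span K (Set.range d) ≤
      Submodule.span K (Set.range fun i ↦ D.liftKaehlerDifferential (b i)) := by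
    rw [Submodule.span_le]
    rintro _ ⟨a, rfl⟩
    have h1 : d a = D.liftKaehlerDifferential (KaehlerDifferential.D k A a) :=
      (D.liftKaehlerDifferential_comp_D a).symm
    rw [h1, ← b.sum_repr (KaehlerDifferential.D k A a), map_sum]
    refine sum_mem fun i _ ↦ ?_
    rw [map_smul, hsmul]
    exact Submodule.smul_mem _ _ (Submodule.subset_span ⟨i, rfl⟩)
  have hfin' : FiniteDimensional K
      (Submodule.span K (Set.range fun i ↦ D.liftKaehlerDifferential (b i))) :=
    FiniteDimensional.span_of_finite K (Set.finite_range _)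
  have := Submodule.finiteDimensional_of_le hle
  refine ⟨Module.Finite.iff_fg.mp this, (Submodule.finrank_mono hle).trans ?_⟩
  exact (finrank_range_le_card _).trans (by simp)

end Differentials

/-! ### Local points, preimmersions and smooth charts -/

section LocalRing

/-- Every point of `Spec N` specialises to the closed point, so an open set containing the image of
the closed point contains the whole image. -/
lemma exists_specMap_comp_eq_of_isLocalRing {P : Scheme.{u}} {A N : Type u} [CommRing A]
    [CommRing N] [IsLocalRing N] (l : Spec (.of N) ⟶ P) (a : Spec (.of A) ⟶ P)
    [IsOpenImmersion a] (h : l (IsLocalRing.closedPoint N) ∈ Set.range a) :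
    ∃ Ψ : A →+* N, Spec.map (CommRingCat.ofHom Ψ) ≫ a = l := by
  have hr : Set.range l ⊆ Set.range a := by
    rintro _ ⟨t, rfl⟩
    have hs : l t ⤳ l (IsLocalRing.closedPoint N) :=
      (IsLocalRing.specializes_closedPoint (R := N) t).map l.continuous
    exact hs.mem_open a.opensRange.2 h
  refine ⟨(Spec.preimage (IsOpenImmersion.lift a l hr)).hom, ?_⟩
  rw [CommRingCat.ofHom_hom, Spec.map_preimage, IsOpenImmersion.lift_fac]

/-- The ring of a chart around the image of a local point under a preimmersion `m` computes, up to
units, all values at that point of functions on the source of `m`. -/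
theorem exists_mul_eq_of_isPreimmersion {Z P P' : Scheme.{u}} {N A R : Type u} [CommRing N]
    [IsLocalRing N] [CommRing A] [CommRing R] (l : Spec (.of N) ⟶ Z) (m : Z ⟶ P)
    [IsPreimmersion m] (a : Spec (.of A) ⟶ P) [IsOpenImmersion a] (Ψ : A →+* N)
    (hΨ : Spec.map (CommRingCat.ofHom Ψ) ≫ a = l ≫ m) (i : Z ⟶ P') (b : Spec (.of R) ⟶ P')
    [IsOpenImmersion b] (θ : R →+* N) (hθ : Spec.map (CommRingCat.ofHom θ) ≫ b = l ≫ i) (r : R) :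
    ∃ α β, IsUnit (Ψ β) ∧ Ψ β * θ r = Ψ α := by
  set z := l (IsLocalRing.closedPoint N) with hz
  have hzU : z ∈ (m ⁻¹ᵁ a.opensRange ⊓ i ⁻¹ᵁ b.opensRange : Z.Opens) := by
    refine ⟨⟨Spec.map (CommRingCat.ofHom Ψ) (IsLocalRing.closedPoint N), ?_⟩,
      ⟨Spec.map (CommRingCat.ofHom θ) (IsLocalRing.closedPoint N), ?_⟩⟩
    · exact congrArg (fun t ↦ t (IsLocalRing.closedPoint N)) hΨ
    · exact congrArg (fun t ↦ t (IsLocalRing.closedPoint N)) hθ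
  -- An affine open of `Z` around the point maps into both charts. Its map to `Spec A` is still a
  -- preimmersion, and surjectivity on stalks writes functions on it as fractions from `A` near the
  -- point.
  obtain ⟨D, w, hw, hzw, hwU⟩ := Scheme.exists_affine_mem_range_and_range_subset hzU
  obtain ⟨δ, hδ⟩ := exists_specMap_comp_eq_of_isLocalRing (A := D) l w hzw
  have hwa : Set.range (w ≫ m) ⊆ Set.range a := by
    rintro _ ⟨t, rfl⟩; exact (hwU ⟨t, rfl⟩).1
  have hwb : Set.range (w ≫ i) ⊆ Set.range b := by
    rintro _ ⟨t, rfl⟩; exact (hwU ⟨t, rfl⟩).2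
  have hd := IsOpenImmersion.lift_fac a (w ≫ m) hwa
  have he := IsOpenImmersion.lift_fac b (w ≫ i) hwb
  obtain ⟨d, hd'⟩ : ∃ d, IsOpenImmersion.lift a (w ≫ m) hwa = Spec.map d := ⟨_, (Spec.map_preimage _).symm⟩
  obtain ⟨e, he'⟩ : ∃ e, IsOpenImmersion.lift b (w ≫ i) hwb = Spec.map e := ⟨_, (Spec.map_preimage _).symm⟩
  rw [hd'] at hd
  rw [he'] at he
  have hΨd : Ψ = δ.comp d.hom := by
    have : Spec.map (CommRingCat.ofHom Ψ) ≫ a = Spec.map (d ≫ CommRingCat.ofHom δ) ≫ a := by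
      rw [hΨ, Spec.map_comp, Category.assoc, hd, ← Category.assoc, hδ]
    rw [cancel_mono] at this
    exact congrArg CommRingCat.Hom.hom (Spec.map_injective this)
  have hθe : θ = δ.comp e.hom := by
    have : Spec.map (CommRingCat.ofHom θ) ≫ b = Spec.map (e ≫ CommRingCat.ofHom δ) ≫ b := by
      rw [hθ, Spec.map_comp, Category.assoc, he, ← Category.assoc, hδ]
    rw [cancel_mono] at this
    exact congrArg CommRingCat.Hom.hom (Spec.map_injective this)
  have hpre : IsPreimmersion (Spec.map d ≫ a) := by rw [hd]; infer_instance
  have hpre' : IsPreimmersion (Spec.map d) := IsPreimmersion.of_comp _ a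
  have hsurj := ((IsPreimmersion.SpecMap_iff d).mp hpre').2
  rw [RingHom.surjectiveOnStalks_iff_forall_ideal] at hsurj
  obtain ⟨x, y, c, hc, hy, h⟩ := hsurj ((IsLocalRing.maximalIdeal N).comap δ)
    (Ideal.comap_ne_top _ (IsLocalRing.maximalIdeal.isMaximal N).ne_top) (e r)
  have hu (t : D) (ht : t ∉ (IsLocalRing.maximalIdeal N).comap δ) : IsUnit (δ t) := by
    by_contra hn
    exact ht ((IsLocalRing.mem_maximalIdeal _).mpr hn)
  refine ⟨x, y, by rw [hΨd]; exact hu _ hy, ?_⟩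
  rw [hΨd, hθe]
  refine (hu c hc).mul_left_cancel ?_
  have := congrArg δ h
  simp only [map_mul] at this
  rw [← mul_assoc]
  exact this

end LocalRing

lemma exists_standardSmooth_chart {k : Type u} [Field k] {F : Scheme.{u}}
    (sF : F ⟶ Spec (.of k)) {n : ℕ} (hs : SmoothOfRelativeDimension n sF) (x : F) :
    ∃ (A : Type u) (_ : CommRing A) (_ : Algebra k A) (a : Spec (.of A) ⟶ F),
      IsOpenImmersion a ∧ x ∈ Set.range a ∧
      a ≫ sF = Spec.map (CommRingCat.ofHom (algebraMap k A)) ∧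
      Algebra.IsStandardSmoothOfRelativeDimension n k A := by
  obtain ⟨U, hU, V, hV, hx, e, h⟩ := hs.exists_isStandardSmoothOfRelativeDimension x
  have hUtop : U = ⊤ := by
    ext t
    obtain rfl : t = sF x := Subsingleton.elim (α := PrimeSpectrum k) _ _
    exact ⟨fun _ ↦ trivial, fun _ ↦ e hx⟩
  subst hUtop
  let φ : k →+* Γ(F, V) := ((Scheme.ΓSpecIso (.of k)).inv ≫ sF.appLE ⊤ V e).hom
  have hφ : φ.IsStandardSmoothOfRelativeDimension n := by
    refine RingHom.isStandardSmoothOfRelativeDimension_respectsIso.2 (sF.appLE ⊤ V e).hom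
      (Scheme.ΓSpecIso (.of k)).symm.commRingCatIsoToRingEquiv h
  refine ⟨Γ(F, V), inferInstance, φ.toAlgebra, hV.fromSpec, inferInstance, ?_, ?_, hφ⟩
  · rw [hV.range_fromSpec]; exact hx
  · rw [← IsAffineOpen.SpecMap_appLE_fromSpec sF (isAffineOpen_top _) hV e]
    rw [IsAffineOpen.fromSpec_top]
    change _ = Spec.map (_ ≫ _)
    rw [Spec.map_comp]
    congr 1
    rw [Scheme.isoSpec_Spec_inv]

/-! ### Regularity of the generic fibre -/

section Deformation

open Matrix

instance {K M : Type*} [Field K] [AddCommGroup M] [Module K M] [Module Kᵐᵒᵖ M]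
    [IsCentralScalar K M] : IsLocalRing (TrivSqZeroExt K M) := by
  refine .of_nonunits_add fun a b ha hb ↦ ?_
  simp only [mem_nonunits_iff, TrivSqZeroExt.isUnit_iff_isUnit_fst, isUnit_iff_ne_zero, not_not,
    TrivSqZeroExt.fst_add] at ha hb ⊢
  rw [ha, hb, add_zero]

/-- The vector `m` is the value on `ψ X` of a derivation of the rational function field `K`. -/
lemma exists_ringHom_trivSqZeroExt {k K M : Type*} [Field k] [Field K] [AddCommGroup M] [Module K M]
    [Module Kᵐᵒᵖ M] [IsCentralScalar K M] (ψ : Polynomial k →+* K) (hψ : Function.Injective ψ)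
    (hfrac : ∀ s, ∃ r t, ψ t ≠ 0 ∧ s * ψ t = ψ r) (m : M) :
    ∃ ι : K →+* TrivSqZeroExt K M, (∀ c, (ι c).fst = c) ∧ (ι (ψ Polynomial.X)).snd = m ∧
      ∀ r, (ι (ψ (Polynomial.C r))).snd = 0 := by
  let := ψ.toAlgebra
  have hψ' : algebraMap (Polynomial k) K = ψ := rfl
  have : FaithfulSMul (Polynomial k) K := (faithfulSMul_iff_algebraMap_injective _ _).mpr hψ
  have : IsFractionRing (Polynomial k) K := by
    refine IsFractionRing.of_field _ _ fun s ↦ ?_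
    obtain ⟨r, t, ht, h⟩ := hfrac s
    exact ⟨r, t, by rw [hψ', ← h, mul_div_cancel_right₀ _ ht]⟩
  -- Polynomials are evaluated at `X` plus the infinitesimal `m`; a nonzero denominator has nonzero
  -- first component and so becomes a unit.
  let g : Polynomial k →+* TrivSqZeroExt K M :=
    Polynomial.eval₂RingHom ((TrivSqZeroExt.inlHom K M).comp (ψ.comp Polynomial.C))
      (TrivSqZeroExt.inl (ψ Polynomial.X) + TrivSqZeroExt.inr m)
  have hg (p : Polynomial k) : (g p).fst = ψ p := by
    have : (TrivSqZeroExt.fstHom K K M).toRingHom.comp g = ψ := by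
      ext <;> simp [g]
    exact congrArg (· p) this
  have hu (t : nonZeroDivisors (Polynomial k)) : IsUnit (g t) := by
    rw [TrivSqZeroExt.isUnit_iff_isUnit_fst, hg, isUnit_iff_ne_zero]
    exact (map_ne_zero_iff ψ hψ).mpr (nonZeroDivisors.ne_zero t.2)
  refine ⟨IsLocalization.lift hu, fun c ↦ ?_, ?_, fun r ↦ ?_⟩
  · have : (TrivSqZeroExt.fstHom K K M).toRingHom.comp (IsLocalization.lift hu) = RingHom.id K := by
      refine IsLocalization.ringHom_ext (nonZeroDivisors (Polynomial k)) ?_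
      rw [RingHom.comp_assoc, IsLocalization.lift_comp]
      exact RingHom.ext hg
    exact congrArg (· c) this
  · rw [← hψ', IsLocalization.lift_eq]
    simp [g]
  · rw [← hψ', IsLocalization.lift_eq]
    simp [g]

/-- On the radical both the value and the linear variation of the form vanish, and the quadratic
term in `e` vanishes by `he`. So a singular point of a conic may be moved to first order in any
direction. -/
lemma sum_mul_add_mul_add_eq_zero {R : Type*} [CommRing R] {n : ℕ} (m : Fin n → Fin n → R)
    (p e : Fin n → R) (h1 : ∀ i, ∑ j, m i j * p j = 0) (h2 : ∀ j, ∑ i, m i j * p i = 0)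
    (he : ∀ i j, e i * e j = 0) :
    ∑ i, ∑ j, m i j * (p i + e i) * (p j + e j) = 0 := by
  have h (i j) : m i j * (p i + e i) * (p j + e j) =
      (p i + e i) * (m i j * p j) + e j * (m i j * p i) := by
    linear_combination m i j * he i j
  simp only [h, Finset.sum_add_distrib]
  rw [Finset.sum_comm (f := fun i j ↦ e j * (m i j * p i))]
  simp only [← Finset.mul_sum, h1, h2, mul_zero, Finset.sum_const_zero, add_zero]

/-- A plane conic over `k(t)` which is a locally closed subscheme of a smooth surface over `k` is
regular, hence defined by a nondegenerate form. -/
theorem det_ne_zero_of_isPreimmersion {k K : Type u} [Field k] [Field K] (ψ : Polynomial k →+* K)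
    (hψ : Function.Injective ψ) (hfrac : ∀ s, ∃ r t, ψ t ≠ 0 ∧ s * ψ t = ψ r)
    {F C : Scheme.{u}} {sF : F ⟶ Spec (.of k)} (hs : SmoothOfRelativeDimension 2 sF)
    (m : C ⟶ F) [IsPreimmersion m] (i : C ⟶ projSpace 2 K) [IsClosedImmersion i]
    (hcomm : m ≫ sF = i ≫ projSpaceStr 2 K ≫
      Spec.map (CommRingCat.ofHom (ψ.comp Polynomial.C)))
    {Q : MvPolynomial (Fin 3) K} (hQ : Q.IsHomogeneous 2)
    (hker : ∀ j, RingHom.ker (i.app (Proj.basicOpen (grading 2 K) (X j))).hom =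
      Ideal.span {chartEquation Q hQ j})
    {M : Matrix (Fin 3) (Fin 3) K} (hM : Mᵀ = M)
    (hQM : Q = ∑ i, ∑ j, MvPolynomial.C (M i j) * X i * X j) : M.det ≠ 0 := by
  intro hdet
  -- A vector in the radical is a singular `K`-point of the conic. A first-order deformation of it
  -- with three independent directions will contradict the dimension two of `F`.
  obtain ⟨p, hp, hMp⟩ := exists_mulVec_eq_zero_iff.mpr hdet
  obtain ⟨j, hj⟩ := Function.ne_iff.mp hp
  obtain ⟨ι, hι, hιX, hιC⟩ := exists_ringHom_trivSqZeroExt ψ hψ hfrac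
    (Pi.single j 1 : Fin 3 → K)
  let π : TrivSqZeroExt K (Fin 3 → K) →+* K := (TrivSqZeroExt.fstHom K K (Fin 3 → K)).toRingHom
  let d : TrivSqZeroExt K (Fin 3 → K) →+ (Fin 3 → K) :=
    (TrivSqZeroExt.sndHom K (Fin 3 → K)).toAddMonoidHom
  let N := TrivSqZeroExt K (Fin 3 → K)
  let alg : Algebra K N := ι.toAlgebra
  have halg (c : K) : @algebraMap K N _ _ alg c = ι c := rfl
  -- Direction `j` is already used by `ι`, which moves the parameter of `K`; the other two
  -- directions move the remaining coordinates of `p`. Adding nothing to the coordinate `j` keeps it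
  -- in the image of `ι`.
  let e (i : Fin 3) : N := if i = j then 0 else TrivSqZeroExt.inr (Pi.single i 1)
  let v (i : Fin 3) : N := ι (p i) + e i
  have hvj : v j = ι (p j) := by simp [v, e]
  have hu : IsUnit (v j) := by
    rw [hvj]; exact (isUnit_iff_ne_zero.mpr hj).map ι
  have he (a b) : e a * e b = 0 := by
    simp only [e]
    split_ifs
    · exact zero_mul _
    · exact zero_mul _
    · exact mul_zero _
    · exact TrivSqZeroExt.inr_mul_inr _ _ _
  have hMp' (a) : ∑ b, ι (M a b) * ι (p b) = 0 := by
    refine Eq.trans ?_ ((congrArg ι (congrFun hMp a)).trans (map_zero ι))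
    refine Eq.trans ?_ (map_sum ι (fun b ↦ M a b * p b) Finset.univ).symm
    exact Finset.sum_congr rfl fun b _ ↦ (map_mul ι _ _).symm
  have hv : @aeval K N (Fin 3) _ _ alg v Q = 0 := by
    rw [hQM]
    simp only [map_sum, map_mul, aeval_C, aeval_X, halg]
    refine sum_mul_add_mul_add_eq_zero (fun a b ↦ ι (M a b)) (fun a ↦ ι (p a)) e hMp'
      (fun b ↦ ?_) he
    rw [← hMp' b]
    exact Finset.sum_congr rfl fun a _ ↦ by rw [← hM, transpose_apply, hM]
  obtain ⟨l, hl⟩ := @exists_comp_eq_projPoint 2 K _ C i _ Q hQ j (hker j) N _ alg v hu hv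
  obtain ⟨A, _, _, a, ha, hla, has, hA⟩ :=
    exists_standardSmooth_chart sF hs ((l ≫ m) (IsLocalRing.closedPoint N))
  obtain ⟨Ψ, hΨ⟩ := exists_specMap_comp_eq_of_isLocalRing (l ≫ m) a hla
  have hΨk (r : k) : Ψ (algebraMap k A r) = ι (ψ (Polynomial.C r)) := by
    have h1 : Spec.map (CommRingCat.ofHom (algebraMap k A) ≫ CommRingCat.ofHom Ψ) =
        Spec.map (CommRingCat.ofHom (ψ.comp Polynomial.C) ≫ CommRingCat.ofHom ι) := by
      rw [Spec.map_comp, ← has, ← Category.assoc, hΨ, Category.assoc, hcomm, ← Category.assoc, hl,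
        Spec.map_comp, ← Category.assoc]
      exact congrArg (· ≫ _) (@projPoint_str 2 K _ N _ alg j v hu)
    exact congrArg (fun f ↦ f.hom r) (Spec.map_injective h1)
  -- `W` collects the directions seen by functions on `F`, at most two by smoothness. Since `m` is a
  -- preimmersion, functions on the conic are locally fractions of those on `F`, so `W` also
  -- contains every direction seen on the conic, which is all of `K³`.
  let W := Submodule.span K (Set.range fun s ↦ (Ψ s).snd)
  have hfr : (Submodule.span K (Set.range fun s ↦ (Ψ s).snd)).FG ∧ Module.finrank K W ≤ 2 := by
    have : Nontrivial A := Ψ.domain_nontrivial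
    refine finrank_span_snd_le (k := k) (π.comp Ψ) (d.comp Ψ.toAddMonoidHom)
      (fun s t ↦ ?_) fun r ↦ ?_
    · change (Ψ (s * t)).snd = (Ψ s).fst • (Ψ t).snd + (Ψ t).fst • (Ψ s).snd
      rw [map_mul, TrivSqZeroExt.snd_mul, op_smul_eq_smul]
    · change (Ψ (algebraMap k A r)).snd = 0
      rw [hΨk, hιC]
  have hWmul {s t : N} (hs : s.snd ∈ W) (ht : t.snd ∈ W) : (s * t).snd ∈ W := by
    rw [TrivSqZeroExt.snd_mul, op_smul_eq_smul]
    exact add_mem (W.smul_mem _ ht) (W.smul_mem _ hs)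
  let θ := @chartHom 2 K _ N _ alg j v hu
  have hθ (r) : (θ r).snd ∈ W := by
    obtain ⟨α, β, hβ, h⟩ := exists_mul_eq_of_isPreimmersion l m a Ψ hΨ i
      (Proj.awayι (grading 2 K) (X j) (X_mem_grading 2 K j) one_pos) θ hl.symm r
    have h2 := congrArg TrivSqZeroExt.snd h
    rw [TrivSqZeroExt.snd_mul, op_smul_eq_smul] at h2
    have hβ' : (Ψ β).fst ≠ 0 := by
      rwa [TrivSqZeroExt.isUnit_iff_isUnit_fst, isUnit_iff_ne_zero] at hβ
    refine (W.smul_mem_iff hβ').mp ?_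
    rw [eq_sub_of_add_eq h2]
    exact sub_mem (Submodule.subset_span ⟨α, rfl⟩)
      (W.smul_mem _ (Submodule.subset_span ⟨β, rfl⟩))
  have hιW (c : K) : (ι c).snd ∈ W := by
    have h1 := @chartHom_mk 2 K _ N _ alg j v hu 0 (MvPolynomial.C c)
      (by simp)
    rw [pow_zero, mul_one, aeval_C, halg] at h1
    rw [← h1]
    exact hθ _
  have hvW (b) : (v b).snd ∈ W := by
    have h1 := @chartHom_mk 2 K _ N _ alg j v hu 1 (X b) (by simpa using X_mem_grading 2 K b)
    rw [pow_one, aeval_X] at h1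
    rw [← h1]
    exact hWmul (hθ _) (hvj ▸ hιW _)
  have htop : W = ⊤ := by
    rw [eq_top_iff, ← (Pi.basisFun K (Fin 3)).span_eq, Submodule.span_le]
    rintro _ ⟨b, rfl⟩
    rw [Pi.basisFun_apply]
    by_cases hb : b = j
    · rw [hb, ← hιX]; exact hιW _
    · have h1 : (Pi.single b 1 : Fin 3 → K) = (v b).snd - (ι (p b)).snd := by
        change _ = (ι (p b) + e b).snd - _
        rw [TrivSqZeroExt.snd_add, add_sub_cancel_left]
        simp only [e, hb, if_false]
        rfl
      rw [h1]
      exact sub_mem (hvW b) (hιW _)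
  have := hfr.2
  rw [htop, finrank_top, Module.finrank_fin_fun] at this
  omega

end Deformation

/-! ### Function fields of the line and of the surface -/

open IntermediateField in
/-- The residue field of the generic point of `ℙ¹` is the field of rational functions in the
affine coordinate. -/
theorem exists_residueField_coordinate [IsIntegral (projSpace 1 ℝ)] {η : projSpace 1 ℝ}
    (hη : IsGenericPoint η Set.univ) :
    ∃ (_ : Algebra ℝ ((projSpace 1 ℝ).residueField η)) (t : (projSpace 1 ℝ).residueField η),
      Transcendental ℝ t ∧
      (∀ s, ∃ p r : Polynomial ℝ, Polynomial.aeval t r ≠ 0 ∧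
        s * Polynomial.aeval t r = Polynomial.aeval t p) ∧
      (projSpace 1 ℝ).fromSpecResidueField η = projPoint ℝ 1 ![t, 1] isUnit_one := by
  have hX : Transcendental ℝ (RatFunc.X : RatFunc ℝ) := RatFunc.transcendental_X
  -- The point `(X : 1)` over ℝ(X) identifies the residue field with a subfield containing `X`,
  -- hence with all of ℝ(X).
  obtain ⟨σ, hσ⟩ := exists_residueField_hom hX hη
  have hr := range_residueField_hom hX hη σ hσ
  have hbij : Function.Bijective σ := by
    refine ⟨σ.injective, fun s ↦ ?_⟩
    rw [← RingHom.mem_range, hr, RatFunc.adjoin_X]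
    exact (mem_top : s ∈ (⊤ : IntermediateField ℝ (RatFunc ℝ)))
  let e := RingEquiv.ofBijective σ hbij
  let alg : Algebra ℝ ((projSpace 1 ℝ).residueField η) :=
    (e.symm.toRingHom.comp (algebraMap ℝ (RatFunc ℝ))).toAlgebra
  let e' : RatFunc ℝ →ₐ[ℝ] (projSpace 1 ℝ).residueField η :=
    { e.symm.toRingHom with commutes' := fun r ↦ rfl }
  have he' (p : Polynomial ℝ) : Polynomial.aeval (e' RatFunc.X) p =
      e' (algebraMap (Polynomial ℝ) (RatFunc ℝ) p) := by
    rw [Polynomial.aeval_algHom_apply]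
    congr 1
    rw [← RatFunc.algebraMap_X, Polynomial.aeval_algebraMap_apply, Polynomial.aeval_X_left_apply]
  refine ⟨alg, e' RatFunc.X, fun h ↦ hX ((isAlgebraic_algHom_iff e' e'.injective).mp h), fun s ↦ ?_, ?_⟩
  · obtain ⟨p, r, hr0, h⟩ := IsFractionRing.div_surjective (A := Polynomial ℝ) (σ s)
    have hne : algebraMap (Polynomial ℝ) (RatFunc ℝ) r ≠ 0 :=
      IsFractionRing.to_map_ne_zero_of_mem_nonZeroDivisors hr0
    refine ⟨p, r, by rw [he']; exact (map_ne_zero e').mpr hne, ?_⟩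
    have hs : s = e' (σ s) := (e.symm_apply_apply s).symm
    rw [he', he', hs, ← map_mul, ← h, div_mul_cancel₀ _ hne]
  · have h1 := comp_projPoint (K := ℝ) e' 1 ![RatFunc.X, 1] isUnit_one
    have h2 : (fun i ↦ e' ((![RatFunc.X, 1] : Fin 2 → RatFunc ℝ) i)) = ![e' RatFunc.X, 1] := by
      ext i; fin_cases i <;> simp
    have h3 : projPoint ℝ 1 (fun i ↦ e' ((![RatFunc.X, 1] : Fin 2 → RatFunc ℝ) i))
        (isUnit_one.map e') = projPoint ℝ 1 ![e' RatFunc.X, 1] isUnit_one := by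
      congr 1
    have h4 : e'.toRingHom.comp σ = RingHom.id _ := RingHom.ext e.symm_apply_apply
    rw [hσ, ← Category.assoc, ← Spec.map_comp, ← CommRingCat.ofHom_comp, h4] at h1
    refine Eq.trans ?_ (h1.trans h3)
    exact (Category.id_comp _).symm.trans
      (congrArg (· ≫ (projSpace 1 ℝ).fromSpecResidueField η) (Spec.map_id _).symm)

/-- One equation without constant term in three unknowns has a nontrivial solution over the
algebraic closure. Nonemptiness is needed for `f` to be dominant. -/
lemma nonempty_of_isHomogeneous_two {K : Type u} [Field K] {C : Scheme.{u}} (i : C ⟶ projSpace 2 K)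
    [IsClosedImmersion i] {Q : MvPolynomial (Fin 3) K} (hQ : Q.IsHomogeneous 2)
    (hker : ∀ j, RingHom.ker (i.app (Proj.basicOpen (grading 2 K) (X j))).hom =
      Ideal.span {chartEquation Q hQ j}) :
    Nonempty C := by
  let R := AlgebraicClosure K
  obtain ⟨x, hx, h⟩ := exists_ne_zero_forall_eval_eq_zero (k := R)
    (fun _ : Fin 1 ↦ map (algebraMap K R) Q) (fun _ ↦ by
      have : (map (algebraMap K R) Q).IsHomogeneous 2 := hQ.map _
      rw [MvPolynomial.eval_zero, constantCoeff_eq]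
      exact this.coeff_eq_zero (by simp)) (by norm_num : 1 < 3)
  obtain ⟨j, hj⟩ := Function.ne_iff.mp hx
  obtain ⟨l, -⟩ := exists_comp_eq_projPoint i hQ j (hker j) x (isUnit_iff_ne_zero.mpr hj) (by
    have := h 0
    rwa [MvPolynomial.eval_map] at this)
  exact ⟨l default⟩

/-- Since `g ≫ i` is a preimmersion, every element of `L` is a quotient of values of functions on a
chart, that is, of polynomials in `v` over `K`. -/
theorem exists_coordinates {K : Type u} [Field K] {C : Scheme.{u}} (i : C ⟶ projSpace 2 K)
    [IsClosedImmersion i] {Q : MvPolynomial (Fin 3) K} (hQ : Q.IsHomogeneous 2)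
    (hker : ∀ j, RingHom.ker (i.app (Proj.basicOpen (grading 2 K) (X j))).hom =
      Ideal.span {chartEquation Q hQ j})
    {L : Type u} [Field L] [Algebra K L] (g : Spec (.of L) ⟶ C)
    [IsPreimmersion g]
    (hg : g ≫ i ≫ projSpaceStr 2 K = Spec.map (CommRingCat.ofHom (algebraMap K L))) :
    ∃ (k : Fin 3) (v : Fin 3 → L), v k = 1 ∧ aeval v Q = 0 ∧
      IntermediateField.adjoin K (Set.range v) = ⊤ := by
  obtain ⟨j, v, hv1, hj, h⟩ := exists_eq_projPoint (g ≫ i) ((Category.assoc _ _ _).trans hg)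
  have hv0 : v j ≠ 0 := hj.ne_zero
  have hdiv : (fun a ↦ v a / v j) = v := by simp [hv1]
  refine ⟨j, v, hv1, ?_, ?_⟩
  · have h1 := apply_dehom_eq_zero hQ j (hker j) g (chartHom K j v hj) h
    rwa [chartHom_dehom v j hv0, hdiv] at h1
  · rw [eq_top_iff]
    intro s _
    obtain ⟨α, β, hβ, hs⟩ := exists_mul_eq_of_isPreimmersion (𝟙 (Spec (.of L))) (g ≫ i)
      (Proj.awayι (grading 2 K) (X j) (X_mem_grading 2 K j) one_pos) (chartHom K j v hj)
      ((Category.id_comp _).trans h).symm (𝟙 _) (𝟙 (Spec (.of L))) (RingHom.id L)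
      (by simp) s
    have hmem (r) : chartHom K j v hj r ∈ IntermediateField.adjoin K (Set.range v) := by
      have h1 : chartHom K j v hj r ∈ ratioRing K v j := by
        rw [← range_chartHom v j hv0]; exact ⟨r, rfl⟩
      have h2 : chartHom K j v hj r ∈ Algebra.adjoin K (Set.range fun a ↦ v a / v j) := h1
      rw [hdiv] at h2
      exact IntermediateField.algebra_adjoin_le_adjoin _ _ h2
    have h3 : s = chartHom K j v hj α / chartHom K j v hj β := by
      rw [eq_div_iff hβ.ne_zero, ← hs, mul_comm]; rfl
    rw [h3]
    exact div_mem (hmem α) (hmem β)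

-- A smooth affine chart at the generic point embeds into its fraction field κ(ξ). Finite generation
-- serves the birational comparison, and two-dimensionality of the differentials shows that κ(ξ) is
-- not algebraic over any ℝ(z).
open IntermediateField in
theorem exists_isChart_fromSpecResidueField {F : Scheme.{0}} [IsIntegral F]
    (sF : F ⟶ Spec (.of ℝ)) (hs : SmoothOfRelativeDimension 2 sF) {ξ : F}
    (hξ : IsGenericPoint ξ Set.univ) [Algebra ℝ (F.residueField ξ)]
    (hq : F.fromSpecResidueField ξ ≫ sF =
      Spec.map (CommRingCat.ofHom (algebraMap ℝ (F.residueField ξ)))) :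
    (∃ (T : Subring (F.residueField ξ)) (c : Spec (.of T) ⟶ F) (E : Finset (F.residueField ξ)),
      IsChart (F.fromSpecResidueField ξ) T c ∧ HasFractions T ∧
      T = (Algebra.adjoin ℝ (E : Set (F.residueField ξ))).toSubring) ∧
    ∀ z : F.residueField ξ, ¬ Algebra.IsAlgebraic ℝ⟮z⟯ (F.residueField ξ) := by
  classical
  obtain ⟨A, _, _, a, ha, hξa, has, hA⟩ := exists_standardSmooth_chart sF hs ξ
  obtain ⟨φ, hφ, hfrac⟩ := exists_specMap_eq_fromSpecResidueField a ξ hξa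
  have hφk : φ.comp (algebraMap ℝ A) = algebraMap ℝ (F.residueField ξ) := by
    rw [← hφ, Category.assoc, has, ← Spec.map_comp] at hq
    exact congrArg CommRingCat.Hom.hom (Spec.map_injective hq)
  have hinj : Function.Injective φ := by
    have : Nonempty (Spec (.of A)) := ⟨hξa.choose⟩
    have := isIntegral_of_isOpenImmersion a
    have hA : IsDomain A := (affine_isIntegral_iff (.of A)).mp this
    have hdom : IsDominant (Spec.map (CommRingCat.ofHom φ) ≫ a) := by
      refine ⟨?_⟩
      rw [hφ, DenseRange, F.range_fromSpecResidueField]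
      exact dense_iff_closure_eq.mpr hξ
    have := isDominant_of_comp_isOpenImmersion (Spec.map (CommRingCat.ofHom φ)) a
    exact injective_of_isDominant_specMap φ
  refine ⟨?_, fun z ↦ ?_⟩
  · obtain ⟨c, hc, -, -⟩ := exists_isChart_of_injective φ hinj a hφ
    have : Algebra.IsStandardSmooth ℝ A :=
      Algebra.IsStandardSmoothOfRelativeDimension.isStandardSmooth 2
    obtain ⟨E, hE⟩ := (inferInstance : Algebra.FiniteType ℝ A).out
    let φ' : A →ₐ[ℝ] F.residueField ξ :=
      { φ with commutes' := fun r ↦ congrArg (· r) hφk }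
    refine ⟨φ.range, c, E.image φ, hc, fun s ↦ ?_, ?_⟩
    · obtain ⟨r, t, ht, h⟩ := hfrac s
      exact ⟨_, ⟨r, rfl⟩, _, ⟨t, rfl⟩, ht, h⟩
    · have h1 : φ'.range = Algebra.adjoin ℝ (E.image φ : Set (F.residueField ξ)) := by
        rw [← Algebra.map_top, ← hE, AlgHom.map_adjoin, Finset.coe_image]
        rfl
      rw [← h1]
      rfl
  · let := φ.toAlgebra
    have : FaithfulSMul A (F.residueField ξ) :=
      (faithfulSMul_iff_algebraMap_injective _ _).mpr hinj
    have : IsScalarTower ℝ A (F.residueField ξ) := .of_algebraMap_eq' hφk.symm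
    have : IsFractionRing A (F.residueField ξ) := by
      refine IsFractionRing.of_field _ _ fun s ↦ ?_
      obtain ⟨r, t, ht, h⟩ := hfrac s
      exact ⟨r, t, by
        change s = φ r / φ t
        rw [← h, mul_div_cancel_right₀ _ ht]⟩
    exact not_isAlgebraic_adjoin_simple (A := A) z

open IntermediateField in
/-- The descent of an equation `x ^ 2 + y ^ 2 = g` from an abstract rational function field `K`
to the subfield `ℝ⟮z⟯` of `L`. -/
lemma exists_sq_add_sq_eq_adjoin_simple {K L : Type*} [Field K] [Field L] [Algebra ℝ K]
    [Algebra K L] [Algebra ℝ L] [IsScalarTower ℝ K L] {t : K}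
    (hfrac : ∀ s : K, ∃ p r : Polynomial ℝ, Polynomial.aeval t r ≠ 0 ∧
      s * Polynomial.aeval t r = Polynomial.aeval t p)
    (ht : Transcendental ℝ t)
    (hL : ¬ Algebra.IsAlgebraic ℝ⟮algebraMap K L t⟯ L) {Q : MvPolynomial (Fin 3) K}
    (hQ : Q.IsHomogeneous 2)
    (hreg : ∀ M : Matrix (Fin 3) (Fin 3) K, M.transpose = M →
      Q = ∑ i, ∑ j, MvPolynomial.C (M i j) * X i * X j → M.det ≠ 0)
    {v : Fin 3 → L} {k : Fin 3} (hk : v k = 1) (hv : aeval v Q = 0)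
    (htop : adjoin K (Set.range v) = ⊤) :
    ∃ (g : ℝ⟮algebraMap K L t⟯) (x y : L), g ≠ 0 ∧ x ^ 2 + y ^ 2 = g ∧
      adjoin ℝ⟮algebraMap K L t⟯ {x, y} = (⊤ : IntermediateField ℝ⟮algebraMap K L t⟯ L) := by
  set z := algebraMap K L t with hz
  have hmem (s : K) : algebraMap K L s ∈ ℝ⟮z⟯ := by
    obtain ⟨p, r, hr, h⟩ := hfrac s
    refine (mem_adjoin_simple_iff ℝ _).mpr ⟨p, r, ?_⟩
    rw [hz, Polynomial.aeval_algebraMap_apply, Polynomial.aeval_algebraMap_apply, ← map_div₀, ← h,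
      mul_div_cancel_right₀ _ hr]
  let e : K →+* ℝ⟮z⟯ := (algebraMap K L).codRestrict ℝ⟮z⟯ hmem
  have hLK : ¬ Algebra.IsAlgebraic K L := by
    intro h
    let := e.toAlgebra
    have : IsScalarTower K ℝ⟮z⟯ L := .of_algebraMap_eq' rfl
    exact hL (Algebra.IsAlgebraic.tower_top (K := K) ℝ⟮z⟯)
  have hchar : CharZero K := charZero_of_injective_algebraMap (algebraMap ℝ K).injective
  obtain ⟨M, hM, hQM⟩ := hQ.exists_symmetric_matrix
  obtain ⟨u, w, huw, h1, h2⟩ := exists_isotropic_real ht hfrac hM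
  obtain ⟨g, x, y, hg, hxy, hadj⟩ := exists_sq_add_sq_eq hM (hreg M hM hQM) huw h1 h2 hk (by
    rw [hQM] at hv
    simp only [map_sum, map_mul, aeval_C, aeval_X] at hv
    rw [← hv]
    simp only [dotProduct, Matrix.mulVec, Finset.mul_sum, Matrix.map_apply]
    exact Finset.sum_congr rfl fun a _ ↦ Finset.sum_congr rfl fun b _ ↦ by ring) htop hLK
  refine ⟨e g, x, y, (map_ne_zero e).mpr hg, hxy, ?_⟩
  rw [eq_top_iff]
  intro s _
  have hs : s ∈ adjoin K {x, y} := hadj ▸ mem_top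
  induction hs using adjoin_induction with
  | mem s hs => exact subset_adjoin _ _ hs
  | algebraMap r => exact IntermediateField.algebraMap_mem _ (e r)
  | add a b _ _ ha hb => exact add_mem (ha mem_top) (hb mem_top)
  | inv a _ ha => exact inv_mem (ha mem_top)
  | mul a b _ _ ha hb => exact mul_mem (ha mem_top) (hb mem_top)

/-- `ξ` specialises to a point of the fibre, so `f ξ` specialises to `η`; conversely `η` specialises
to every point. -/
lemma apply_eq_of_nonempty_fiber {F B : Scheme.{u}} (f : F ⟶ B) {η : B}
    (hη : IsGenericPoint η Set.univ)
    {ξ : F} (hξ : IsGenericPoint ξ Set.univ) (h : Nonempty (f.fiber η)) : f ξ = η := by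
  obtain ⟨c⟩ := h
  have h1 : f (f.fiberι η c) = η := by
    have : f.fiberι η c ∈ f ⁻¹' {η} := by rw [← f.range_fiberι]; exact ⟨c, rfl⟩
    exact this
  have h2 : f ξ ⤳ η := by
    rw [← h1]
    exact (hξ.specializes (Set.mem_univ _)).map f.continuous
  exact (h2.antisymm (hη.specializes (Set.mem_univ _))).eq

end RealConic

end

/-! ### The normal form of a real conic fibration -/

theorem mainTheorem10 {F : Scheme.{0}} (sF : F ⟶ Spec (CommRingCat.of ℝ))
    (f : F ⟶ RealConic.projSpace 1 ℝ)
    (hf : RealConic.IsConicFibration ℝ sF (RealConic.projSpaceStr 1 ℝ) f) :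
    ∃ (m : ℕ) (a : Fin (2 * m) → ℝ) (ε : ℝ),
      Function.Injective a ∧ (ε = 1 ∨ ε = -1) ∧
      ∃ (F' : Scheme.{0}) (sF' : F' ⟶ Spec (CommRingCat.of ℝ))
        (f' : F' ⟶ RealConic.projSpace 1 ℝ),
        RealConic.IsConicFibration ℝ sF' (RealConic.projSpaceStr 1 ℝ) f' ∧
        RealConic.HasStandardAffineEquation sF' f' ε a ∧
        RealConic.BirationalConicFibrations ℝ sF (RealConic.projSpaceStr 1 ℝ) f
          sF' (RealConic.projSpaceStr 1 ℝ) f' := by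
  open RealConic in
  have := hf.surface.integral
  have := hf.curve.integral
  obtain ⟨η, hη, Q, hQ, i, -, hi, hcomm, hker⟩ := hf.genericFiber
  obtain ⟨_, t, ht, hfrac, hηt⟩ := exists_residueField_coordinate hη
  have hstr : (projSpace 1 ℝ).fromSpecResidueField η ≫ projSpaceStr 1 ℝ =
      Spec.map (CommRingCat.ofHom (algebraMap ℝ ((projSpace 1 ℝ).residueField η))) :=
    (congrArg (· ≫ _) hηt).trans (projPoint_str 1 _ _)
  let ξ := genericPoint F
  have hξ : IsGenericPoint ξ Set.univ := genericPoint_spec F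
  have hfξ : f ξ = η := apply_eq_of_nonempty_fiber f hη hξ
    (nonempty_of_isHomogeneous_two i hQ hker)
  obtain ⟨σ, hσ⟩ := exists_specMap_residueField (L := F.residueField ξ) (η := η)
    (F.fromSpecResidueField ξ ≫ f) default
    ((congrArg f (F.fromSpecResidueField_apply ξ _)).trans hfξ)
  let := σ.toAlgebra
  let : Algebra ℝ (F.residueField ξ) :=
    (σ.comp (algebraMap ℝ ((projSpace 1 ℝ).residueField η))).toAlgebra
  have : IsScalarTower ℝ ((projSpace 1 ℝ).residueField η) (F.residueField ξ) :=
    .of_algebraMap_eq' rfl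
  have hq : F.fromSpecResidueField ξ ≫ sF =
      Spec.map (CommRingCat.ofHom (algebraMap ℝ (F.residueField ξ))) := by
    rw [← hf.comm, ← Category.assoc]
    refine (congrArg (· ≫ projSpaceStr 1 ℝ) hσ).trans ?_
    rw [Category.assoc, hstr, ← Spec.map_comp]
    rfl
  obtain ⟨⟨T, c, E, hc, hT, hE⟩, hL⟩ :=
    exists_isChart_fromSpecResidueField sF hf.surface.smooth hξ hq
  let z : F.residueField ξ := σ t
  have hz : Transcendental ℝ z := fun h ↦
    ht ((isAlgebraic_algebraMap_iff σ.injective).mp h)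
  have hqf : F.fromSpecResidueField ξ ≫ f = projPoint ℝ 1 ![z, 1] isUnit_one := by
    refine hσ.trans ((congrArg (Spec.map (CommRingCat.ofHom σ) ≫ ·) hηt).trans ?_)
    refine (comp_projPoint (K := ℝ) (IsScalarTower.toAlgHom ℝ _ (F.residueField ξ)) 1
      ![t, 1] isUnit_one).trans ?_
    congr 1
    ext i; fin_cases i
    · rfl
    · exact map_one _
  -- The generic point of `F` lies on the generic fibre. As a point of the fibre it is again a
  -- preimmersion, so its coordinates on the conic generate the function field.
  let g : Spec (.of (F.residueField ξ)) ⟶ f.fiber η :=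
    Limits.pullback.lift (F.fromSpecResidueField ξ) (Spec.map (CommRingCat.ofHom σ)) hσ
  have hg1 : g ≫ f.fiberι η = F.fromSpecResidueField ξ := Limits.pullback.lift_fst _ _ _
  have hg2 : g ≫ f.fiberToSpecResidueField η = Spec.map (CommRingCat.ofHom σ) :=
    Limits.pullback.lift_snd _ _ _
  have : IsPreimmersion (g ≫ f.fiberι η) :=
    hg1 ▸ (inferInstance : IsPreimmersion (F.fromSpecResidueField ξ))
  have : IsPreimmersion g := IsPreimmersion.of_comp g (f.fiberι η)
  obtain ⟨k, v, hk, hv, htop⟩ := exists_coordinates i hQ hker g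
    ((congrArg (g ≫ ·) hcomm).trans hg2)
  have hinj := transcendental_iff_injective.mp ht
  obtain ⟨w, x, y, hw, hxy, hadj⟩ := exists_sq_add_sq_eq_adjoin_simple hfrac ht (hL z) hQ
    (fun M hM hQM ↦ det_ne_zero_of_isPreimmersion (k := ℝ) (Polynomial.aeval t).toRingHom hinj
      (fun s ↦ by
        obtain ⟨p, r, h⟩ := hfrac s
        exact ⟨p, r, h⟩) hf.surface.smooth (f.fiberι η) i (by
        have h1 : (Polynomial.aeval t).toRingHom.comp Polynomial.C =
            algebraMap ℝ ((projSpace 1 ℝ).residueField η) :=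
          RingHom.ext fun r ↦ Polynomial.aeval_C t r
        rw [h1, ← hf.comm, ← Category.assoc, f.fiber_fac, Category.assoc, hstr, ← hcomm,
          Category.assoc]) hQ hker hM hQM) hk hv htop
  obtain ⟨t', m, a, ε, x', y', ht', ha, hε, hstd, hadj'⟩ :=
    exists_isStandardPoint hz (hL z) hw hxy hadj
  -- The base coordinate is unchanged in even degree and replaced by `1 / (z - r)` in odd degree.
  obtain ⟨τ, hτ, hτz⟩ : ∃ τ : projSpace 1 ℝ ≅ projSpace 1 ℝ,
      τ.hom ≫ projSpaceStr 1 ℝ = projSpaceStr 1 ℝ ∧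
      projPoint ℝ 1 ![z, 1] isUnit_one ≫ τ.hom = projPoint ℝ 1 ![t', 1] isUnit_one := by
    rcases ht' with rfl | ⟨r, hr⟩
    · exact ⟨Iso.refl _, Category.id_comp _, Category.comp_id _⟩
    · exact exists_iso_projLine hz hstd.transcendental_z r hr
  exact exists_birational_standardModel (L := F.residueField ξ) hf hc hT E hE hq τ hτ
    ((Category.assoc _ _ _).symm.trans ((congrArg (· ≫ τ.hom) hqf).trans hτz)) ha hε hstd hadj'
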